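/- **Lemma (cost to block encode $\nabla V$ for the Lennard-Jones potential).** Let $V(r)=4\varepsilon\big((\sigma/r)^{12}-(\sigma/r)^{6}\big)$ be the two-particle Lennard-Jones potential with fixed $\varepsilon,\sigma>0$, and fix $\kappa>0$. Consider two particles in $[0,1]^d$, $d\ge 1$, on a grid with $N=2^n$ points per dimension, $n\ge1$. A configuration is a pair $(\alpha^0,\alpha^1)$ of grid indices in $\{0,\dots,N-1\}^d$, stored in binary in $2dn$ system qubits, with squared distance $R^2(\alpha^0,\alpha^1)=\sum_{k}\big(\tfrac{\alpha^0_k-\alpha^1_k}{N-1}\big)^2$. Let $a\ge 1$, let the $2a$-point central first-derivative stencil have coefficients $$c_l=\frac{(-1)^{l+1}(a!)^2}{l\,(a-|l|)!\,(a+|l|)!}\qquad(1\le|l|\le a),\qquad \beta=\sum_{1\le |l|\le a}|c_l| ,$$ and let $p\in\{2a-1,2a,2a+1\}$ (the statement holds for each of these conventions for the order of the stencil). For a polynomial $\widetilde V$ and $i\in\{0,1\}$ let $\partial^i_k\widetilde V$ be the diagonal operator with entries $$\partial^i_k\widetilde V(\alpha^0,\alpha^1)=\sum_{1\le|l|\le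 a}c_l\,\widetilde V\big(R^2_{(i,k,l)}(\alpha^0,\alpha^1)\big),$$ where $R^2_{(i,k,l)}$ is $R^2$ evaluated after replacing $\alpha^i_k$ by $\alpha^i_k+l \bmod N$, and let $\nabla^i\widetilde V=\sum_{k}\partial^i_k\widetilde V\otimes|k\rangle$, where $|k\rangle$ is a basis state of an output register of $\lceil\log_2 d\rceil$ qubits. There is a constant $C>0$, depending only on $\varepsilon,\sigma,\kappa$, such that for all $n,d,a,p$ as above there is a real polynomial $\widetilde V$ with the following properties. 1. (QSP approximation with cutoff $\delta=\kappa/N$.) The even polynomial $y\mapsto\widetilde V(4dy^2)$ has degree at most $C\sqrt d\,pN\log_2N$ and satisfies $|\widetilde V(4dy^2)|\le C N^{12}$ for $y\in[-1,1]$; moreover $|\widetilde V(r^2)-V(r)|\le N^{-(2a+1)}$ for all $r\in[\delta,2\sqrt d]$. 2. For each particle $i\in\{0,1\}$ there is a quantum circuit $U$ consisting of at most $C\,d^2p^2N\log_2^2N$ Toffoli or simpler gates (Toffoli, CNOT, arbitrary one-qubit unitaries), with exactly $\lceil\log_2(n+1)\rceil+2\lceil\log_2 d\rceil+\lceil\log_2p\rceil+4$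 ancilla qubits (the output register included), that is an exact block encoding of $\nabla^i\widetilde V$ with a subnormalization $0<\lambda\le C\,\beta\,dN^{12}$: with all ancillas initialized in $|0\rangle$ and all of them except the output register projected onto $|0\rangle$ at the end, $U$ acts on the system as $\lambda^{-1}\,\nabla^i\widetilde V$. -/

import Mathlib

open scoped Nat

noncomputable section

namespace LJGradient

/-! ### Qubits, gates and circuits

A computational basis state of a register with wires `W` is a function `W → Fin 2`. -/

/-- "Toffoli or simpler" gates on the wires `W`: arbitrary one-qubit unitaries, `CNOT` and the
Toffoli gate. -/
inductive Gate (W : Type) : Type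
  | single (w : W) (u : Matrix.unitaryGroup (Fin 2) ℂ) : Gate W
  | cnot (c t : W) (h : c ≠ t) : Gate W
  | toffoli (c₁ c₂ t : W) (h₁₂ : c₁ ≠ c₂) (h₁ : c₁ ≠ t) (h₂ : c₂ ≠ t) : Gate W

/-- The matrix of a gate on the whole register. Arithmetic in `Fin 2` is modulo 2. -/
def Gate.toMatrix {W : Type} [Fintype W] [DecidableEq W] :
    Gate W → Matrix (W → Fin 2) (W → Fin 2) ℂ
  | .single w u => Matrix.of fun x y =>
      if ∀ v, v ≠ w → x v = y v then (u : Matrix (Fin 2) (Fin 2) ℂ) (x w) (y w) else 0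
  | .cnot c t _ => Matrix.of fun x y => if x = Function.update y t (y t + y c) then 1 else 0
  | .toffoli c₁ c₂ t _ _ _ => Matrix.of fun x y =>
      if x = Function.update y t (y t + y c₁ * y c₂) then 1 else 0

/-- A circuit is a list of gates, the head being applied first; its gate count is its length. -/
abbrev Circuit (W : Type) : Type := List (Gate W)

/-- The matrix implemented by a circuit. -/
def Circuit.toMatrix {W : Type} [Fintype W] [DecidableEq W] :
    Circuit W → Matrix (W → Fin 2) (W → Fin 2) ℂ
  | [] => 1
  | g :: c => Circuit.toMatrix c * g.toMatrix

/-! ### Block encodings -/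

/-- The basis state with `q` flag ancillas in state `f`, the `m`-qubit output register in state
`z` and the system in state `s`. -/
def joinState {q m : ℕ} {S : Type} (f : Fin q → Fin 2) (z : Fin m → Fin 2) (s : S → Fin 2) :
    (Fin q ⊕ Fin m) ⊕ S → Fin 2 :=
  Sum.elim (Sum.elim f z) s

/-- Exact block encoding with subnormalization `lam` and `q + m` ancilla qubits of an operator
`A` from the system into (output register) ⊗ (system): all ancillas start in `|0⟩`, and the `q`
flag ancillas are projected on `|0⟩` at the end, i.e.
`lam • (⟨0|_q ⊗ I_m ⊗ I_S) U (|0⟩_q ⊗ |0⟩_m ⊗ I_S) = A`.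
For `m = 0` this is the usual `(lam, q)` block encoding of a square matrix. -/
def IsBlockEncoding {q m : ℕ} {S : Type} [Fintype S] [DecidableEq S] (lam : ℝ)
    (U : Matrix ((Fin q ⊕ Fin m) ⊕ S → Fin 2) ((Fin q ⊕ Fin m) ⊕ S → Fin 2) ℂ)
    (A : Matrix ((Fin m → Fin 2) × (S → Fin 2)) (S → Fin 2) ℂ) : Prop :=
  U ∈ Matrix.unitaryGroup ((Fin q ⊕ Fin m) ⊕ S → Fin 2) ℂ ∧
    ∀ (z : Fin m → Fin 2) (s s' : S → Fin 2),
      (lam : ℂ) * U (joinState 0 z s) (joinState 0 0 s') = A (z, s) s'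

/-! ### Two particles on a grid with `N = 2 ^ n` points per dimension -/

/-- Grid positions of two particles in `d` dimensions. -/
abbrev Config (d n : ℕ) : Type := Fin 2 → Fin d → Fin (2 ^ n)

/-- System wires: particle, spatial dimension, binary digit. -/
abbrev SysWire (d n : ℕ) : Type := Fin 2 × Fin d × Fin n

/-- The configuration encoded in binary by a basis state of the system
(digit `b` has weight `2 ^ b`). -/
def decode {d n : ℕ} (s : SysWire d n → Fin 2) : Config d n :=
  fun i k => finFunctionFinEquiv (fun b => s (i, k, b))

/-- The point of `[0, 1]` represented by a grid index: `i / (N - 1)`. -/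
def position {n : ℕ} (i : Fin (2 ^ n)) : ℝ := ((i : ℕ) : ℝ) / ((2 : ℝ) ^ n - 1)

/-- Squared Euclidean distance of the two particles. -/
def sqDist {d n : ℕ} (c : Config d n) : ℝ :=
  ∑ k : Fin d, (position (c 0 k) - position (c 1 k)) ^ 2

/-- Shift coordinate `k` of particle `i` by `l` grid points, modulo `N`. (`finRotate` is the
modular increment.) -/
def shift {d n : ℕ} (i : Fin 2) (k : Fin d) (l : ℤ) (c : Config d n) : Config d n :=
  Function.update c i (Function.update (c i) k ((finRotate (2 ^ n) ^ l) (c i k)))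

/-! ### Finite differences and the potential -/

/-- Central difference coefficients of the first derivative on the `2 a` points
`±1, …, ±a` (for grid spacing one). -/
def fdCoeff (a : ℕ) (l : ℤ) : ℝ :=
  if l = 0 ∨ a < l.natAbs then 0
  else (-1) ^ (l.natAbs + 1) * ((a ! : ℕ) : ℝ) ^ 2 /
    ((l : ℝ) * (((a - l.natAbs)! : ℕ) : ℝ) * (((a + l.natAbs)! : ℕ) : ℝ))

/-- The `ℓ¹`-norm of the stencil coefficients. -/
def fdNorm (a : ℕ) : ℝ := ∑ l ∈ Finset.Icc (-(a : ℤ)) a, |fdCoeff a l|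

/-- The Lennard-Jones pair potential as a function of the distance. -/
def lennardJones (ε σ r : ℝ) : ℝ := 4 * ε * ((σ / r) ^ 12 - (σ / r) ^ 6)

/-- Admissible approximations, as delivered by quantum signal processing, of a radial potential
`V` in `d` dimensions with cutoff `δ`. The approximation is `W` evaluated at the squared distance,
which is `4 * d * y ^ 2` for a block-encoded normalized distance `y`; so `y ↦ W (4 * d * y ^ 2)`
is an even polynomial, required to have degree at most `D`, to be bounded by `B` on `[-1, 1]`,
and to agree with `V` up to `tol` at all distances beyond the cutoff. -/
def IsQSPApprox (V : ℝ → ℝ) (d : ℕ) (δ tol B D : ℝ) (W : Polynomial ℝ) : Prop :=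
  ((2 * W.natDegree : ℕ) : ℝ) ≤ D ∧
  (∀ y : ℝ, -1 ≤ y → y ≤ 1 → |W.eval (4 * d * y ^ 2)| ≤ B) ∧
  (∀ r : ℝ, δ ≤ r → r ≤ 2 * √(d : ℝ) → |W.eval (r ^ 2) - V r| ≤ tol)

/-- The finite-difference partial derivative of `W (r²)` in direction `k` of particle `i`, as a
function of the configuration (in units of the inverse grid spacing). -/
def fdPartial {d n : ℕ} (a : ℕ) (W : Polynomial ℝ) (i : Fin 2) (k : Fin d)
    (c : Config d n) : ℝ :=
  ∑ l ∈ Finset.Icc (-(a : ℤ)) a, fdCoeff a l * W.eval (sqDist (shift i k l c))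

/-- The gradient with respect to particle `i`, as the operator `∑ k, ∂ₖ W ⊗ |k⟩` where each
`∂ₖ W` is a diagonal matrix and `k` is held in binary by an output register of `⌈log₂ d⌉`
qubits. -/
def fdGradient {d n : ℕ} (a : ℕ) (W : Polynomial ℝ) (i : Fin 2) :
    Matrix ((Fin (Nat.clog 2 d) → Fin 2) × (SysWire d n → Fin 2)) (SysWire d n → Fin 2) ℂ :=
  Matrix.of fun zs s' =>
    if h : (finFunctionFinEquiv zs.1 : ℕ) < d then
      if zs.2 = s' then ((fdPartial a W i ⟨_, h⟩ (decode s') : ℝ) : ℂ) else 0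
    else 0

end LJGradient

end

/-!
The block encoding has five ingredients, each with an explicit gate count.

*The polynomial.* The Dirichlet kernel `D` of order `m` gives a polynomial `s(t) = (1 - D²) / t`
of degree `O(m)`, bounded by `4 m²` and comparable to `1 / t` as soon as `t` is of order `m⁻²`.
Let `x⁶ A(x)` be the probability that a binomial variable with success probability `x` exceeds
about a quarter of the number of trials; it is exponentially close to `1` for `x ≥ 3 / 4`. Then
`s⁶ A(t s)` is bounded by `O(m¹²)` on `[0, 1]` and approximates `t⁻⁶` beyond the cutoff, with a
relative error decreasing geometrically in the degree of `A` (`exists_inv_pow_six_approx`). For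
`t = r² / (4 d)` and `m` of order `√d N`, its product with a multiple of `σ¹² - σ⁶ r⁶` approximates
the Lennard-Jones potential (`exists_isQSPApprox_lennardJones`).

*The distance.* An operator `U` prepares a superposition over directions, particles and binary
digits, with amplitude proportional to `√(2 ^ t)` for the digit of weight `2 ^ t`, and multiplies
it by the sign `(-1) ^ (particle + value of the digit)`, found by a table lookup
(`exists_select_sign`). Undoing the preparation of particle and digit leaves the coordinate
differences as amplitudes. Hence the projections `Π₁` and `Π₂` on the zero states of all of these
registers and of the particle and digit register satisfy `Π₁ Uᴴ Π₂ U Π₁ = (R² / d) Π₁`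
(`exists_distance_overlap`). No arithmetic on the coordinates is needed.

*Signal processing.* Alternating the reflections in `Π₁` and in `Uᴴ Π₂ U` gives a unitary whose
hermitian part is `2 R² / d - 1` on the range of `Π₁`. For a real polynomial `Q` with `|Q| < 1` on
`[-1, 1]`, the Fejér–Riesz theorem (`exists_normSq_eq_eval_re`) supplies a complementary polynomial,
and layer stripping (`exists_signal_sequence`) writes the pair as an alternating product of
one-qubit rotations and controlled signal unitaries, so `Q (2 R² / d - 1)` is block encoded with
one further ancilla (`exists_polynomial_blockEncoding`).

*The stencil.* The finite difference is the linear combination of the conjugates of this operator by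
modular shifts of one coordinate. The points of the stencil are held in superposition in a register
with amplitudes `√(|c_l| / β)`, the sign of `c_l` being put into one of the two preparations. The
modular addition uses no workspace: each bit of the sum is flipped under control of the lower bits
and of the direction and stencil registers, the highest bit being treated first
(`HasGateCount.triangular_flip`). This costs `O(d p N)` gates per addition and no ancillas.

*The direction.* The output register is prepared in the uniform superposition of the directions,
which selects the coordinate to be shifted and gives the subnormalization
`√d β Λ`, where `Λ` is twice the bound on the polynomial (`exists_gradient_circuit`).

State preparations and diagonal operators are reduced to multiplexed rotations, whose gate count is
exponential in the number of controls (`HasGateCount.mux_rotation`). All control registers have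
logarithmic size, except for the digits of one coordinate, where the exponential is `N`.
-/

noncomputable section

namespace LJGradient

set_option linter.unusedSectionVars false

/-! ### A polynomial approximation of the Lennard-Jones potential -/

section Approximation

open Polynomial

lemma abs_sin_nat_mul_le (k : ℕ) (θ : ℝ) : |Real.sin (k * θ)| ≤ k * |Real.sin θ| := by
  induction k with
  | zero => simp
  | succ k ih =>
    have h : ((k + 1 : ℕ) : ℝ) * θ = k * θ + θ := by push_cast; ring
    rw [h, Real.sin_add]
    calc |Real.sin (k * θ) * Real.cos θ + Real.cos (k * θ) * Real.sin θ|
        ≤ |Real.sin (k * θ)| * |Real.cos θ| + |Real.cos (k * θ)| * |Real.sin θ| := by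
          rw [← abs_mul, ← abs_mul]; exact abs_add_le _ _
      _ ≤ |Real.sin (k * θ)| * 1 + 1 * |Real.sin θ| := by
          gcongr <;> exact Real.abs_cos_le_one _
      _ ≤ ((k + 1 : ℕ) : ℝ) * |Real.sin θ| := by push_cast; linarith

/-- The Dirichlet kernel `(2 m + 1)⁻¹ ∑_{|k| ≤ m} cos (2 k θ)` as a polynomial in `sin² θ`. -/
def dirichletPoly (m : ℕ) : ℝ[X] :=
  C ((2 * m + 1 : ℝ)⁻¹) *
    (1 + 2 * ∑ k ∈ Finset.range m, (Chebyshev.T ℝ ((k + 1 : ℕ) : ℤ)).comp (1 - 2 * X))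

lemma dirichletPoly_eval (m : ℕ) (θ : ℝ) :
    (dirichletPoly m).eval (Real.sin θ ^ 2) =
      (2 * m + 1 : ℝ)⁻¹ *
        (1 + 2 * ∑ k ∈ Finset.range m, Real.cos (2 * (((k + 1 : ℕ) : ℝ) * θ))) := by
  have h : ∀ k : ℕ, ((Chebyshev.T ℝ ((k + 1 : ℕ) : ℤ)).comp (1 - 2 * X)).eval (Real.sin θ ^ 2) =
      Real.cos (2 * (((k + 1 : ℕ) : ℝ) * θ)) := by
    intro k
    have : (1 - 2 * Real.sin θ ^ 2 : ℝ) = Real.cos (2 * θ) := by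
      rw [Real.cos_two_mul, Real.cos_sq']; ring
    rw [eval_comp]
    simp only [eval_sub, eval_one, eval_mul, eval_ofNat, eval_X, this]
    rw [Chebyshev.T_real_cos]
    congr 1; push_cast; ring
  simp only [dirichletPoly, eval_mul, eval_C, eval_add, eval_one, eval_ofNat, eval_finsetSum, h]

lemma sin_mul_dirichlet_sum (m : ℕ) (θ : ℝ) :
    Real.sin θ * (1 + 2 * ∑ k ∈ Finset.range m, Real.cos (2 * (((k + 1 : ℕ) : ℝ) * θ))) =
      Real.sin ((2 * m + 1) * θ) := by
  induction m with
  | zero => simp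
  | succ m ih =>
    rw [Finset.sum_range_succ, mul_add 2, ← add_assoc, mul_add, ih]
    have h1 : (2 * (m : ℝ) + 1) * θ = 2 * (((m + 1 : ℕ) : ℝ) * θ) - θ := by push_cast; ring
    have h2 : (2 * ((m + 1 : ℕ) : ℝ) + 1) * θ = 2 * (((m + 1 : ℕ) : ℝ) * θ) + θ := by
      push_cast; ring
    rw [h1, h2, Real.sin_sub, Real.sin_add]; ring

lemma natDegree_dirichletPoly_le (m : ℕ) : (dirichletPoly m).natDegree ≤ m := by
  unfold dirichletPoly
  refine (natDegree_C_mul_le _ _).trans ((natDegree_add_le _ _).trans (max_le (by simp) ?_))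
  have : (2 : ℝ[X]) = C 2 := rfl
  rw [this]
  refine (natDegree_C_mul_le _ _).trans (natDegree_sum_le_of_forall_le _ _ fun k hk => ?_)
  refine natDegree_comp_le.trans ?_
  rw [Chebyshev.natDegree_T]
  have h1 : (1 - C 2 * X : ℝ[X]).natDegree ≤ 1 := by
    refine (natDegree_sub_le _ _).trans (max_le (by simp) ((natDegree_C_mul_le _ _).trans ?_))
    simp
  have := Finset.mem_range.1 hk
  calc _ ≤ (k + 1) * 1 := Nat.mul_le_mul (by rw [Int.natAbs_natCast]) h1
    _ ≤ m := by omega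

lemma dirichletPoly_bounds (m : ℕ) {t : ℝ} (h0 : 0 ≤ t) (h1 : t ≤ 1) :
    |(dirichletPoly m).eval t| ≤ 1 ∧ 1 - (dirichletPoly m).eval t ≤ 2 * m ^ 2 * t ∧
      (4 ≤ (2 * m + 1) ^ 2 * t → (dirichletPoly m).eval t ^ 2 ≤ 1 / 4) := by
  obtain ⟨θ, rfl⟩ : ∃ θ, t = Real.sin θ ^ 2 :=
    ⟨Real.arcsin (√t), by
      rw [Real.sin_arcsin (by linarith [Real.sqrt_nonneg t]) (by simpa using h1),
        Real.sq_sqrt h0]⟩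
  have hm : (0 : ℝ) < 2 * m + 1 := by positivity
  rw [dirichletPoly_eval]
  refine ⟨?_, ?_, ?_⟩
  · rw [abs_mul, abs_of_pos (inv_pos.2 hm), inv_mul_le_one₀ hm]
    calc _ ≤ |(1 : ℝ)| + |2 * ∑ k ∈ Finset.range m, Real.cos (2 * (((k + 1 : ℕ) : ℝ) * θ))| :=
          abs_add_le _ _
      _ ≤ 1 + 2 * ∑ k ∈ Finset.range m, 1 := by
          rw [abs_one, abs_mul, abs_two]
          gcongr
          refine (Finset.abs_sum_le_sum_abs _ _).trans (Finset.sum_le_sum fun k _ => ?_)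
          exact Real.abs_cos_le_one _
      _ = 2 * m + 1 := by simp; ring
  · have hs : ∑ k ∈ Finset.range m, (1 - Real.cos (2 * (((k + 1 : ℕ) : ℝ) * θ))) ≤
        ∑ k ∈ Finset.range m, 2 * (m : ℝ) ^ 2 * Real.sin θ ^ 2 := by
      refine Finset.sum_le_sum fun k hk => ?_
      have h2 := abs_sin_nat_mul_le (k + 1) θ
      have h3 : Real.sin (((k + 1 : ℕ) : ℝ) * θ) ^ 2 ≤ (m : ℝ) ^ 2 * Real.sin θ ^ 2 := by
        rw [← sq_abs, ← sq_abs (Real.sin θ), ← mul_pow]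
        refine pow_le_pow_left₀ (abs_nonneg _) (h2.trans ?_) 2
        gcongr
        exact Finset.mem_range.1 hk
      rw [Real.cos_two_mul, Real.cos_sq']
      linarith
    rw [Finset.sum_sub_distrib] at hs
    simp only [Finset.sum_const, Finset.card_range, nsmul_eq_mul, mul_one] at hs
    have : 1 - (2 * m + 1 : ℝ)⁻¹ * (1 + 2 * ∑ k ∈ Finset.range m,
        Real.cos (2 * (((k + 1 : ℕ) : ℝ) * θ))) =
        (2 * m + 1 : ℝ)⁻¹ * (2 * (m - ∑ k ∈ Finset.range m,
        Real.cos (2 * (((k + 1 : ℕ) : ℝ) * θ)))) := by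
      generalize ∑ k ∈ Finset.range m, Real.cos (2 * (((k + 1 : ℕ) : ℝ) * θ)) = S
      field_simp; ring
    rw [this, inv_mul_le_iff₀ hm]
    have h5 : 0 ≤ (m : ℝ) ^ 2 * Real.sin θ ^ 2 := by positivity
    nlinarith
  · intro h4
    have key := sin_mul_dirichlet_sum m θ
    set S := 1 + 2 * ∑ k ∈ Finset.range m, Real.cos (2 * (((k + 1 : ℕ) : ℝ) * θ))
    have h5 : Real.sin θ ^ 2 * S ^ 2 ≤ 1 := by
      rw [← mul_pow, key]; exact Real.sin_sq_le_one _
    have h6 : 0 < Real.sin θ ^ 2 := by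
      by_contra hc
      have : Real.sin θ ^ 2 = 0 := le_antisymm (not_lt.1 hc) h0
      rw [this] at h4; linarith
    rw [mul_pow, inv_pow, inv_mul_le_iff₀ (by positivity)]
    have h7 : 4 * S ^ 2 ≤ (2 * m + 1 : ℝ) ^ 2 * Real.sin θ ^ 2 * S ^ 2 := by gcongr
    nlinarith

/-- A polynomial of degree `O(m)` between `0` and `4 m²` which is comparable to `1 / t` as soon as
`t` is of order at least `m⁻²`. -/
lemma exists_soft_inverse (m : ℕ) : ∃ s : ℝ[X], s.natDegree ≤ 2 * m ∧
    ∀ t : ℝ, 0 ≤ t → t ≤ 1 → 0 ≤ s.eval t ∧ s.eval t ≤ 4 * m ^ 2 ∧ t * s.eval t ≤ 1 ∧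
      (4 ≤ (2 * m + 1) ^ 2 * t → 3 / 4 ≤ t * s.eval t) := by
  set q : ℝ[X] := 1 - dirichletPoly m ^ 2
  have hq0 : q.coeff 0 = 0 := by
    rw [coeff_zero_eq_eval_zero]
    have := dirichletPoly_eval m 0
    simp only [Real.sin_zero, mul_zero, Real.cos_zero, Finset.sum_const, Finset.card_range,
      nsmul_eq_mul, mul_one] at this
    norm_num at this
    have hm : (2 * m + 1 : ℝ) ≠ 0 := by positivity
    have h1 : (2 * m + 1 : ℝ)⁻¹ * (1 + 2 * m) = 1 := by rw [add_comm 1, inv_mul_cancel₀ hm]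
    simp [q, this, h1]
  have hq : ∀ t : ℝ, t * q.divX.eval t = 1 - (dirichletPoly m).eval t ^ 2 := by
    intro t
    have h := congrArg (eval t) (divX_mul_X_add q)
    rw [hq0] at h
    simp only [map_zero, add_zero, eval_mul, eval_X] at h
    rw [mul_comm, h]; simp [q]
  have hpos : ∀ t : ℝ, 0 < t → t ≤ 1 → q.divX.eval t ∈ Set.Icc (0 : ℝ) (4 * m ^ 2) := by
    intro t h0 h1
    obtain ⟨ha, hb, -⟩ := dirichletPoly_bounds m h0.le h1
    have := hq t
    obtain ⟨h3, h4⟩ := abs_le.1 ha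
    constructor
    · refine nonneg_of_mul_nonneg_right ?_ h0
      rw [this]; nlinarith
    · refine le_of_mul_le_mul_left ?_ h0
      rw [this]
      nlinarith
  refine ⟨q.divX, ?_, fun t h0 h1 => ?_⟩
  · refine (natDegree_divX_le).trans ((natDegree_sub_le _ _).trans (max_le (by simp) ?_))
    refine natDegree_pow_le.trans ?_
    have := natDegree_dirichletPoly_le m
    omega
  · obtain ⟨ha, hb, hc⟩ := dirichletPoly_bounds m h0 h1
    -- the value at `0` is reached as a limit
    have hmem : q.divX.eval t ∈ Set.Icc (0 : ℝ) (4 * m ^ 2) := by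
      have hcl : IsClosed ((fun t => q.divX.eval t) ⁻¹' Set.Icc (0 : ℝ) (4 * m ^ 2)) :=
        isClosed_Icc.preimage q.divX.continuous
      have hsub : Set.Ioc (0 : ℝ) 1 ⊆ (fun t => q.divX.eval t) ⁻¹' Set.Icc (0 : ℝ) (4 * m ^ 2) :=
        fun t ht => hpos t ht.1 ht.2
      have := hcl.closure_subset_iff.2 hsub
      rw [closure_Ioc zero_ne_one] at this
      exact this ⟨h0, h1⟩
    refine ⟨hmem.1, hmem.2, ?_, fun h4 => ?_⟩
    · rw [hq]; nlinarith [sq_nonneg ((dirichletPoly m).eval t)]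
    · rw [hq]; linarith [hc h4]

lemma choose_add_le_four_pow (r j i : ℕ) (h : j + r ≤ 4 * (i + 1)) :
    (j + r).choose (i + r) ≤ 4 ^ r * j.choose i := by
  induction r with
  | zero => simp
  | succ r ih =>
    have h1 := Nat.add_one_mul_choose_eq (j + r) (i + r)
    have h2 : (j + (r + 1)).choose (i + (r + 1)) ≤ 4 * (j + r).choose (i + r) := by
      refine Nat.le_of_mul_le_mul_right (c := i + r + 1) ?_ (by omega)
      rw [show j + (r + 1) = j + r + 1 by omega, show i + (r + 1) = i + r + 1 by omega, ← h1]
      calc (j + r + 1) * (j + r).choose (i + r) ≤ (4 * (i + r + 1)) * (j + r).choose (i + r) :=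
            Nat.mul_le_mul_right _ (by omega)
        _ = _ := by ring
    calc _ ≤ 4 * (j + r).choose (i + r) := h2
      _ ≤ 4 * (4 ^ r * j.choose i) := Nat.mul_le_mul_left _ (ih (by omega))
      _ = _ := by ring

/-- `x⁶ A(x)` is the probability that a binomial variable with `4 g + 6` trials and success
probability `x` exceeds `g + 6`. A sixth factorial moment bounds it by a constant times `x⁶`, and
it is exponentially close to `1` for `x ≥ 3 / 4`. -/
lemma exists_amplifier (g : ℕ) : ∃ A : ℝ[X], A.natDegree ≤ 4 * g ∧
    ∀ x : ℝ, 0 ≤ x → x ≤ 1 → 0 ≤ A.eval x ∧ A.eval x ≤ 4 ^ 6 ∧ x ^ 6 * A.eval x ≤ 1 ∧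
      (3 / 4 ≤ x → 1 - 2 ^ 6 * (1 / 4) ^ g ≤ x ^ 6 * A.eval x) := by
  refine ⟨∑ k ∈ Finset.range (3 * g), C (((4 * g + 6).choose (g + 7 + k) : ℕ) : ℝ) *
    (X ^ (g + 1 + k) * (1 - X) ^ (3 * g - 1 - k)), ?_, fun x h0 h1 => ?_⟩
  · refine natDegree_sum_le_of_forall_le _ _ fun k hk => (natDegree_C_mul_le _ _).trans ?_
    refine natDegree_mul_le.trans ?_
    have h1 : (1 - X : ℝ[X]).natDegree ≤ 1 :=
      (natDegree_sub_le _ _).trans (max_le (by simp) (by simp))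
    have h2 : ((1 - X : ℝ[X]) ^ (3 * g - 1 - k)).natDegree ≤ 3 * g - 1 - k := by
      refine natDegree_pow_le.trans ?_
      calc _ ≤ (3 * g - 1 - k) * 1 := Nat.mul_le_mul_left _ h1
        _ = _ := by ring
    rw [natDegree_X_pow]
    have := Finset.mem_range.1 hk
    omega
  · have h1' : 0 ≤ 1 - x := by linarith
    simp only [eval_finsetSum, eval_mul, eval_C, eval_pow, eval_X, eval_sub, eval_one]
    have e1 := add_pow x (1 - x) (4 * g)
    have e2 := add_pow x (1 - x) (4 * g + 6)
    rw [add_sub_cancel, one_pow, show 4 * g + 1 = (g + 1) + 3 * g by ring,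
      Finset.sum_range_add] at e1
    rw [add_sub_cancel, one_pow, show 4 * g + 6 + 1 = (g + 7) + 3 * g by ring,
      Finset.sum_range_add] at e2
    have hx6 : x ^ 6 * ∑ k ∈ Finset.range (3 * g), (((4 * g + 6).choose (g + 7 + k) : ℕ) : ℝ) *
        (x ^ (g + 1 + k) * (1 - x) ^ (3 * g - 1 - k)) =
        ∑ k ∈ Finset.range (3 * g), x ^ (g + 7 + k) * (1 - x) ^ (4 * g + 6 - (g + 7 + k)) *
          ((4 * g + 6).choose (g + 7 + k) : ℕ) := by
      rw [Finset.mul_sum]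
      refine Finset.sum_congr rfl fun k hk => ?_
      have := Finset.mem_range.1 hk
      rw [show 4 * g + 6 - (g + 7 + k) = 3 * g - 1 - k by omega]
      ring
    refine ⟨Finset.sum_nonneg fun k _ => by positivity, ?_, ?_, fun h34 => ?_⟩
    · have hs : ∑ k ∈ Finset.range (3 * g), x ^ (g + 1 + k) * (1 - x) ^ (4 * g - (g + 1 + k)) *
          ((4 * g).choose (g + 1 + k) : ℝ) ≤ 1 := by
        refine le_trans ?_ e1.ge
        exact le_add_of_nonneg_left (Finset.sum_nonneg fun k _ => by positivity)
      refine le_trans ?_ (le_of_le_of_eq (mul_le_mul_of_nonneg_left hs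
        (by positivity : (0 : ℝ) ≤ 4 ^ 6)) (mul_one _))
      rw [Finset.mul_sum]
      refine Finset.sum_le_sum fun k hk => ?_
      have hk' := Finset.mem_range.1 hk
      have hch := choose_add_le_four_pow 6 (4 * g) (g + 1 + k) (by omega)
      rw [show g + 1 + k + 6 = g + 7 + k by omega] at hch
      have hch' : (((4 * g + 6).choose (g + 7 + k) : ℕ) : ℝ) ≤
          4 ^ 6 * ((4 * g).choose (g + 1 + k) : ℝ) := by
        exact_mod_cast hch
      rw [show 4 * g - (g + 1 + k) = 3 * g - 1 - k by omega]
      calc _ ≤ (4 ^ 6 * ((4 * g).choose (g + 1 + k) : ℝ)) *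
            (x ^ (g + 1 + k) * (1 - x) ^ (3 * g - 1 - k)) := by gcongr
        _ = _ := by ring
    · rw [hx6]
      refine le_trans ?_ e2.ge
      exact le_add_of_nonneg_left (Finset.sum_nonneg fun k _ => by positivity)
    · rw [hx6, sub_le_iff_le_add]
      refine e2.le.trans ?_
      rw [add_comm]
      gcongr
      calc ∑ i ∈ Finset.range (g + 7), x ^ i * (1 - x) ^ (4 * g + 6 - i) *
            ((4 * g + 6).choose i : ℝ)
          ≤ ∑ i ∈ Finset.range (g + 7), (1 / 4) ^ (3 * g) * ((4 * g + 6).choose i : ℝ) := by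
            refine Finset.sum_le_sum fun i hi => ?_
            have hi' := Finset.mem_range.1 hi
            gcongr
            calc x ^ i * (1 - x) ^ (4 * g + 6 - i) ≤ 1 * (1 / 4) ^ (4 * g + 6 - i) := by
                  gcongr
                  · exact pow_le_one₀ h0 h1
                  · linarith
              _ ≤ (1 / 4) ^ (3 * g) := by
                  rw [one_mul]
                  exact pow_le_pow_of_le_one (by norm_num) (by norm_num) (by omega)
        _ = (1 / 4) ^ (3 * g) * ∑ i ∈ Finset.range (g + 7), ((4 * g + 6).choose i : ℝ) := by
            rw [Finset.mul_sum]
        _ ≤ (1 / 4) ^ (3 * g) * 2 ^ (4 * g + 6) := by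
            gcongr
            have h2 := Nat.sum_range_choose (4 * g + 6)
            rw [show 4 * g + 6 + 1 = (g + 7) + 3 * g by ring, Finset.sum_range_add] at h2
            have h3 : ∑ i ∈ Finset.range (g + 7), (4 * g + 6).choose i ≤ 2 ^ (4 * g + 6) := by
              omega
            exact_mod_cast h3
        _ = 2 ^ 6 * (1 / 4) ^ g := by
            rw [pow_add, pow_mul, pow_mul, mul_comm _ ((2 : ℝ) ^ 6), mul_left_comm, ← mul_pow]
            norm_num

/-- A polynomial approximation of `t ↦ t⁻⁶` beyond a cutoff of order `m⁻²`, which stays bounded by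
a constant times `m¹²` on all of `[0, 1]`. -/
lemma exists_inv_pow_six_approx (m g : ℕ) : ∃ P : ℝ[X],
    P.natDegree ≤ 12 * m + 4 * g * (2 * m + 1) ∧
    ∀ t : ℝ, 0 ≤ t → t ≤ 1 → 0 ≤ P.eval t ∧ P.eval t ≤ 4 ^ 6 * (4 * m ^ 2) ^ 6 ∧
      t ^ 3 * P.eval t ≤ 4 ^ 6 * (4 * m ^ 2) ^ 3 ∧
      (4 ≤ (2 * m + 1) ^ 2 * t → |t ^ 6 * P.eval t - 1| ≤ 2 ^ 6 * (1 / 4) ^ g) := by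
  obtain ⟨s, hs, hs'⟩ := exists_soft_inverse m
  obtain ⟨A, hA, hA'⟩ := exists_amplifier g
  refine ⟨s ^ 6 * A.comp (X * s), ?_, fun t h0 h1 => ?_⟩
  · refine natDegree_mul_le.trans (add_le_add (natDegree_pow_le.trans (by omega)) ?_)
    refine natDegree_comp_le.trans (Nat.mul_le_mul hA (natDegree_mul_le.trans ?_))
    rw [natDegree_X]; omega
  · obtain ⟨a1, a2, a3, a4⟩ := hs' t h0 h1
    obtain ⟨b1, b2, b3, b4⟩ := hA' _ (mul_nonneg h0 a1) a3
    simp only [eval_mul, eval_pow, eval_comp, eval_X]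
    generalize hAe : A.eval (t * s.eval t) = α at *
    generalize s.eval t = σ at *
    refine ⟨by positivity, ?_, ?_, fun h4 => ?_⟩
    · rw [mul_comm]; gcongr
    · calc t ^ 3 * (σ ^ 6 * α) = α * (t * σ) ^ 3 * σ ^ 3 := by ring
        _ ≤ 4 ^ 6 * 1 * (4 * (m : ℝ) ^ 2) ^ 3 := by
          gcongr
          exact pow_le_one₀ (mul_nonneg h0 a1) a3
        _ = _ := by ring
    · have e : t ^ 6 * (σ ^ 6 * α) = (t * σ) ^ 6 * α := by ring
      rw [e, abs_le]
      have := b4 (a4 h4)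
      have h2 : (0 : ℝ) ≤ 2 ^ 6 * (1 / 4) ^ g := by positivity
      constructor <;> linarith

/-- The polynomial is `x ↦ 4 ε (σ¹² - σ⁶ x³) Q(x)` with `Q(x)` an approximation of `x⁻⁶`. -/
lemma exists_isQSPApprox_lennardJones (ε σ κ : ℝ) (hε : 0 < ε) (hσ : 0 < σ) (hκ : 0 < κ) :
    ∃ C : ℝ, 0 < C ∧ ∀ n d a p : ℕ, 1 ≤ n → 1 ≤ d → 1 ≤ a → 2 * a ≤ p + 1 →
      ∃ W : ℝ[X], IsQSPApprox (lennardJones ε σ) d (κ / 2 ^ n) (((2 : ℝ) ^ n)⁻¹ ^ (2 * a + 1))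
        (C * ((2 : ℝ) ^ n) ^ 12) (C * √(d : ℝ) * p * 2 ^ n * n) W := by
  obtain ⟨K, hK1, hKκ⟩ : ∃ K : ℝ, 1 ≤ K ∧ 1 ≤ K * κ :=
    ⟨max 1 κ⁻¹, le_max_left _ _, by
      calc 1 = κ⁻¹ * κ := (inv_mul_cancel₀ hκ.ne').symm
        _ ≤ _ := by gcongr; exact le_max_right _ _⟩
  set C₁ : ℝ := 4 * ε * (σ ^ 12 * K ^ 12 + σ ^ 6 * K ^ 12) with hC₁
  have hC₁pos : 0 < C₁ := by positivity
  obtain ⟨c₀, hc₀⟩ : ∃ c₀ : ℕ, C₁ * 2 ^ 6 ≤ 4 ^ c₀ :=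
    (pow_unbounded_of_one_lt (C₁ * 2 ^ 6) (by norm_num : (1 : ℝ) < 4)).imp fun _ h => h.le
  refine ⟨4 ^ 6 * 16 ^ 6 * C₁ + 216 * (15 + c₀) * K, by positivity, ?_⟩
  intro n d a p hn hd ha hp
  set N : ℝ := 2 ^ n with hN
  have hN1 : 1 ≤ N := one_le_pow₀ (by norm_num)
  have hd1 : (1 : ℝ) ≤ d := by exact_mod_cast hd
  have hsd : 1 ≤ √(d : ℝ) := Real.one_le_sqrt.2 hd1
  have hsd2 : √(d : ℝ) ^ 2 = d := Real.sq_sqrt (by linarith)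
  set m : ℕ := ⌈2 * √(d : ℝ) * N * K⌉₊ with hm
  have hone : 1 ≤ √(d : ℝ) * N * K :=
    one_le_mul_of_one_le_of_one_le (one_le_mul_of_one_le_of_one_le hsd hN1) hK1
  have hm1 : 2 * √(d : ℝ) * N * K ≤ m := Nat.le_ceil _
  have hm2 : (m : ℝ) ≤ 4 * √(d : ℝ) * N * K := by
    have := Nat.ceil_lt_add_one (a := 2 * √(d : ℝ) * N * K) (by positivity)
    linarith
  have hmpos : 1 ≤ m := by
    have : (1 : ℝ) ≤ m := by linarith
    exact_mod_cast this
  set g : ℕ := (15 + c₀) * (p * n) with hg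
  have hpn : 1 ≤ p * n := Nat.mul_pos (by omega) hn
  have hgpos : 1 ≤ g := Nat.mul_pos (by omega) hpn
  have hgle : c₀ + n * (12 + (2 * a + 1)) ≤ g := by
    have h1 : 12 + (2 * a + 1) ≤ 15 * p := by omega
    have h2 := Nat.mul_le_mul_left n h1
    have h3 : c₀ ≤ c₀ * (p * n) := Nat.le_mul_of_pos_right _ hpn
    have h4 : g = 15 * (n * p) + c₀ * (p * n) := by rw [hg]; ring
    have h5 : n * (15 * p) = 15 * (n * p) := by ring
    omega
  obtain ⟨P, hPdeg, hP⟩ := exists_inv_pow_six_approx m g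
  have h4m : 4 * (m : ℝ) ^ 2 ≤ 64 * d * N ^ 2 * K ^ 2 := by
    calc 4 * (m : ℝ) ^ 2 ≤ 4 * (4 * √(d : ℝ) * N * K) ^ 2 := by gcongr
      _ = 64 * √(d : ℝ) ^ 2 * N ^ 2 * K ^ 2 := by ring
      _ = _ := by rw [hsd2]
  have hd4 : (0 : ℝ) < 4 * d := by positivity
  set W : ℝ[X] := C (4 * ε * ((4 * d : ℝ)⁻¹) ^ 6) * ((C (σ ^ 12) - C (σ ^ 6) * X ^ 3) *
    P.comp (C ((4 * d : ℝ)⁻¹) * X)) with hW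
  have hWeval : ∀ t : ℝ, W.eval (4 * d * t) =
      4 * ε * (σ ^ 12 * ((4 * d : ℝ)⁻¹) ^ 6 * P.eval t -
        σ ^ 6 * ((4 * d : ℝ)⁻¹) ^ 3 * (t ^ 3 * P.eval t)) := by
    intro t
    simp only [hW, eval_mul, eval_sub, eval_C, eval_pow, eval_X, eval_comp]
    rw [inv_mul_cancel_left₀ hd4.ne']
    field_simp
  refine ⟨W, ?_, ?_, ?_⟩
  · have h1 : W.natDegree ≤ 3 + (12 * m + 4 * g * (2 * m + 1)) := by
      refine (natDegree_C_mul_le _ _).trans (natDegree_mul_le.trans (add_le_add ?_ ?_))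
      · refine (natDegree_sub_le _ _).trans (max_le (by simp) ?_)
        exact (natDegree_C_mul_le _ _).trans (by simp)
      · refine natDegree_comp_le.trans ?_
        calc _ ≤ (12 * m + 4 * g * (2 * m + 1)) * 1 := Nat.mul_le_mul hPdeg
              ((natDegree_C_mul_le _ _).trans (by simp))
          _ = _ := mul_one _
    have h2 : 2 * W.natDegree ≤ 54 * (g * m) := by
      have e1 : m ≤ g * m := Nat.le_mul_of_pos_left m hgpos
      have e2 : g ≤ g * m := Nat.le_mul_of_pos_right g hmpos
      nlinarith
    calc ((2 * W.natDegree : ℕ) : ℝ) ≤ ((54 * (g * m) : ℕ) : ℝ) := by exact_mod_cast h2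
      _ = 54 * (15 + c₀) * (p * n) * m := by rw [hg]; push_cast; ring
      _ ≤ 54 * (15 + c₀) * (p * n) * (4 * √(d : ℝ) * N * K) := by gcongr
      _ = (0 + 216 * (15 + c₀) * K) * √(d : ℝ) * p * N * n := by ring
      _ ≤ (4 ^ 6 * 16 ^ 6 * C₁ + 216 * (15 + c₀) * K) * √(d : ℝ) * p * N * n := by
        gcongr; positivity
  · intro y hy1 hy2
    obtain ⟨b1, b2, b3, -⟩ := hP (y ^ 2) (sq_nonneg y) (by nlinarith)
    rw [hWeval, abs_mul, abs_of_pos (by positivity : 0 < 4 * ε)]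
    set Q := P.eval (y ^ 2)
    calc 4 * ε *
          |σ ^ 12 * ((4 * d : ℝ)⁻¹) ^ 6 * Q - σ ^ 6 * ((4 * d : ℝ)⁻¹) ^ 3 * ((y ^ 2) ^ 3 * Q)|
        ≤ 4 * ε * (σ ^ 12 * ((4 * d : ℝ)⁻¹) ^ 6 * (4 ^ 6 * (64 * d * N ^ 2 * K ^ 2) ^ 6) +
          σ ^ 6 * ((4 * d : ℝ)⁻¹) ^ 3 * (4 ^ 6 * (64 * d * N ^ 2 * K ^ 2) ^ 3)) := by
          refine mul_le_mul_of_nonneg_left ((abs_sub _ _).trans ?_) (by positivity)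
          rw [abs_of_nonneg (by positivity), abs_of_nonneg (by positivity)]
          refine add_le_add (mul_le_mul_of_nonneg_left (b2.trans (by gcongr)) (by positivity))
            (mul_le_mul_of_nonneg_left (b3.trans (by gcongr)) (by positivity))
      _ = 4 * ε * (4 ^ 6 * 16 ^ 6 * (σ ^ 12 * K ^ 12) * N ^ 12 +
          4 ^ 6 * 16 ^ 3 * (σ ^ 6 * K ^ 6) * N ^ 6) := by field_simp; ring
      _ ≤ 4 * ε * (4 ^ 6 * 16 ^ 6 * (σ ^ 12 * K ^ 12) * N ^ 12 +
          4 ^ 6 * 16 ^ 6 * (σ ^ 6 * K ^ 12) * N ^ 12) := by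
          gcongr <;> norm_num
      _ = (4 ^ 6 * 16 ^ 6 * C₁ + 0) * N ^ 12 := by rw [hC₁]; ring
      _ ≤ (4 ^ 6 * 16 ^ 6 * C₁ + 216 * (15 + c₀) * K) * N ^ 12 := by
        gcongr; positivity
  · intro r hr1 hr2
    have hr0 : 0 < r := lt_of_lt_of_le (by positivity) hr1
    have hNKr : 1 ≤ N * K * r := by
      rw [div_le_iff₀ (by positivity)] at hr1
      nlinarith
    set t : ℝ := r ^ 2 / (4 * d) with ht
    have ht1 : 4 * d * t = r ^ 2 := by rw [ht]; field_simp
    have hr2' : r ^ 2 ≤ 4 * d := by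
      calc r ^ 2 ≤ (2 * √(d : ℝ)) ^ 2 := by gcongr
        _ = _ := by rw [mul_pow, hsd2]; norm_num
    obtain ⟨-, -, -, b4⟩ := hP t (by positivity) ((div_le_one hd4).2 hr2')
    have h4 : 4 ≤ (2 * m + 1 : ℝ) ^ 2 * t := by
      calc (4 : ℝ) ≤ 4 * (N * K * r) ^ 2 := by nlinarith
        _ = (2 * (2 * √(d : ℝ) * N * K)) ^ 2 * t := by
          have : (2 * (2 * √(d : ℝ) * N * K)) ^ 2 * t =
              16 * (√(d : ℝ) ^ 2) * N ^ 2 * K ^ 2 * t := by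
            ring
          rw [this, hsd2, show 16 * (d : ℝ) * N ^ 2 * K ^ 2 * t = 4 * N ^ 2 * K ^ 2 * (4 * d * t)
            by ring, ht1]
          ring
        _ ≤ _ := by gcongr; linarith
    specialize b4 h4
    have hV : W.eval (r ^ 2) - lennardJones ε σ r =
        4 * ε * (σ ^ 12 * r⁻¹ ^ 12 - σ ^ 6 * r⁻¹ ^ 6) * (t ^ 6 * P.eval t - 1) := by
      rw [← ht1, hWeval, lennardJones, ht]
      field_simp
    have hrinv : r⁻¹ ≤ N * K := by
      rw [inv_le_iff_one_le_mul₀ hr0]; exact hNKr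
    rw [hV, abs_mul]
    calc _ ≤ (4 * ε * (σ ^ 12 * (N * K) ^ 12 + σ ^ 6 * (N * K) ^ 12)) *
          (2 ^ 6 * (1 / 4) ^ g) := by
          gcongr
          rw [abs_mul, abs_of_pos (by positivity : 0 < 4 * ε)]
          refine mul_le_mul_of_nonneg_left ((abs_sub _ _).trans ?_) (by positivity)
          rw [abs_of_nonneg (by positivity), abs_of_nonneg (by positivity)]
          gcongr
          · calc r⁻¹ ^ 6 ≤ (N * K) ^ 6 := by gcongr
              _ ≤ _ := pow_le_pow_right₀ (one_le_mul_of_one_le_of_one_le hN1 hK1) (by norm_num)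
      _ = C₁ * 2 ^ 6 * N ^ 12 * (1 / 4) ^ g := by rw [hC₁]; ring
      _ ≤ 4 ^ c₀ * N ^ 12 * (1 / 4) ^ (c₀ + n * (12 + (2 * a + 1))) := by
          refine mul_le_mul (mul_le_mul_of_nonneg_right hc₀ (by positivity))
            (pow_le_pow_of_le_one (by norm_num) (by norm_num) hgle) (by positivity) (by positivity)
      _ = N ^ 12 * ((1 / 4) ^ n) ^ (12 + (2 * a + 1)) := by
          rw [pow_add, pow_mul _ n, mul_comm (4 ^ c₀), mul_assoc, ← mul_assoc (4 ^ c₀), ← mul_pow]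
          norm_num
      _ ≤ N ^ 12 * N⁻¹ ^ (12 + (2 * a + 1)) := by
          gcongr
          rw [hN, ← inv_pow]
          exact pow_le_pow_left₀ (by norm_num) (by norm_num) _
      _ = N⁻¹ ^ (2 * a + 1) := by
          rw [pow_add, ← mul_assoc, ← mul_pow, mul_inv_cancel₀ (by positivity), one_pow, one_mul]

end Approximation

/-! ### Factorization of positive trigonometric polynomials -/

section SpectralFactorization

open Polynomial ComplexConjugate

lemma exists_sq_sub_two_mul_add_one (ρ : ℂ) : ∃ u : ℂ, u ≠ 0 ∧ u ^ 2 + 1 = 2 * ρ * u := by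
  obtain ⟨s, hs⟩ := IsAlgClosed.exists_pow_nat_eq (ρ ^ 2 - 1) (n := 2) (by norm_num)
  have h : (ρ + s) ^ 2 + 1 = 2 * ρ * (ρ + s) := by linear_combination hs
  refine ⟨ρ + s, fun h0 => ?_, h⟩
  rw [h0] at h
  norm_num at h

lemma circle_mul_conj {z : ℂ} (hz : ‖z‖ = 1) : z * conj z = 1 := by
  rw [Complex.mul_conj, Complex.normSq_eq_norm_sq, hz]; simp

/-- **Fejér–Riesz**, for trigonometric polynomials in the cosine: a real polynomial which is
positive on `[-1, 1]` is, in the variable `Re z` on the unit circle, the squared modulus of a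
polynomial in `z` of the same degree. Each root `(u + u⁻¹) / 2` of `H` contributes the root `u`. -/
lemma exists_normSq_eq_eval_re (H : ℝ[X]) (hH : ∀ c : ℝ, -1 ≤ c → c ≤ 1 → 0 < H.eval c) :
    ∃ G : ℂ[X], G.natDegree ≤ H.natDegree ∧
      ∀ z : ℂ, ‖z‖ = 1 → Complex.normSq (G.eval z) = H.eval z.re := by
  induction hk : H.natDegree using Nat.strong_induction_on generalizing H with
  | _ k ih =>
  have hre : ∀ z : ℂ, ‖z‖ = 1 → -1 ≤ z.re ∧ z.re ≤ 1 := fun z hz =>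
    abs_le.1 (hz ▸ Complex.abs_re_le_norm z)
  -- multiplying by one factor
  have step : ∀ (L H' : ℝ[X]) (l : ℂ[X]), H = L * H' → 0 < L.natDegree →
      (∀ c : ℝ, -1 ≤ c → c ≤ 1 → 0 < L.eval c) → l.natDegree ≤ L.natDegree →
      (∀ z : ℂ, ‖z‖ = 1 → Complex.normSq (l.eval z) = L.eval z.re) →
      ∃ G : ℂ[X], G.natDegree ≤ k ∧
        ∀ z : ℂ, ‖z‖ = 1 → Complex.normSq (G.eval z) = H.eval z.re := by
    intro L H' l hLH hLd hL hl hlz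
    have hL0 : L ≠ 0 := by rintro rfl; simp at hLd
    have hH0 : H' ≠ 0 := by
      rintro rfl
      have := hH 0 (by norm_num) (by norm_num)
      simp [hLH] at this
    have hdeg : k = L.natDegree + H'.natDegree := by rw [← hk, hLH, natDegree_mul hL0 hH0]
    obtain ⟨G, hG, hGz⟩ := ih H'.natDegree (by omega) H' (fun c h1 h2 => by
      have := hH c h1 h2
      rw [hLH, eval_mul] at this
      exact (pos_iff_pos_of_mul_pos this).1 (hL c h1 h2)) rfl
    refine ⟨l * G, natDegree_mul_le.trans (by omega), fun z hz => ?_⟩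
    rw [eval_mul, Complex.normSq_mul, hlz z hz, hGz z hz, hLH, eval_mul]
  rcases Nat.eq_zero_or_pos H.natDegree with h0 | hpos
  · obtain ⟨c, hc⟩ := natDegree_eq_zero.1 h0
    have hcpos : 0 < c := by simpa [← hc] using hH 0 (by norm_num) (by norm_num)
    refine ⟨C ((√c : ℝ) : ℂ), by simp, fun z _ => ?_⟩
    rw [← hc, eval_C, eval_C, Complex.normSq_ofReal, Real.mul_self_sqrt hcpos.le]
  · obtain ⟨ρ, hρ⟩ := IsAlgClosed.exists_aeval_eq_zero ℂ H (by
      exact (natDegree_pos_iff_degree_pos.1 hpos).ne')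
    by_cases him : ρ.im = 0
    · obtain ⟨x, rfl⟩ : ∃ x : ℝ, ρ = x := ⟨ρ.re, Complex.ext rfl him⟩
      have hroot : H.eval x = 0 := by
        have : ((H.eval x : ℝ) : ℂ) = 0 := by
          rw [← hρ, ← Complex.coe_algebraMap, aeval_algebraMap_apply, coe_aeval_eq_eval]
        exact_mod_cast this
      obtain ⟨Q, hQ⟩ := dvd_iff_isRoot.2 hroot
      have hx : 1 ≤ x ^ 2 := by
        by_contra hc
        obtain ⟨h1, h2⟩ := abs_lt.1 (sq_lt_one_iff_abs_lt_one x |>.1 (not_le.1 hc))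
        exact (hH x h1.le h2.le).ne' hroot
      set u : ℝ := x + √(x ^ 2 - 1) with hu
      have hs := Real.sq_sqrt (sub_nonneg.2 hx)
      have hu1 : u ^ 2 + 1 = 2 * x * u := by rw [hu]; linear_combination hs
      have hu0 : u ≠ 0 := fun h => by rw [h] at hu1; norm_num at hu1
      refine step (C (2 * u) * (C x - X)) (C (-(2 * u)⁻¹) * Q) (X - C (u : ℂ)) ?_ ?_ ?_ ?_ ?_
      · rw [hQ]
        have : (C (2 * u) * C (-(2 * u)⁻¹) : ℝ[X]) = -1 := by
          rw [← C_mul, mul_neg, mul_inv_cancel₀ (by simpa using hu0)]; simp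
        linear_combination (C x - X) * Q * (-this)
      · rw [natDegree_C_mul (by simpa using hu0), ← neg_sub, natDegree_neg, natDegree_X_sub_C]
        norm_num
      · intro c h1 h2
        have h3 := hH c h1 h2
        simp only [eval_mul, eval_C, eval_sub, eval_X]
        refine lt_of_le_of_ne (by nlinarith [sq_nonneg (u - c)]) fun h => ?_
        rcases mul_eq_zero.1 h.symm with h | h
        · exact hu0 (by linarith)
        · rw [show c = x by linarith, hroot] at h3; exact h3.false
      · rw [natDegree_X_sub_C, natDegree_C_mul (by simpa using hu0), ← neg_sub, natDegree_neg,
          natDegree_X_sub_C]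
      · intro z hz
        have h1 : z.re * z.re + z.im * z.im = 1 := by
          rw [← Complex.normSq_apply, Complex.normSq_eq_norm_sq, hz]; norm_num
        simp only [eval_mul, eval_C, eval_sub, eval_X, Complex.normSq_apply, Complex.sub_re,
          Complex.sub_im, Complex.ofReal_re, Complex.ofReal_im]
        linear_combination h1 + hu1
    · obtain ⟨u, hu0, hu⟩ := exists_sq_sub_two_mul_add_one ρ
      obtain ⟨Q, hQ⟩ := H.quadratic_dvd_of_aeval_eq_zero_im_ne_zero hρ him
      have hn0 : 4 * Complex.normSq u ≠ 0 := by simpa using hu0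
      have hnρ : ‖ρ‖ ^ 2 = ρ.re * ρ.re + ρ.im * ρ.im := by
        rw [← Complex.normSq_eq_norm_sq, Complex.normSq_apply]
      have hdeg : (X ^ 2 - C (2 * ρ.re) * X + C (‖ρ‖ ^ 2) : ℝ[X]).natDegree = 2 := by
        compute_degree!
      refine step (C (4 * Complex.normSq u) * (X ^ 2 - C (2 * ρ.re) * X + C (‖ρ‖ ^ 2)))
        (C (4 * Complex.normSq u)⁻¹ * Q) ((X - C u) * (X - C (conj u))) ?_ ?_ ?_ ?_ ?_
      · rw [hQ]
        have : (C (4 * Complex.normSq u) * C (4 * Complex.normSq u)⁻¹ : ℝ[X]) = 1 := by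
          rw [← C_mul, mul_inv_cancel₀ hn0, C_1]
        linear_combination -(X ^ 2 - C (2 * ρ.re) * X + C (‖ρ‖ ^ 2)) * Q * this
      · rw [natDegree_C_mul hn0, hdeg]; norm_num
      · intro c _ _
        simp only [eval_mul, eval_C, eval_sub, eval_X, eval_add, eval_pow, hnρ]
        have h1 : 0 < ρ.im * ρ.im := mul_self_pos.2 him
        have h2 : 0 < Complex.normSq u := Complex.normSq_pos.2 hu0
        have h3 : 0 < c ^ 2 - 2 * ρ.re * c + (ρ.re * ρ.re + ρ.im * ρ.im) := by
          nlinarith [sq_nonneg (c - ρ.re)]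
        positivity
      · rw [natDegree_C_mul hn0, hdeg]
        refine natDegree_mul_le.trans ?_
        simp
      · intro z hz
        have h1 := circle_mul_conj hz
        have h2 : z + conj z = ((2 * z.re : ℝ) : ℂ) := Complex.add_conj z
        have h3 : Complex.normSq (z - conj u) = Complex.normSq (conj z - u) := by
          rw [← Complex.normSq_conj, map_sub, Complex.conj_conj]
        have h4 : (z - u) * (conj z - u) = 2 * u * (ρ - z.re) := by
          push_cast at h2
          linear_combination h1 - u * h2 + hu
        simp only [eval_mul, eval_C, eval_sub, eval_X, Complex.normSq_mul, eval_add, eval_pow]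
        rw [h3, ← Complex.normSq_mul, h4, Complex.normSq_mul, Complex.normSq_mul, hnρ]
        simp only [Complex.normSq_apply, Complex.sub_re, Complex.sub_im, Complex.ofReal_re,
          Complex.ofReal_im, Complex.re_ofNat, Complex.im_ofNat]
        ring

end SpectralFactorization

/-! ### Quantum signal processing for a controlled unitary -/

section SignalProcessing

open Polynomial ComplexConjugate

/-- The polynomial which on the unit circle equals `z ^ M * conj (F z)`, for `F` of degree at most
`M`. -/
def conjReflect (M : ℕ) (F : ℂ[X]) : ℂ[X] := (F.map (starRingEnd ℂ)).reflect M

lemma eval_conjReflect (M : ℕ) {F : ℂ[X]} (hF : F.natDegree ≤ M) {z : ℂ} (hz : ‖z‖ = 1) :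
    (conjReflect M F).eval z = z ^ M * conj (F.eval z) := by
  have h1 := circle_mul_conj hz
  let : Invertible (conj z) := ⟨z, h1, by rw [mul_comm]; exact h1⟩
  have h := eval₂_reflect_mul_pow (RingHom.id ℂ) (conj z) M (F.map (starRingEnd ℂ))
    (natDegree_map_le.trans hF)
  have h2 : (⅟(conj z) : ℂ) = z := rfl
  rw [h2, ← eval, ← eval, eval_map, eval₂_hom] at h
  rw [conjReflect, ← h, mul_left_comm, ← mul_pow, h1, one_pow, mul_one]

lemma infinite_unit_circle : {z : ℂ | ‖z‖ = 1}.Infinite := by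
  refine Set.infinite_of_injOn_mapsTo (s := Set.Icc (-1 : ℝ) 1)
    (f := fun c : ℝ => (⟨c, √(1 - c ^ 2)⟩ : ℂ)) (fun x _ y _ h => congrArg Complex.re h) ?_
    (Set.Icc_infinite (by norm_num))
  intro c hc
  have h1 : 0 ≤ 1 - c ^ 2 := by nlinarith [hc.1, hc.2]
  change ‖(⟨c, √(1 - c ^ 2)⟩ : ℂ)‖ = 1
  rw [Complex.norm_def, Complex.normSq_mk, Real.mul_self_sqrt h1, Real.sqrt_eq_one]
  ring

lemma conjReflect_identity {M : ℕ} {F G : ℂ[X]} (hF : F.natDegree ≤ M) (hG : G.natDegree ≤ M)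
    (h : ∀ z : ℂ, ‖z‖ = 1 → Complex.normSq (F.eval z) + Complex.normSq (G.eval z) = 1) :
    F * conjReflect M F + G * conjReflect M G = X ^ M := by
  refine eq_of_infinite_eval_eq _ _ (infinite_unit_circle.mono fun z (hz : ‖z‖ = 1) => ?_)
  have h1 := congrArg ((↑) : ℝ → ℂ) (h z hz)
  push_cast at h1
  rw [← Complex.mul_conj, ← Complex.mul_conj] at h1
  simp only [Set.mem_ofPred_eq, eval_add, eval_mul, eval_pow, eval_X, eval_conjReflect M hF hz,
    eval_conjReflect M hG hz]
  linear_combination z ^ M * h1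

lemma conjReflect_add (M : ℕ) (F G : ℂ[X]) :
    conjReflect M (F + G) = conjReflect M F + conjReflect M G := by
  simp [conjReflect, reflect_add]

lemma conjReflect_C_mul (M : ℕ) (c : ℂ) (F : ℂ[X]) :
    conjReflect M (C c * F) = C (conj c) * conjReflect M F := by
  simp [conjReflect, reflect_C_mul]

lemma conjReflect_X_mul {M : ℕ} {F : ℂ[X]} (hF : F.natDegree ≤ M) :
    conjReflect (M + 1) (X * F) = conjReflect M F := by
  rw [conjReflect, Polynomial.map_mul, map_X, add_comm,
    reflect_mul _ _ natDegree_X_le (natDegree_map_le.trans hF), reflect_one_X, one_mul, conjReflect]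

lemma conjReflect_succ {M : ℕ} {F : ℂ[X]} (hF : F.natDegree ≤ M) :
    conjReflect (M + 1) F = X * conjReflect M F := by
  rw [← one_mul F, conjReflect, Polynomial.map_mul, Polynomial.map_one, add_comm,
    reflect_mul _ _ (by simp) (natDegree_map_le.trans hF), reflect_one, pow_one, one_mul,
    conjReflect]

/-- The special unitary matrix with first row `(p, q)`. -/
def rowUnitary (p q : ℂ) : Matrix (Fin 2) (Fin 2) ℂ := !![p, q; -conj q, conj p]

lemma rowUnitary_mem {p q : ℂ} (h : p * conj p + q * conj q = 1) :
    rowUnitary p q ∈ Matrix.unitaryGroup (Fin 2) ℂ := by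
  rw [Matrix.mem_unitaryGroup_iff]
  ext i j
  fin_cases i <;> fin_cases j <;>
    simp [rowUnitary, Matrix.mul_apply, Fin.sum_univ_two, Matrix.star_apply]
  · linear_combination h
  · ring
  · ring
  · linear_combination h

lemma exists_unit_multiple {x y : ℂ} (h : x ≠ 0 ∨ y ≠ 0) : ∃ r : ℂ,
    r * conj r * (x * conj x + y * conj y) = 1 := by
  have hpos : 0 < Complex.normSq x + Complex.normSq y := by
    rcases h with h | h
    · exact add_pos_of_pos_of_nonneg (Complex.normSq_pos.2 h) (Complex.normSq_nonneg _)
    · exact add_pos_of_nonneg_of_pos (Complex.normSq_nonneg _) (Complex.normSq_pos.2 h)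
  refine ⟨((√(Complex.normSq x + Complex.normSq y))⁻¹ : ℝ), ?_⟩
  rw [Complex.conj_ofReal, Complex.mul_conj, Complex.mul_conj, ← Complex.ofReal_mul,
    ← Complex.ofReal_add, ← Complex.ofReal_mul, ← mul_inv, Real.mul_self_sqrt hpos.le,
    inv_mul_cancel₀ hpos.ne', Complex.ofReal_one]

/-- Two orthogonal vectors of `ℂ²` can be rotated onto the second and the first coordinate axis. -/
lemma exists_rotation (f₀ g₀ f₁ g₁ : ℂ) (h : f₀ * conj f₁ + g₀ * conj g₁ = 0) :
    ∃ p q : ℂ, p * conj p + q * conj q = 1 ∧ p * f₀ + q * g₀ = 0 ∧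
      -conj q * f₁ + conj p * g₁ = 0 := by
  by_cases h1 : f₁ ≠ 0 ∨ g₁ ≠ 0
  · obtain ⟨r, hr⟩ := exists_unit_multiple h1
    refine ⟨r * conj f₁, r * conj g₁, ?_, ?_, ?_⟩
    · simp only [map_mul, Complex.conj_conj]; linear_combination hr
    · linear_combination r * h
    · simp only [map_mul, Complex.conj_conj]; ring
  · push Not at h1
    by_cases h0 : f₀ ≠ 0 ∨ g₀ ≠ 0
    · obtain ⟨r, hr⟩ := exists_unit_multiple h0
      refine ⟨-r * g₀, r * f₀, ?_, by ring, by simp [h1.1, h1.2]⟩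
      simp only [map_mul, map_neg]; linear_combination hr
    · push Not at h0
      exact ⟨1, 0, by simp, by simp [h0.1], by simp [h1.2]⟩

section Layers

variable {A : Type*} [Ring A] [Algebra ℂ A] (ι : Matrix (Fin 2) (Fin 2) ℂ →ₐ[ℂ] A) (w : A)

/-- The unitary `w` controlled on the qubit `ι` being in state `|0⟩`. -/
def zeroControlled : A := ι (Matrix.single 0 0 1) * w + ι (Matrix.single 1 1 1)

/-- Layer stripping: a pair of polynomials with `|F|² + |G|² = 1` on the unit circle is the first
column of an alternating product of one-qubit rotations and controlled signal unitaries. `P n` is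
any property of the products with `n` signal unitaries. -/
lemma exists_signal_sequence (hw : ∀ m, Commute (ι m) w) (P : ℕ → A → Prop)
    (h0 : ∀ R ∈ Matrix.unitaryGroup (Fin 2) ℂ, P 0 (ι R))
    (h1 : ∀ n S, ∀ R ∈ Matrix.unitaryGroup (Fin 2) ℂ,
      P n S → P (n + 1) (ι R * zeroControlled ι w * S))
    (M : ℕ) (F G : ℂ[X]) (hF : F.natDegree ≤ M) (hG : G.natDegree ≤ M)
    (hFG : F * conjReflect M F + G * conjReflect M G = X ^ M) :
    ∃ S, P M S ∧ S * ι (Matrix.single 0 0 1) =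
      ι (Matrix.single 0 0 1) * aeval w F + ι (Matrix.single 1 0 1) * aeval w G := by
  induction M generalizing F G with
  | zero =>
    obtain ⟨f, rfl⟩ := natDegree_eq_zero.1 (Nat.le_zero.1 hF)
    obtain ⟨g, rfl⟩ := natDegree_eq_zero.1 (Nat.le_zero.1 hG)
    have hfg : f * conj f + g * conj g = 1 := by
      simp only [conjReflect, map_C, reflect_C, pow_zero, mul_one, ← C_mul, ← C_add] at hFG
      exact C_injective (hFG.trans C_1.symm)
    refine ⟨_, h0 (star (rowUnitary (conj f) (conj g)))
      (Unitary.star_mem (rowUnitary_mem (by simpa [mul_comm] using hfg))), ?_⟩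
    rw [aeval_C, aeval_C, ← map_mul, ← Algebra.commutes, ← Algebra.commutes, ← Algebra.smul_def,
      ← Algebra.smul_def, ← map_smul, ← map_smul, ← map_add]
    congr 1
    ext i j
    fin_cases i <;> fin_cases j <;>
      simp [rowUnitary, Matrix.mul_apply, Matrix.star_apply, Matrix.single_apply]
  | succ M ih =>
    have horth : F.coeff 0 * conj (F.coeff (M + 1)) + G.coeff 0 * conj (G.coeff (M + 1)) = 0 := by
      have := congrArg (fun p => coeff p 0) hFG
      simpa [mul_coeff_zero, conjReflect, coeff_reflect, coeff_X_pow] using this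
    obtain ⟨p, q, hpq, hp, hq⟩ := exists_rotation _ _ _ _ horth
    set F₁ := C p * F + C q * G with hF₁
    set G₁ := C (-conj q) * F + C (conj p) * G with hG₁
    have hF₁d : F₁.natDegree ≤ M + 1 := (natDegree_add_le _ _).trans
      (max_le ((natDegree_C_mul_le _ _).trans hF) ((natDegree_C_mul_le _ _).trans hG))
    have hG₁d : G₁.natDegree ≤ M + 1 := (natDegree_add_le _ _).trans
      (max_le ((natDegree_C_mul_le _ _).trans hF) ((natDegree_C_mul_le _ _).trans hG))
    have hG₁M : G₁.natDegree ≤ M := by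
      rw [natDegree_le_iff_coeff_eq_zero] at hG₁d ⊢
      intro N hN
      rcases Nat.lt_or_ge (M + 1) N with h | h
      · exact hG₁d N h
      · rw [show N = M + 1 by omega, hG₁]; simpa using hq
    have hF₁X : X * F₁.divX = F₁ := by
      have := divX_mul_X_add F₁
      rw [show F₁.coeff 0 = 0 by rw [hF₁]; simpa using hp, C_0, add_zero, mul_comm] at this
      exact this
    have hFdiv : F₁.divX.natDegree ≤ M := by
      rw [natDegree_divX_eq_natDegree_tsub_one]; omega
    have hid : F₁.divX * conjReflect M F₁.divX + G₁ * conjReflect M G₁ = X ^ M := by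
      have h2 : conjReflect (M + 1) F₁ = conjReflect M F₁.divX := by
        rw [← conjReflect_X_mul hFdiv, hF₁X]
      have h3 := conjReflect_succ hG₁M
      have h4 : F₁ * conjReflect (M + 1) F₁ + G₁ * conjReflect (M + 1) G₁ = X ^ (M + 1) := by
        rw [← hFG, hF₁, hG₁]
        rw [conjReflect_add, conjReflect_add, conjReflect_C_mul, conjReflect_C_mul,
          conjReflect_C_mul, conjReflect_C_mul]
        simp only [map_neg, Complex.conj_conj]
        have := congrArg (C : ℂ → ℂ[X]) hpq
        simp only [C_add, C_mul, C_1] at this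
        linear_combination (F * conjReflect (M + 1) F + G * conjReflect (M + 1) G) * this
      rw [h2, h3] at h4
      refine mul_left_cancel₀ (X_ne_zero (R := ℂ)) ?_
      calc _ = X * F₁.divX * conjReflect M F₁.divX + G₁ * (X * conjReflect M G₁) := by ring
        _ = _ := by rw [hF₁X, h4]; ring
    obtain ⟨S, hS, hSeq⟩ := ih F₁.divX G₁ hFdiv hG₁M hid
    refine ⟨_, h1 M S (star (rowUnitary p q)) (Unitary.star_mem (rowUnitary_mem hpq)) hS, ?_⟩
    have e1 : zeroControlled ι w * (S * ι (Matrix.single 0 0 1)) =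
        ι (Matrix.single 0 0 1) * aeval w F₁ + ι (Matrix.single 1 0 1) * aeval w G₁ := by
      have a1 : ι (Matrix.single 0 0 1) * w * ι (Matrix.single 0 0 1) =
          ι (Matrix.single 0 0 1) * w := by
        rw [mul_assoc, ← (hw _).eq, ← mul_assoc, ← map_mul]; simp
      have a2 : ι (Matrix.single 0 0 1) * w * ι (Matrix.single 1 0 1) = 0 := by
        rw [mul_assoc, ← (hw _).eq, ← mul_assoc, ← map_mul]; simp
      have a3 : ι (Matrix.single 1 1 1) * ι (Matrix.single 0 0 1) = 0 := by
        rw [← map_mul]; simp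
      have a4 : ι (Matrix.single 1 1 1) * ι (Matrix.single 1 0 1) = ι (Matrix.single 1 0 1) := by
        rw [← map_mul]; simp
      have a5 : aeval w F₁ = w * aeval w F₁.divX := by
        conv_lhs => rw [← hF₁X, map_mul, aeval_X]
      rw [hSeq, zeroControlled, add_mul, mul_add, mul_add, ← mul_assoc, a1, ← mul_assoc, a2,
        ← mul_assoc, a3, ← mul_assoc, a4, a5]
      simp [mul_assoc]
    have e2 : F = C (conj p) * F₁ + C (-q) * G₁ := by
      have := congrArg (C : ℂ → ℂ[X]) hpq
      simp only [C_add, C_mul, C_1] at this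
      rw [hF₁, hG₁]; simp only [map_neg]
      linear_combination -F * this
    have e3 : G = C (conj q) * F₁ + C p * G₁ := by
      have := congrArg (C : ℂ → ℂ[X]) hpq
      simp only [C_add, C_mul, C_1] at this
      rw [hF₁, hG₁]; simp only [map_neg]
      linear_combination -G * this
    rw [mul_assoc, mul_assoc, e1, mul_add, ← mul_assoc, ← mul_assoc, ← map_mul, ← map_mul]
    have m1 : star (rowUnitary p q) * Matrix.single 0 0 1 =
        conj p • Matrix.single 0 0 1 + conj q • Matrix.single 1 0 1 := by
      ext i j
      fin_cases i <;> fin_cases j <;>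
        simp [rowUnitary, Matrix.mul_apply, Matrix.star_apply, Matrix.single_apply]
    have m2 : star (rowUnitary p q) * Matrix.single 1 0 1 =
        (-q) • Matrix.single 0 0 1 + p • Matrix.single 1 0 1 := by
      ext i j
      fin_cases i <;> fin_cases j <;>
        simp [rowUnitary, Matrix.mul_apply, Matrix.star_apply, Matrix.single_apply]
    rw [m1, m2, congrArg (aeval w) e2, congrArg (aeval w) e3]
    simp only [map_add, map_mul, aeval_C, map_smul, ← Algebra.smul_def, add_mul, mul_add,
      smul_mul_assoc, mul_smul_comm]
    abel

/-- `X ^ natDegree w * w ((X + X⁻¹) / 2)`. -/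
def laurentLift (W : ℝ[X]) : ℂ[X] :=
  ∑ j ∈ Finset.range (W.natDegree + 1),
    C ((W.coeff j : ℝ) : ℂ) * (X ^ (W.natDegree - j) * (C (1 / 2) * (X ^ 2 + 1)) ^ j)

lemma natDegree_laurentLift_le (W : ℝ[X]) : (laurentLift W).natDegree ≤ 2 * W.natDegree := by
  refine natDegree_sum_le_of_forall_le _ _ fun j hj => (natDegree_C_mul_le _ _).trans ?_
  have := Finset.mem_range.1 hj
  have h2 : (C (1 / 2) * (X ^ 2 + 1) : ℂ[X]).natDegree ≤ 2 := by compute_degree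
  refine natDegree_mul_le.trans ?_
  rw [natDegree_X_pow]
  have h3 := natDegree_pow_le_of_le j h2
  omega

lemma aeval_laurentLift {w v : A} (hwv : w * v = 1) (hvw : v * w = 1) (W : ℝ[X]) :
    aeval w (laurentLift W) =
      w ^ W.natDegree * aeval ((1 / 2 : ℂ) • (w + v)) (W.map (algebraMap ℝ ℂ)) := by
  rw [aeval_eq_sum_range (p := W.map (algebraMap ℝ ℂ)), natDegree_map, laurentLift, map_sum,
    Finset.mul_sum]
  refine Finset.sum_congr rfl fun j hj => ?_
  have hj' : j ≤ W.natDegree := Nat.lt_succ_iff.1 (Finset.mem_range.1 hj)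
  have hc : Commute w ((1 / 2 : ℂ) • (w + v)) := by
    refine Commute.smul_right ?_ _
    exact (Commute.refl w).add_right (hwv.trans hvw.symm)
  have h1 : aeval w (C (1 / 2) * (X ^ 2 + 1) : ℂ[X]) = w * ((1 / 2 : ℂ) • (w + v)) := by
    rw [map_mul, aeval_C, ← Algebra.smul_def, mul_smul_comm, mul_add, hwv]
    simp [pow_two]
  rw [map_mul, map_mul, map_pow, map_pow, h1, aeval_X, aeval_C, hc.mul_pow, ← mul_assoc (w ^ _),
    ← pow_add, Nat.sub_add_cancel hj', coeff_map, mul_smul_comm, ← Algebra.smul_def]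
  rfl

/-- A real polynomial `W` with `|W| < 1` on `[-1, 1]`, evaluated at the hermitian part of a unitary
`w`, is up to the factor `w ^ deg W` a block of a product with `2 deg W` controlled `w`'s. -/
theorem exists_signal_sequence_of_real (hw : ∀ m, Commute (ι m) w) {v : A} (hwv : w * v = 1)
    (hvw : v * w = 1) (P : ℕ → A → Prop) (h0 : ∀ R ∈ Matrix.unitaryGroup (Fin 2) ℂ, P 0 (ι R))
    (h1 : ∀ n S, ∀ R ∈ Matrix.unitaryGroup (Fin 2) ℂ,
      P n S → P (n + 1) (ι R * zeroControlled ι w * S))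
    (W : ℝ[X]) (hW : ∀ c : ℝ, -1 ≤ c → c ≤ 1 → |W.eval c| < 1) :
    ∃ S B, P (2 * W.natDegree) S ∧ S * ι (Matrix.single 0 0 1) =
      ι (Matrix.single 0 0 1) *
        (w ^ W.natDegree * aeval ((1 / 2 : ℂ) • (w + v)) (W.map (algebraMap ℝ ℂ))) +
      ι (Matrix.single 1 0 1) * B := by
  obtain ⟨G, hG, hGz⟩ := exists_normSq_eq_eval_re (1 - W ^ 2) fun c h1 h2 => by
    have := (sq_lt_one_iff_abs_lt_one _).2 (hW c h1 h2)
    simpa using this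
  have hGd : G.natDegree ≤ 2 * W.natDegree := hG.trans ((natDegree_sub_le _ _).trans
    (max_le (by simp) natDegree_pow_le))
  have hid := conjReflect_identity (natDegree_laurentLift_le W) hGd fun z hz => by
    have hzz := circle_mul_conj hz
    have hF := aeval_laurentLift (A := ℂ) hzz ((mul_comm _ _).trans hzz) W
    have h2 : ((1 / 2 : ℂ) • (z + conj z)) = ((z.re : ℝ) : ℂ) := by
      rw [Complex.add_conj, smul_eq_mul]; push_cast; ring
    rw [h2, coe_aeval_eq_eval, coe_aeval_eq_eval] at hF
    have h3 : (W.map (algebraMap ℝ ℂ)).eval ((z.re : ℝ) : ℂ) = ((W.eval z.re : ℝ) : ℂ) := by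
      rw [eval_map, ← Complex.coe_algebraMap, eval₂_at_apply]
    rw [hGz z hz, hF, h3, Complex.normSq_mul, Complex.normSq_ofReal, map_pow,
      Complex.normSq_eq_norm_sq, hz]
    simp only [one_pow, one_mul, eval_sub, eval_one, eval_pow]
    ring
  obtain ⟨S, hS, hSe⟩ := exists_signal_sequence ι w hw P h0 h1 _ _ _ (natDegree_laurentLift_le W)
    hGd hid
  refine ⟨S, aeval w G, hS, ?_⟩
  rw [hSe, aeval_laurentLift hwv hvw]

end Layers

end SignalProcessing

/-! ### Operators acting on one wire, conditioned on the others -/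

section Multiplexed

variable {W : Type} [Fintype W] [DecidableEq W]

/-- The operator applying the one-qubit matrix `u y` to wire `w` of the basis state `y`. -/
def mux (w : W) (u : (W → Fin 2) → Matrix (Fin 2) (Fin 2) ℂ) :
    Matrix (W → Fin 2) (W → Fin 2) ℂ :=
  Matrix.of fun x y => if ∀ v, v ≠ w → x v = y v then u y (x w) (y w) else 0

/-- `f` does not depend on coordinate `w`. -/
def IndepOf {β : Type*} (w : W) (f : (W → Fin 2) → β) : Prop :=
  ∀ x b, f (Function.update x w b) = f x

lemma indepOf_const {β : Type*} (w : W) (c : β) : IndepOf w (fun _ => c) := fun _ _ => rfl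

lemma IndepOf.comp {β γ : Type*} {w : W} {f : (W → Fin 2) → β} (hf : IndepOf w f) (g : β → γ) :
    IndepOf w (fun y => g (f y)) := fun x b => congrArg g (hf x b)

lemma IndepOf.mul {β : Type*} [Mul β] {w : W} {f g : (W → Fin 2) → β} (hf : IndepOf w f)
    (hg : IndepOf w g) : IndepOf w (fun y => f y * g y) := fun x b => by
  simp only [hf x b, hg x b]

lemma _root_.DependsOn.indepOf {β : Type*} {f : (W → Fin 2) → β} {s : Set W} (hf : DependsOn f s)
    {w : W} (hw : w ∉ s) : IndepOf w f := fun _ _ =>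
  hf fun i hi => Function.update_of_ne (fun h : i = w => hw (h ▸ hi)) _ _

lemma fin_two_cases (b : Fin 2) : b = 0 ∨ b = 1 := by fin_cases b <;> simp

lemma dependsOn_update {β : Type*} {c : W} {cs : Finset W} {f : (W → Fin 2) → β}
    (hf : DependsOn f ((insert c cs : Finset W) : Set W)) (b : Fin 2) :
    DependsOn (fun y => f (Function.update y c b)) (cs : Set W) := by
  intro x y hxy
  refine hf fun i hi => ?_
  by_cases h : i = c
  · subst h; simp
  · rw [Function.update_of_ne h, Function.update_of_ne h]
    exact hxy i (by simpa [h] using hi)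

lemma agree_off_iff {w : W} {x y : W → Fin 2} :
    (∀ v, v ≠ w → x v = y v) ↔ x = Function.update y w (x w) := by
  constructor
  · intro h; ext1 v
    by_cases hv : v = w
    · subst hv; simp
    · rw [Function.update_of_ne hv, h v hv]
  · intro h v hv
    rw [h, Function.update_of_ne hv]

lemma IndepOf.congr {β : Type*} {w : W} {f : (W → Fin 2) → β} (hf : IndepOf w f)
    {x y : W → Fin 2} (h : ∀ v, v ≠ w → x v = y v) : f x = f y := by
  rw [agree_off_iff.1 h, hf]

lemma sum_agree_off (w : W) (x : W → Fin 2) (f : (W → Fin 2) → ℂ) :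
    ∑ z, (if ∀ v, v ≠ w → x v = z v then f z else 0) = ∑ b, f (Function.update x w b) := by
  rw [← Finset.sum_filter]
  symm
  refine Finset.sum_nbij' (fun b => Function.update x w b) (fun z => z w) ?_ ?_ ?_ ?_ ?_
  · intro b _
    simp only [Finset.mem_filter, Finset.mem_univ, true_and]
    intro v hv; rw [Function.update_of_ne hv]
  · intro _ _; exact Finset.mem_univ _
  · intro b _; simp
  · intro z hz
    simp only [Finset.mem_filter, Finset.mem_univ, true_and] at hz
    exact (agree_off_iff.1 fun v hv => (hz v hv).symm).symm
  · intro _ _; rfl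

lemma mux_mul_apply {w : W} {u : (W → Fin 2) → Matrix (Fin 2) (Fin 2) ℂ} (hu : IndepOf w u)
    (M : Matrix (W → Fin 2) (W → Fin 2) ℂ) (x y : W → Fin 2) :
    (mux w u * M) x y = ∑ b, u x (x w) b * M (Function.update x w b) y := by
  simp only [Matrix.mul_apply, mux, Matrix.of_apply, ite_mul, zero_mul]
  rw [sum_agree_off w x (fun z => u z (x w) (z w) * M z y)]
  simp [hu x]

lemma mux_mul {w : W} {u u' : (W → Fin 2) → Matrix (Fin 2) (Fin 2) ℂ} (hu : IndepOf w u) :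
    mux w u * mux w u' = mux w (fun y => u y * u' y) := by
  ext x y
  rw [mux_mul_apply hu]
  simp only [mux, Matrix.of_apply]
  have : ∀ b : Fin 2, (∀ v, v ≠ w → Function.update x w b v = y v) ↔ (∀ v, v ≠ w → x v = y v) :=
    fun b => forall₂_congr fun v hv => by rw [Function.update_of_ne hv]
  simp only [this]
  split_ifs with h
  · rw [Matrix.mul_apply, hu.congr h]; simp
  · simp

lemma mux_one (w : W) : mux w (fun _ => 1) = 1 := by
  ext x y
  simp only [mux, Matrix.of_apply, Matrix.one_apply]
  by_cases h : ∀ v, v ≠ w → x v = y v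
  · rw [if_pos h]
    congr 1
    rw [eq_iff_iff]
    refine ⟨fun hw => ?_, fun hw => by rw [hw]⟩
    ext1 v
    by_cases hv : v = w
    · rw [hv, hw]
    · exact h v hv
  · rw [if_neg h, if_neg]
    rintro rfl
    exact h fun _ _ => rfl

lemma mux_conjTranspose {w : W} {u : (W → Fin 2) → Matrix (Fin 2) (Fin 2) ℂ}
    (hu : IndepOf w u) : (mux w u).conjTranspose = mux w (fun y => star (u y)) := by
  ext x y
  simp only [mux, Matrix.conjTranspose_apply, Matrix.of_apply, Matrix.star_apply]
  by_cases h : ∀ v, v ≠ w → x v = y v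
  · rw [if_pos h, if_pos fun v hv => (h v hv).symm, hu.congr h]
  · rw [if_neg h, if_neg fun h' => h fun v hv => (h' v hv).symm, star_zero]

lemma mux_mem_unitary {w : W} {u : (W → Fin 2) → Matrix (Fin 2) (Fin 2) ℂ} (hu : IndepOf w u)
    (h : ∀ y, u y ∈ Matrix.unitaryGroup (Fin 2) ℂ) :
    mux w u ∈ Matrix.unitaryGroup (W → Fin 2) ℂ := by
  rw [Matrix.mem_unitaryGroup_iff, Matrix.star_eq_conjTranspose, mux_conjTranspose hu,
    mux_mul hu, ← mux_one w]
  congr 1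
  funext y
  exact Matrix.mem_unitaryGroup_iff.1 (h y)

/-- The algebra of operators acting on the single wire `c`. -/
def onWire (c : W) : Matrix (Fin 2) (Fin 2) ℂ →ₐ[ℂ] Matrix (W → Fin 2) (W → Fin 2) ℂ :=
  AlgHom.ofLinearMap
    { toFun := fun m => mux c fun _ => m
      map_add' := fun a b => by
        ext x y
        simp only [mux, Matrix.of_apply, Matrix.add_apply]
        split_ifs <;> simp
      map_smul' := fun r a => by
        ext x y
        simp [mux, Matrix.of_apply, Matrix.smul_apply] }
    (mux_one c) (fun a b => (mux_mul (indepOf_const c a)).symm)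

lemma onWire_apply (c : W) (m : Matrix (Fin 2) (Fin 2) ℂ) : onWire c m = mux c fun _ => m := rfl

lemma mul_mux_apply {w : W} {u : (W → Fin 2) → Matrix (Fin 2) (Fin 2) ℂ}
    (M : Matrix (W → Fin 2) (W → Fin 2) ℂ) (x y : W → Fin 2) :
    (M * mux w u) x y = ∑ b, M x (Function.update y w b) * u y b (y w) := by
  simp only [Matrix.mul_apply, mux, Matrix.of_apply, mul_ite, mul_zero]
  have := sum_agree_off w y (fun z => M x z * u y (z w) (y w))
  simp only [Function.update_self] at this
  rw [← this]
  refine Finset.sum_congr rfl fun z _ => ?_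
  congr 1
  rw [eq_iff_iff]
  exact forall₂_congr fun v hv => eq_comm

lemma commute_onWire_mux {w c : W} (hwc : w ≠ c) {u : (W → Fin 2) → Matrix (Fin 2) (Fin 2) ℂ}
    (hu : IndepOf c u) (m : Matrix (Fin 2) (Fin 2) ℂ) : Commute (onWire c m) (mux w u) := by
  ext x y
  rw [onWire_apply, mux_mul_apply (indepOf_const c m), mul_mux_apply]
  simp only [mux, Matrix.of_apply, hu y]
  by_cases h : ∀ v, v ≠ w → v ≠ c → x v = y v
  · rw [Finset.sum_eq_single (y c), Finset.sum_eq_single (x c)]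
    · rw [if_pos, if_pos]
      · simp [Function.update_of_ne hwc]; ring
      · intro v hv
        by_cases hvc : v = c
        · subst hvc; simp
        · rw [Function.update_of_ne hvc, h v hv hvc]
      · intro v hv
        by_cases hvc : v = c
        · subst hvc; simp
        · rw [Function.update_of_ne hvc, h v hv hvc]
    · intro b _ hb
      rw [if_neg, zero_mul]
      intro h'
      have := h' c hwc.symm
      rw [Function.update_self] at this
      exact hb this.symm
    · simp
    · intro b _ hb
      rw [if_neg, mul_zero]
      intro h'
      have := h' c hwc.symm
      rw [Function.update_self] at this
      exact hb this
    · simp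
  · push Not at h
    obtain ⟨v, h1, h2, h3⟩ := h
    rw [Finset.sum_eq_zero, Finset.sum_eq_zero]
    · intro b _
      rw [if_neg, zero_mul]
      intro h'
      exact h3 (by simpa [Function.update_of_ne h2] using h' v h1)
    · intro b _
      rw [if_neg, mul_zero]
      intro h'
      exact h3 (by simpa [Function.update_of_ne h2] using h' v h1)

lemma commute_onWire_diagonal {c : W} {D : (W → Fin 2) → ℂ} (hD : IndepOf c D)
    (m : Matrix (Fin 2) (Fin 2) ℂ) : Commute (onWire c m) (Matrix.diagonal D) := by
  ext x y
  rw [onWire_apply, Matrix.mul_diagonal, Matrix.diagonal_mul]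
  simp only [mux, Matrix.of_apply]
  split_ifs with h
  · rw [hD.congr h, mul_comm]
  · simp

/-- The `b`-th power of the Pauli matrix `X`. -/
def xPow (b : Fin 2) : Matrix (Fin 2) (Fin 2) ℂ := Matrix.of fun i j => if i = j + b then 1 else 0

lemma star_xPow (b : Fin 2) : star (xPow b) = xPow b := by
  ext i j
  fin_cases b <;> fin_cases i <;> fin_cases j <;> simp [xPow, Matrix.star_apply]

lemma xPow_mul_self (b : Fin 2) : xPow b * xPow b = 1 := by
  ext i j
  fin_cases b <;> fin_cases i <;> fin_cases j <;> simp [xPow, Matrix.mul_apply]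

lemma xPow_mem_unitary (b : Fin 2) : xPow b ∈ Matrix.unitaryGroup (Fin 2) ℂ := by
  rw [Matrix.mem_unitaryGroup_iff, star_xPow, xPow_mul_self]

/-- The matrix sending the basis state `y` to the basis state `f y`. -/
def mapMatrix (f : (W → Fin 2) → (W → Fin 2)) : Matrix (W → Fin 2) (W → Fin 2) ℂ :=
  Matrix.of fun x y => if x = f y then 1 else 0

lemma mapMatrix_mul (f g : (W → Fin 2) → (W → Fin 2)) :
    mapMatrix f * mapMatrix g = mapMatrix (f ∘ g) := by
  ext x y
  simp [mapMatrix, Matrix.mul_apply]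

lemma mapMatrix_id : mapMatrix (id : (W → Fin 2) → (W → Fin 2)) = 1 := by
  ext x y
  simp [mapMatrix, Matrix.one_apply]

lemma mul_mapMatrix_apply (M : Matrix (W → Fin 2) (W → Fin 2) ℂ) (f : (W → Fin 2) → (W → Fin 2))
    (x y : W → Fin 2) : (M * mapMatrix f) x y = M x (f y) := by
  simp [mapMatrix, Matrix.mul_apply]

lemma conjTranspose_mapMatrix_mul_apply (M : Matrix (W → Fin 2) (W → Fin 2) ℂ)
    (f : (W → Fin 2) → (W → Fin 2)) (x y : W → Fin 2) :
    ((mapMatrix f).conjTranspose * M) x y = M (f x) y := by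
  simp [mapMatrix, Matrix.mul_apply, Matrix.conjTranspose_apply, apply_ite]

lemma mux_xPow (t : W) (b : (W → Fin 2) → Fin 2) :
    mux t (fun y => xPow (b y)) = mapMatrix fun y => Function.update y t (y t + b y) := by
  ext x y
  simp only [mux, mapMatrix, Matrix.of_apply, xPow]
  rw [← ite_and]
  congr 1
  rw [eq_iff_iff]
  constructor
  · rintro ⟨h1, h2⟩
    rw [agree_off_iff.1 h1, h2]
  · intro h
    refine ⟨fun v hv => by rw [h, Function.update_of_ne hv], by rw [h]; simp⟩

end Multiplexed

/-! ### Gate counts -/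

section GateCount

variable {W : Type} [Fintype W] [DecidableEq W]

lemma Gate.toMatrix_single (w : W) (u : Matrix.unitaryGroup (Fin 2) ℂ) :
    (Gate.single w u).toMatrix = onWire w u := rfl

lemma Gate.toMatrix_cnot (c t : W) (h : c ≠ t) :
    (Gate.cnot c t h).toMatrix = mux t (fun y => xPow (y c)) := by
  rw [mux_xPow]; rfl

lemma Gate.toMatrix_toffoli (c₁ c₂ t : W) (h₁₂ : c₁ ≠ c₂) (h₁ : c₁ ≠ t) (h₂ : c₂ ≠ t) :
    (Gate.toffoli c₁ c₂ t h₁₂ h₁ h₂).toMatrix = mux t (fun y => xPow (y c₁ * y c₂)) := by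
  rw [mux_xPow]; rfl

lemma indepOf_eval {c t : W} (h : c ≠ t) : IndepOf t (fun y : W → Fin 2 => y c) :=
  fun _ _ => Function.update_of_ne h _ _

lemma Gate.exists_conjTranspose (g : Gate W) :
    g.toMatrix ∈ Matrix.unitaryGroup (W → Fin 2) ℂ ∧
      ∃ g' : Gate W, g'.toMatrix = g.toMatrix.conjTranspose := by
  cases g with
  | single w u =>
    refine ⟨mux_mem_unitary (indepOf_const w _) fun _ => u.2, .single w (star u), ?_⟩
    rw [toMatrix_single, toMatrix_single, onWire_apply, onWire_apply,
      mux_conjTranspose (indepOf_const w _)]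
    rfl
  | cnot c t h =>
    have hi := (indepOf_eval h).comp xPow
    refine ⟨?_, .cnot c t h, ?_⟩
    · rw [toMatrix_cnot]; exact mux_mem_unitary hi fun _ => xPow_mem_unitary _
    · rw [toMatrix_cnot, mux_conjTranspose hi]; simp only [star_xPow]
  | toffoli c₁ c₂ t h₁₂ h₁ h₂ =>
    have hi : IndepOf t (fun y : W → Fin 2 => xPow (y c₁ * y c₂)) := fun x b => by
      simp only [Function.update_of_ne h₁, Function.update_of_ne h₂]
    refine ⟨?_, .toffoli c₁ c₂ t h₁₂ h₁ h₂, ?_⟩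
    · rw [toMatrix_toffoli]; exact mux_mem_unitary hi fun _ => xPow_mem_unitary _
    · rw [toMatrix_toffoli, mux_conjTranspose hi]; simp only [star_xPow]

lemma Circuit.toMatrix_mem_unitary (c : Circuit W) :
    Circuit.toMatrix c ∈ Matrix.unitaryGroup (W → Fin 2) ℂ := by
  induction c with
  | nil => exact Submonoid.one_mem _
  | cons g c ih => exact Submonoid.mul_mem _ ih g.exists_conjTranspose.1

/-- The matrix `M` is implemented by a circuit of at most `k` gates. -/
def HasGateCount (M : Matrix (W → Fin 2) (W → Fin 2) ℂ) (k : ℕ) : Prop :=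
  ∃ c : Circuit W, Circuit.toMatrix c = M ∧ c.length ≤ k

lemma Circuit.toMatrix_append (c c' : Circuit W) :
    Circuit.toMatrix (c ++ c') = Circuit.toMatrix c' * Circuit.toMatrix c := by
  induction c with
  | nil => simp [Circuit.toMatrix]
  | cons g c ih => simp [Circuit.toMatrix, ih, mul_assoc]

namespace HasGateCount

variable {M M' : Matrix (W → Fin 2) (W → Fin 2) ℂ} {k k' : ℕ}

lemma mono (h : HasGateCount M k) (hk : k ≤ k') : HasGateCount M k' :=
  let ⟨c, hc, hl⟩ := h; ⟨c, hc, hl.trans hk⟩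

lemma one : HasGateCount (1 : Matrix (W → Fin 2) (W → Fin 2) ℂ) 0 := ⟨[], rfl, le_rfl⟩

lemma mul (h : HasGateCount M k) (h' : HasGateCount M' k') : HasGateCount (M * M') (k + k') := by
  obtain ⟨c, rfl, hl⟩ := h
  obtain ⟨c', rfl, hl'⟩ := h'
  exact ⟨c' ++ c, Circuit.toMatrix_append _ _, by rw [List.length_append]; omega⟩

lemma pow (h : HasGateCount M k) (j : ℕ) : HasGateCount (M ^ j) (j * k) := by
  induction j with
  | zero => simpa using one
  | succ j ih => rw [pow_succ, add_mul, one_mul]; exact ih.mul h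

lemma gate (g : Gate W) : HasGateCount g.toMatrix 1 := ⟨[g], by simp [Circuit.toMatrix], le_rfl⟩

lemma conjTranspose (h : HasGateCount M k) : HasGateCount M.conjTranspose k := by
  obtain ⟨c, rfl, hl⟩ := h
  refine mono ?_ hl
  clear hl
  induction c with
  | nil => simpa [Circuit.toMatrix] using one
  | cons g c ih =>
    obtain ⟨g', hg'⟩ := g.exists_conjTranspose.2
    rw [Circuit.toMatrix, Matrix.conjTranspose_mul, ← hg', List.length_cons, add_comm]
    exact (gate g').mul ih

lemma mem_unitary (h : HasGateCount M k) : M ∈ Matrix.unitaryGroup (W → Fin 2) ℂ := by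
  obtain ⟨c, rfl, -⟩ := h
  exact Circuit.toMatrix_mem_unitary c

lemma onWire (w : W) {u : Matrix (Fin 2) (Fin 2) ℂ} (hu : u ∈ Matrix.unitaryGroup (Fin 2) ℂ) :
    HasGateCount (onWire w u) 1 := gate (.single w ⟨u, hu⟩)

lemma cnot {c t : W} (h : c ≠ t) : HasGateCount (mux t fun y => xPow (y c)) 1 :=
  Gate.toMatrix_cnot c t h ▸ gate (.cnot c t h)

lemma toffoli {c₁ c₂ t : W} (h₁₂ : c₁ ≠ c₂) (h₁ : c₁ ≠ t) (h₂ : c₂ ≠ t) :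
    HasGateCount (mux t fun y => xPow (y c₁ * y c₂)) 1 :=
  Gate.toMatrix_toffoli c₁ c₂ t h₁₂ h₁ h₂ ▸ gate (.toffoli c₁ c₂ t h₁₂ h₁ h₂)

/-- Rotations about a fixed axis which `X` inverts, by an angle depending on the control wires
`cs`: the angle is split into its mean over one control and a correction, whose sign that control
flips by two `CNOT`s. -/
lemma mux_rotation (R : ℝ → Matrix (Fin 2) (Fin 2) ℂ)
    (hR : ∀ a, R a ∈ Matrix.unitaryGroup (Fin 2) ℂ) (hadd : ∀ a b, R a * R b = R (a + b))
    (hX : ∀ a, xPow 1 * R a * xPow 1 = R (-a)) (w : W) (cs : Finset W) (hw : w ∉ cs)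
    (θ : (W → Fin 2) → ℝ) (hθ : DependsOn θ (cs : Set W)) :
    HasGateCount (mux w fun y => R (θ y)) (3 * 2 ^ cs.card - 2) := by
  induction cs using Finset.induction_on generalizing θ with
  | empty =>
    have : (fun y => R (θ y)) = fun _ => R (θ 0) := by
      funext y; rw [hθ fun i hi => by simp at hi]
    rw [this]
    exact onWire w (hR _)
  | insert c cs hc ih =>
    rw [Finset.mem_insert, not_or] at hw
    have hup := dependsOn_update hθ
    have hd0 : DependsOn (fun y => (θ (Function.update y c 0) + θ (Function.update y c 1)) / 2)
        (cs : Set W) := fun x y hxy => by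
      simp only [hup 0 hxy, hup 1 hxy]
    have hd1 : DependsOn (fun y => (θ (Function.update y c 0) - θ (Function.update y c 1)) / 2)
        (cs : Set W) := fun x y hxy => by
      simp only [hup 0 hxy, hup 1 hxy]
    have hcn := cnot (W := W) (Ne.symm hw.1)
    have key := ((ih hw.2 _ hd0).mul hcn).mul ((ih hw.2 _ hd1).mul hcn)
    have i0 := ((hd0.indepOf (by simpa using hw.2 : w ∉ (cs : Set W))).comp R)
    have i1 := ((hd1.indepOf (by simpa using hw.2 : w ∉ (cs : Set W))).comp R)
    have ic := ((indepOf_eval (Ne.symm hw.1)).comp xPow)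
    rw [mux_mul i0, mux_mul i1, mux_mul (i0.mul ic)] at key
    have hpos : 1 ≤ 2 ^ cs.card := Nat.one_le_two_pow
    refine (HasGateCount.mono ?_ (by rw [Finset.card_insert_of_notMem hc, pow_succ]; omega :
      3 * 2 ^ cs.card - 2 + 1 + (3 * 2 ^ cs.card - 2 + 1) ≤ 3 * 2 ^ (insert c cs).card - 2))
    convert key using 2
    funext y
    rw [mul_assoc, ← mul_assoc (xPow _) (R _)]
    rcases fin_two_cases (y c) with hy | hy
    · have hx0 : xPow 0 = 1 := by
        ext i j; simp [xPow, Matrix.one_apply]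
      rw [hy, hx0, one_mul, mul_one, hadd, ← hy, Function.update_eq_self]
      congr 1; ring
    · rw [hy, hX, hadd, ← hy, Function.update_eq_self]
      congr 1; ring

end HasGateCount

/-- Rotation of the real plane. -/
def rotY (θ : ℝ) : Matrix (Fin 2) (Fin 2) ℂ :=
  !![(Real.cos θ : ℂ), -(Real.sin θ : ℂ); (Real.sin θ : ℂ), (Real.cos θ : ℂ)]

/-- Opposite phases on the two basis states. -/
def rotZ (θ : ℝ) : Matrix (Fin 2) (Fin 2) ℂ :=
  !![Complex.exp (θ * Complex.I), 0; 0, Complex.exp (-(θ * Complex.I))]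

lemma rotY_add (a b : ℝ) : rotY a * rotY b = rotY (a + b) := by
  ext i j
  fin_cases i <;> fin_cases j <;>
    simp [rotY, Matrix.mul_apply, Complex.cos_add, Complex.sin_add] <;> ring

lemma rotZ_add (a b : ℝ) : rotZ a * rotZ b = rotZ (a + b) := by
  ext i j
  fin_cases i <;> fin_cases j <;>
    simp [rotZ, Matrix.mul_apply, ← Complex.exp_add] <;> ring_nf

lemma star_rotY (a : ℝ) : star (rotY a) = rotY (-a) := by
  ext i j
  fin_cases i <;> fin_cases j <;>
    simp [rotY, Matrix.star_apply, ← Complex.cos_conj, ← Complex.sin_conj]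

lemma star_rotZ (a : ℝ) : star (rotZ a) = rotZ (-a) := by
  ext i j
  fin_cases i <;> fin_cases j <;>
    simp [rotZ, Matrix.star_apply, ← Complex.exp_conj]

lemma rotY_mem (a : ℝ) : rotY a ∈ Matrix.unitaryGroup (Fin 2) ℂ := by
  rw [Matrix.mem_unitaryGroup_iff, star_rotY, rotY_add, add_neg_cancel]
  ext i j
  fin_cases i <;> fin_cases j <;> simp [rotY]

lemma rotZ_mem (a : ℝ) : rotZ a ∈ Matrix.unitaryGroup (Fin 2) ℂ := by
  rw [Matrix.mem_unitaryGroup_iff, star_rotZ, rotZ_add, add_neg_cancel]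
  ext i j
  fin_cases i <;> fin_cases j <;> simp [rotZ]

lemma xPow_rotY (a : ℝ) : xPow 1 * rotY a * xPow 1 = rotY (-a) := by
  ext i j
  fin_cases i <;> fin_cases j <;> simp [rotY, xPow, Matrix.mul_apply]

lemma xPow_rotZ (a : ℝ) : xPow 1 * rotZ a * xPow 1 = rotZ (-a) := by
  ext i j
  fin_cases i <;> fin_cases j <;> simp [rotZ, xPow, Matrix.mul_apply]

end GateCount

/-! ### Diagonal operators, controlled flips and state preparation -/

section Primitives

variable {W : Type} [Fintype W] [DecidableEq W]

lemma mux_eq_diagonal {c : W} {u : (W → Fin 2) → Matrix (Fin 2) (Fin 2) ℂ}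
    (h : ∀ y i j, i ≠ j → u y i j = 0) :
    mux c u = Matrix.diagonal fun y => u y (y c) (y c) := by
  ext x y
  rw [Matrix.diagonal_apply]
  simp only [mux, Matrix.of_apply]
  split_ifs with h1 h2 h2
  · rw [h2]
  · refine h _ _ _ fun hc => h2 ?_
    rw [agree_off_iff.1 h1, hc, Function.update_eq_self]
  · subst h2; exact absurd (fun _ _ => rfl) h1
  · rfl

namespace HasGateCount

/-- The phase is split into its mean over one of the wires, which remains a phase depending on fewer
wires, and opposite corrections for the two values of this wire, a multiplexed rotation. -/
lemma diagonal_exp [Nonempty W] (cs : Finset W) (phi : (W → Fin 2) → ℝ)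
    (h_phi : DependsOn phi (cs : Set W)) :
    HasGateCount (Matrix.diagonal fun y => Complex.exp (phi y * Complex.I)) (3 * 2 ^ cs.card) := by
  induction cs using Finset.induction_on generalizing phi with
  | empty =>
    obtain ⟨w⟩ := ‹Nonempty W›
    have hc : ∀ y, phi y = phi 0 := fun y => h_phi fun i hi => by simp at hi
    have hu : Complex.exp (phi 0 * Complex.I) • (1 : Matrix (Fin 2) (Fin 2) ℂ) ∈
        Matrix.unitaryGroup (Fin 2) ℂ := by
      rw [Matrix.mem_unitaryGroup_iff, star_smul, star_one, smul_mul_smul_comm, one_mul]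
      have : Complex.exp (phi 0 * Complex.I) * star (Complex.exp (phi 0 * Complex.I)) = 1 := by
        rw [Complex.star_def, Complex.mul_conj, Complex.normSq_eq_norm_sq,
          Complex.norm_exp_ofReal_mul_I]
        simp
      rw [this, one_smul]
    refine (mono ?_ (by norm_num : 1 ≤ 3 * 2 ^ (∅ : Finset W).card))
    convert onWire w hu using 1
    rw [onWire_apply, mux_eq_diagonal fun y i j hij => by simp [hij]]
    simp [hc]
  | insert c cs hc ih =>
    have h0 := dependsOn_update h_phi 0
    have h1 := dependsOn_update h_phi 1
    have hα := ih (fun y => (phi (Function.update y c 0) + phi (Function.update y c 1)) / 2)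
      fun x y hxy => by simp only [h0 hxy, h1 hxy]
    have hβ := mux_rotation rotZ rotZ_mem rotZ_add xPow_rotZ c cs hc
      (fun y => (phi (Function.update y c 0) - phi (Function.update y c 1)) / 2)
      fun x y hxy => by simp only [h0 hxy, h1 hxy]
    rw [mux_eq_diagonal fun y i j hij => by
      fin_cases i <;> fin_cases j <;> simp [rotZ] at hij ⊢] at hβ
    have key := hα.mul hβ
    rw [Matrix.diagonal_mul_diagonal] at key
    refine mono ?_ (by rw [Finset.card_insert_of_notMem hc, pow_succ]; omega :
      3 * 2 ^ cs.card + (3 * 2 ^ cs.card - 2) ≤ 3 * 2 ^ (insert c cs).card)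
    suffices e : ∀ y, Complex.exp (((phi (Function.update y c 0) +
          phi (Function.update y c 1)) / 2 : ℝ) * Complex.I) *
        rotZ ((phi (Function.update y c 0) - phi (Function.update y c 1)) / 2) (y c) (y c) =
        Complex.exp (phi y * Complex.I) by simpa only [e] using key
    intro y
    rcases fin_two_cases (y c) with h | h
    · simp only [h, rotZ]
      have : Function.update y c 0 = y := by rw [← h, Function.update_eq_self]
      rw [this]
      simp only [Matrix.of_apply, Matrix.cons_val', Matrix.cons_val_zero]
      rw [← Complex.exp_add]
      congr 1; push_cast; ring
    · simp only [h, rotZ]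
      have : Function.update y c 1 = y := by rw [← h, Function.update_eq_self]
      rw [this]
      simp only [Matrix.of_apply, Matrix.cons_val', Matrix.cons_val_one, Matrix.cons_val_fin_one]
      rw [← Complex.exp_add]
      congr 1; push_cast; ring

lemma diagonal_sign [Nonempty W] (cs : Finset W) (b : (W → Fin 2) → Fin 2)
    (hb : DependsOn b (cs : Set W)) :
    HasGateCount (Matrix.diagonal fun y => (-1 : ℂ) ^ (b y : ℕ)) (3 * 2 ^ cs.card) := by
  have := diagonal_exp cs (fun y => Real.pi * (b y : ℕ)) fun x y hxy => by
    simp only [hb hxy]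
  convert this using 3
  rename_i y
  rcases fin_two_cases (b y) with h | h <;> simp [h, Complex.exp_pi_mul_I]

/-- A flip of a wire is a sign depending on this wire followed by a rotation by a right angle. -/
lemma controlled_flip (t : W) (cs : Finset W) (ht : t ∉ cs) (b : (W → Fin 2) → Fin 2)
    (hb : DependsOn b (cs : Set W)) :
    HasGateCount (mapMatrix fun y => Function.update y t (y t + b y)) (9 * 2 ^ cs.card) := by
  have : Nonempty W := ⟨t⟩
  have h1 := mux_rotation rotY rotY_mem rotY_add xPow_rotY t cs ht
    (fun y => Real.pi / 2 * (b y : ℕ)) fun x y hxy => by simp only [hb hxy]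
  have h2 := diagonal_sign (insert t cs) (fun y => b y * y t) fun x y hxy => by
    have e1 : b x = b y := hb fun i hi => hxy i (by simp_all)
    have e2 : x t = y t := hxy t (by simp)
    simp only [e1, e2]
  have e : (Matrix.diagonal fun y : W → Fin 2 => (-1 : ℂ) ^ ((b y * y t : Fin 2) : ℕ)) =
      mux t fun y => Matrix.diagonal fun i => (-1 : ℂ) ^ ((b y * i : Fin 2) : ℕ) := by
    rw [mux_eq_diagonal fun y i j hij => Matrix.diagonal_apply_ne _ hij]
    simp
  have hbt : IndepOf t b := hb.indepOf (by simpa using ht)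
  have key := h1.mul h2
  rw [e, mux_mul (hbt.comp fun a => rotY (Real.pi / 2 * (a : ℕ)))] at key
  refine mono ?_ (by rw [Finset.card_insert_of_notMem ht, pow_succ]; omega :
    3 * 2 ^ cs.card - 2 + 3 * 2 ^ (insert t cs).card ≤ 9 * 2 ^ cs.card)
  rw [← mux_xPow]
  convert key using 2
  funext y
  ext i j
  rcases fin_two_cases (b y) with h | h <;> fin_cases i <;> fin_cases j <;>
    simp [h, rotY, xPow]

end HasGateCount

/-- Preparation of a real unit vector `v` on the register `e`, one multiplexed rotation per wire.
Wires outside the register are not touched. -/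
lemma exists_statePrep [Nonempty W] {m : ℕ} (e : Fin m → W) (he : Function.Injective e)
    (v : (Fin m → Fin 2) → ℝ) (hv : ∑ b, v b ^ 2 = 1) :
    ∃ P : Matrix (W → Fin 2) (W → Fin 2) ℂ, HasGateCount P (3 * 2 ^ m) ∧
      (∀ c, (∀ j, c ≠ e j) → ∀ a, Commute (onWire c a) P) ∧
      ∀ x y, (∀ j, y (e j) = 0) →
        P x y = if ∀ w, (∀ j, w ≠ e j) → x w = y w then (v (x ∘ e) : ℂ) else 0 := by
  induction m with
  | zero =>
    obtain ⟨w⟩ := ‹Nonempty W›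
    have hv1 : v default ^ 2 = 1 := by
      rwa [Fintype.sum_eq_single default fun b hb => absurd (Subsingleton.elim b default) hb] at hv
    have hu : (v default : ℂ) • (1 : Matrix (Fin 2) (Fin 2) ℂ) ∈
        Matrix.unitaryGroup (Fin 2) ℂ := by
      rw [Matrix.mem_unitaryGroup_iff, star_smul, star_one, smul_mul_smul_comm, one_mul,
        Complex.star_def, Complex.conj_ofReal, ← Complex.ofReal_mul, ← pow_two, hv1]
      simp
    refine ⟨onWire w ((v default : ℂ) • 1), (HasGateCount.onWire w hu).mono (by norm_num), ?_, ?_⟩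
    · intro c _ a
      rw [map_smul, map_one]
      exact (Commute.one_right _).smul_right _
    · intro x y _
      rw [map_smul, map_one, Matrix.smul_apply, Matrix.one_apply, Subsingleton.elim (x ∘ e) default]
      simp [funext_iff]
  | succ m ih =>
    set r : (Fin m → Fin 2) → ℝ := fun b => √(v (Fin.cons 0 b) ^ 2 + v (Fin.cons 1 b) ^ 2) with hr
    have hr1 : ∑ b, r b ^ 2 = 1 := by
      rw [← hv, ← (Fin.consEquiv fun _ => Fin 2).sum_comp, Fintype.sum_prod_type, Fin.sum_univ_two,
        ← Finset.sum_add_distrib]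
      exact Finset.sum_congr rfl fun b _ => Real.sq_sqrt (by positivity)
    have hθ : ∀ b, ∃ θ : ℝ, v (Fin.cons 0 b) = r b * Real.cos θ ∧
        v (Fin.cons 1 b) = r b * Real.sin θ := by
      intro b
      have h := Complex.norm_mul_cos_arg (⟨v (Fin.cons 0 b), v (Fin.cons 1 b)⟩ : ℂ)
      have h' := Complex.norm_mul_sin_arg (⟨v (Fin.cons 0 b), v (Fin.cons 1 b)⟩ : ℂ)
      rw [Complex.norm_def, Complex.normSq_mk, ← pow_two, ← pow_two] at h h'
      exact ⟨_, h.symm, h'.symm⟩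
    choose θ hθ0 hθ1 using hθ
    obtain ⟨P, hP, hPc, hPe⟩ := ih (e ∘ Fin.succ) (he.comp (Fin.succ_injective _)) r hr1
    set cs : Finset W := Finset.univ.image (e ∘ Fin.succ)
    have hcs : cs.card ≤ m := by
      simpa using Finset.card_image_le (s := Finset.univ) (f := e ∘ Fin.succ)
    have he0 : e 0 ∉ cs := by
      simp only [cs, Finset.mem_image, Finset.mem_univ, true_and, not_exists]
      intro j h
      exact Fin.succ_ne_zero j (he h)
    have hdep : DependsOn (fun y : W → Fin 2 => θ (y ∘ e ∘ Fin.succ)) (cs : Set W) := by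
      intro x y hxy
      exact congrArg θ (funext fun j => hxy _ (by simp [cs]))
    have hR := HasGateCount.mux_rotation rotY rotY_mem rotY_add xPow_rotY (e 0) cs he0 _ hdep
    have hi : IndepOf (e 0) (fun y : W → Fin 2 => rotY (θ (y ∘ e ∘ Fin.succ))) :=
      (hdep.indepOf (by simpa using he0)).comp rotY
    refine ⟨_, (hR.mul hP).mono ?_, ?_, ?_⟩
    · have := Nat.pow_le_pow_right (n := 2) (by norm_num) hcs
      rw [pow_succ]; omega
    · intro c hc a
      refine Commute.mul_right (commute_onWire_mux (hc 0).symm ?_ a)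
        (hPc c (fun j => hc j.succ) a)
      refine (hdep.indepOf ?_).comp rotY
      simp only [cs, Finset.coe_image, Set.mem_image, not_exists]
      intro j hj
      exact hc j.succ hj.2.symm
    · intro x y hy
      rw [mux_mul_apply hi, Finset.sum_eq_single 0]
      · rw [hPe _ _ fun j => hy j.succ]
        have e1 : (Function.update x (e 0) 0) ∘ e ∘ Fin.succ = x ∘ e ∘ Fin.succ := by
          funext j
          exact Function.update_of_ne (fun h => Fin.succ_ne_zero j (he h)) _ _
        have e2 : (∀ w, (∀ j, w ≠ (e ∘ Fin.succ) j) → Function.update x (e 0) 0 w = y w) ↔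
            ∀ w, (∀ j, w ≠ e j) → x w = y w := by
          constructor
          · intro h w hw
            have := h w fun j => hw j.succ
            rwa [Function.update_of_ne (hw 0)] at this
          · intro h w hw
            by_cases hw0 : w = e 0
            · rw [hw0, Function.update_self, hy 0]
            · rw [Function.update_of_ne hw0]
              refine h w fun j => ?_
              refine Fin.cases hw0 (fun j => hw j) j
        simp only [e1, e2]
        split_ifs
        · have e3 : x ∘ e = Fin.cons (x (e 0)) (x ∘ e ∘ Fin.succ) := (Fin.cons_self_tail _).symm
          rw [e3]
          rcases fin_two_cases (x (e 0)) with h | h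
          · rw [h, hθ0]; simp [rotY]; ring
          · rw [h, hθ1]; simp [rotY]; ring
        · simp
      · intro b _ hb
        rw [hPe _ _ fun j => hy j.succ, if_neg, mul_zero]
        intro h
        have := h (e 0) fun j hj => Fin.succ_ne_zero j (he hj.symm)
        rw [Function.update_self, hy 0] at this
        exact hb this
      · simp

end Primitives

/-! ### Table lookup -/

section Lookup

variable {W : Type} [Fintype W] [DecidableEq W]

/-- A binary tree of multiplexers moves the content of the wire addressed by the register `e` to
one fixed wire, the root. A node with roots `w₀`, `w₁` of its subtrees adds `w₀` to `w₁` and then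
the product of the address bit with `w₁` to `w₀`. -/
lemma exists_lookup {m : ℕ} (e : Fin m → W) (leaf : (Fin m → Fin 2) → Option W)
    (hinj : ∀ b b' l, leaf b = some l → leaf b' = some l → b = b')
    (hdisj : ∀ b l j, leaf b = some l → l ≠ e j) :
    ∃ (f : (W → Fin 2) → (W → Fin 2)) (root : Option W),
      HasGateCount (mapMatrix f) (2 * 2 ^ m - 2) ∧
      (root = none → ∀ b, leaf b = none) ∧
      (∀ r, root = some r → (∃ b, leaf b = some r) ∧
        ∀ y l, leaf (y ∘ e) = some l → f y r = y l) ∧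
      (∀ y v, (∀ b, leaf b ≠ some v) → f y v = y v) ∧
      (∀ c, (∀ j, c ≠ e j) → (∀ b, leaf b ≠ some c) →
        ∀ y b, f (Function.update y c b) = Function.update (f y) c b) := by
  induction m with
  | zero =>
    refine ⟨id, leaf default, by rw [mapMatrix_id]; exact HasGateCount.one.mono (by norm_num),
      fun h b => by rwa [Subsingleton.elim b default], fun r hr => ⟨⟨_, hr⟩, fun y l hl => ?_⟩,
      fun _ _ _ => rfl, fun _ _ _ _ _ => rfl⟩
    rw [Subsingleton.elim (y ∘ e) default, hr] at hl
    cases hl; rfl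
  | succ m ih =>
    have hcons : ∀ y : W → Fin 2, y ∘ e = Fin.cons (y (e 0)) (y ∘ e ∘ Fin.succ) :=
      fun y => (Fin.cons_self_tail _).symm
    obtain ⟨f₀, r₀, hf₀, hn₀, hs₀, hk₀, hu₀⟩ := ih (e ∘ Fin.succ) (fun b => leaf (Fin.cons 0 b))
      (fun b b' l h h' => (Fin.cons_inj.1 (hinj _ _ l h h')).2) (fun b l j h => hdisj _ l j.succ h)
    obtain ⟨f₁, r₁, hf₁, hn₁, hs₁, hk₁, hu₁⟩ := ih (e ∘ Fin.succ) (fun b => leaf (Fin.cons 1 b))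
      (fun b b' l h h' => (Fin.cons_inj.1 (hinj _ _ l h h')).2) (fun b l j h => hdisj _ l j.succ h)
    have hpow : 1 ≤ 2 ^ m := Nat.one_le_two_pow
    have h01 : ∀ b b' l l', leaf (Fin.cons 0 b) = some l → leaf (Fin.cons 1 b') = some l' →
        l ≠ l' := by
      rintro b b' l l' h h' rfl
      exact zero_ne_one (Fin.cons_inj.1 (hinj _ _ _ h h')).1
    rcases r₀ with _ | w₀
    · refine ⟨f₁, r₁, hf₁.mono (by rw [pow_succ]; omega), ?_, ?_, ?_, ?_⟩
      · intro h b
        rw [← Fin.cons_self_tail b]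
        rcases fin_two_cases (b 0) with h0 | h0 <;> rw [h0]
        · exact hn₀ rfl _
        · exact hn₁ h _
      · intro r hr
        obtain ⟨⟨b, hb⟩, hl⟩ := hs₁ r hr
        refine ⟨⟨_, hb⟩, fun y l h => ?_⟩
        rw [hcons] at h
        rcases fin_two_cases (y (e 0)) with h0 | h0 <;> rw [h0] at h
        · exact absurd (h.symm.trans (hn₀ rfl _)) (by simp)
        · exact hl y l h
      · exact fun y v h => hk₁ y v fun b => h _
      · exact fun c h h' => hu₁ c (fun j => h _) fun b => h' _
    · rcases r₁ with _ | w₁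
      · refine ⟨f₀, some w₀, hf₀.mono (by rw [pow_succ]; omega), by simp, ?_, ?_, ?_⟩
        · intro r hr
          obtain ⟨⟨b, hb⟩, hl⟩ := hs₀ r hr
          refine ⟨⟨_, hb⟩, fun y l h => ?_⟩
          rw [hcons] at h
          rcases fin_two_cases (y (e 0)) with h0 | h0 <;> rw [h0] at h
          · exact hl y l h
          · exact absurd (h.symm.trans (hn₁ rfl _)) (by simp)
        · exact fun y v h => hk₀ y v fun b => h _
        · exact fun c h h' => hu₀ c (fun j => h _) fun b => h' _
      · obtain ⟨⟨b₀, hb₀⟩, hl₀⟩ := hs₀ w₀ rfl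
        obtain ⟨⟨b₁, hb₁⟩, hl₁⟩ := hs₁ w₁ rfl
        have hw : w₀ ≠ w₁ := h01 _ _ _ _ hb₀ hb₁
        have he0 : e 0 ≠ w₀ := (hdisj _ _ _ hb₀).symm
        have he1 : e 0 ≠ w₁ := (hdisj _ _ _ hb₁).symm
        have hc := HasGateCount.cnot (W := W) hw
        have ht := HasGateCount.toffoli (W := W) he1 he0 hw.symm
        rw [mux_xPow] at hc ht
        have key := ht.mul (hc.mul (hf₁.mul hf₀))
        simp only [mapMatrix_mul] at key
        refine ⟨_, some w₀, key.mono (by rw [pow_succ]; omega), by simp, ?_, ?_, ?_⟩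
        · rintro r ⟨⟩
          refine ⟨⟨_, hb₀⟩, fun y l h => ?_⟩
          have a0 : f₁ (f₀ y) w₀ = f₀ y w₀ := hk₁ _ _ fun b hb => h01 _ _ _ _ hb₀ hb rfl
          have a1 : f₁ (f₀ y) (e 0) = y (e 0) := by
            rw [hk₁ _ _ fun b hb => hdisj _ _ 0 hb rfl, hk₀ _ _ fun b hb => hdisj _ _ 0 hb rfl]
          have a2 : (f₀ y) ∘ e ∘ Fin.succ = y ∘ e ∘ Fin.succ := by
            funext j
            exact hk₀ _ _ fun b hb => hdisj _ _ j.succ hb rfl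
          simp only [Function.comp_apply, Function.update_self, Function.update_of_ne hw,
            Function.update_of_ne he1, a0, a1]
          rw [hcons] at h
          rcases fin_two_cases (y (e 0)) with h0 | h0 <;> rw [h0] at h ⊢
          · rw [zero_mul, add_zero]
            exact hl₀ y l h
          · have a3 : f₁ (f₀ y) w₁ = f₀ y l := hl₁ (f₀ y) l (by rw [a2]; exact h)
            have a4 : f₀ y l = y l := hk₀ _ _ fun b hb => h01 _ _ _ _ hb h rfl
            rw [a3, a4, one_mul]
            generalize f₀ y w₀ = p
            generalize y l = q
            revert p q; decide
        · intro y v h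
          have v0 : v ≠ w₀ := fun hv => h _ (hv ▸ hb₀)
          have v1 : v ≠ w₁ := fun hv => h _ (hv ▸ hb₁)
          simp only [Function.comp_apply, Function.update_of_ne v0, Function.update_of_ne v1]
          rw [hk₁ _ _ fun b => h _, hk₀ _ _ fun b => h _]
        · intro c h h' y b
          have v0 : c ≠ w₀ := fun hv => h' _ (hv ▸ hb₀)
          have v1 : c ≠ w₁ := fun hv => h' _ (hv ▸ hb₁)
          simp only [Function.comp_apply]
          rw [hu₀ c (fun j => h _) (fun b => h' _), hu₁ c (fun j => h _) (fun b => h' _)]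
          generalize f₁ (f₀ y) = z
          simp only [Function.update_of_ne v0.symm, Function.update_of_ne v1.symm,
            Function.update_of_ne (h 0).symm, Function.update_comm v1]
          rw [Function.update_comm v0]

/-- The sign `(-1) ^ s`, with `s` the content of the wire addressed by the register `e`, costs a
number of gates proportional to the number of addresses. -/
lemma exists_select_sign {m : ℕ} (e : Fin m → W) (leaf : (Fin m → Fin 2) → Option W)
    (hinj : ∀ b b' l, leaf b = some l → leaf b' = some l → b = b')
    (hdisj : ∀ b l j, leaf b = some l → l ≠ e j) :
    ∃ D : (W → Fin 2) → ℂ, HasGateCount (Matrix.diagonal D) (4 * 2 ^ m) ∧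
      (∀ y l, leaf (y ∘ e) = some l → D y = (-1) ^ (y l : ℕ)) ∧
      ∀ c, (∀ j, c ≠ e j) → (∀ b, leaf b ≠ some c) → IndepOf c D := by
  obtain ⟨f, root, hf, hn, hs, -, hu⟩ := exists_lookup e leaf hinj hdisj
  rcases root with _ | r
  · refine ⟨fun _ => 1, by rw [Matrix.diagonal_one]; exact HasGateCount.one.mono (Nat.zero_le _),
      fun y l h => ?_, fun c _ _ => indepOf_const c _⟩
    rw [hn rfl] at h; cases h
  · obtain ⟨⟨b, hb⟩, hl⟩ := hs r rfl
    have hz := HasGateCount.onWire r (u := Matrix.diagonal fun i : Fin 2 => (-1 : ℂ) ^ (i : ℕ)) (by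
      rw [Matrix.mem_unitaryGroup_iff]
      ext i j
      fin_cases i <;> fin_cases j <;> simp [Matrix.star_eq_conjTranspose])
    rw [onWire_apply, mux_eq_diagonal fun y i j hij => Matrix.diagonal_apply_ne _ hij] at hz
    have key := hf.conjTranspose.mul (hz.mul hf)
    have hfi : ∀ x y, (if f x = f y then (1 : ℂ) else 0) = if x = y then 1 else 0 := by
      intro x y
      have h1 := Matrix.mem_unitaryGroup_iff'.1 hf.mem_unitary
      have h2 := congrFun (congrFun h1 x) y
      rwa [Matrix.star_eq_conjTranspose, conjTranspose_mapMatrix_mul_apply, Matrix.one_apply] at h2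
    refine ⟨fun y => (-1) ^ (f y r : ℕ), ?_, fun y l h => by simp only [hl y l h], ?_⟩
    · have hpow : 1 ≤ 2 ^ m := Nat.one_le_two_pow
      refine HasGateCount.mono ?_ (by omega : 2 * 2 ^ m - 2 + (1 + (2 * 2 ^ m - 2)) ≤ 4 * 2 ^ m)
      convert key using 1
      ext x y
      rw [conjTranspose_mapMatrix_mul_apply, Matrix.diagonal_mul, mapMatrix, Matrix.of_apply, hfi,
        Matrix.diagonal_apply, Matrix.diagonal_apply_eq]
      simp
    · intro c h h' y b'
      have hrc : r ≠ c := fun hr => h' b (hr ▸ hb)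
      simp only [hu c h h', Function.update_of_ne hrc]

end Lookup

/-! ### Block encoding of polynomials of a projected overlap -/

section Walk

open Polynomial

variable {W : Type} [Fintype W] [DecidableEq W]

lemma sum_agree_off_register {m : ℕ} {e : Fin m → W} (he : Function.Injective e) (y : W → Fin 2)
    (f : (W → Fin 2) → ℂ) :
    ∑ z, (if ∀ w, (∀ j, w ≠ e j) → z w = y w then f z else 0) =
      ∑ b : Fin m → Fin 2, f (Function.extend e b y) := by
  rw [← Finset.sum_filter]
  symm
  refine Finset.sum_nbij' (fun b => Function.extend e b y) (fun z => z ∘ e) ?_ ?_ ?_ ?_ ?_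
  · intro b _
    simp only [Finset.mem_filter, Finset.mem_univ, true_and]
    intro w hw
    rw [Function.extend_apply' _ _ _ fun ⟨j, hj⟩ => hw j hj.symm]
  · intro _ _; exact Finset.mem_univ _
  · intro b _; exact Function.extend_comp he _ _
  · intro z hz
    simp only [Finset.mem_filter, Finset.mem_univ, true_and] at hz
    funext w
    by_cases hw : ∃ j, e j = w
    · obtain ⟨j, rfl⟩ := hw
      rw [he.extend_apply]; rfl
    · rw [Function.extend_apply' _ _ _ hw, hz w fun j hj => hw ⟨j, hj.symm⟩]
  · intro _ _; rfl

/-- An operator which is diagonal for fixed contents of the wires outside a register, sandwiched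
between two state preparations on the register. -/
lemma statePrep_sandwich {m : ℕ} {e : Fin m → W} (he : Function.Injective e)
    {P P' : Matrix (W → Fin 2) (W → Fin 2) ℂ} {v v' : (Fin m → Fin 2) → ℝ}
    (hP : ∀ x y, (∀ j, y (e j) = 0) →
      P x y = if ∀ w, (∀ j, w ≠ e j) → x w = y w then (v (x ∘ e) : ℂ) else 0)
    (hP' : ∀ x y, (∀ j, y (e j) = 0) →
      P' x y = if ∀ w, (∀ j, w ≠ e j) → x w = y w then (v' (x ∘ e) : ℂ) else 0)
    (M : Matrix (W → Fin 2) (W → Fin 2) ℂ) (μ : (W → Fin 2) → ℂ) {x y : W → Fin 2}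
    (hx : ∀ j, x (e j) = 0) (hy : ∀ j, y (e j) = 0)
    (hM : ∀ z z', (∀ w, (∀ j, w ≠ e j) → z w = x w) → (∀ w, (∀ j, w ≠ e j) → z' w = y w) →
      M z z' = if z = z' then μ z else 0) :
    (P.conjTranspose * M * P') x y =
      if x = y then ∑ b, ((v b * v' b : ℝ) : ℂ) * μ (Function.extend e b y) else 0 := by
  have h1 : ∀ z, (P.conjTranspose * M) x z * P' z y =
      if ∀ w, (∀ j, w ≠ e j) → z w = y w then
        (if ∀ w, (∀ j, w ≠ e j) → z w = x w then ((v (z ∘ e) * v' (z ∘ e) : ℝ) : ℂ) * μ z else 0)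
      else 0 := by
    intro z
    rw [hP' z y hy]
    by_cases hz : ∀ w, (∀ j, w ≠ e j) → z w = y w
    · rw [if_pos hz, if_pos hz, Matrix.mul_apply]
      have : ∀ z', P.conjTranspose x z' * M z' z =
          if z' = z then (if ∀ w, (∀ j, w ≠ e j) → z w = x w then (v (z ∘ e) : ℂ) * μ z else 0)
            else 0 := by
        intro z'
        rw [Matrix.conjTranspose_apply, hP z' x hx]
        by_cases hz' : ∀ w, (∀ j, w ≠ e j) → z' w = x w
        · rw [if_pos hz', hM z' z hz' hz, Complex.star_def, Complex.conj_ofReal]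
          by_cases hzz : z' = z
          · subst hzz; rw [if_pos rfl, if_pos rfl, if_pos hz']
          · rw [if_neg hzz, if_neg hzz, mul_zero]
        · rw [if_neg hz', star_zero, zero_mul]
          split_ifs with h2 h3
          · subst h2; exact absurd h3 hz'
          · rfl
          · rfl
      rw [Finset.sum_congr rfl fun z' _ => this z', Finset.sum_ite_eq']
      simp only [Finset.mem_univ, if_true]
      split_ifs
      · push_cast; ring
      · simp
    · rw [if_neg hz, if_neg hz, mul_zero]
  rw [Matrix.mul_apply, Finset.sum_congr rfl fun z _ => h1 z, sum_agree_off_register he]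
  have h2 : ∀ b : Fin m → Fin 2,
      (∀ w, (∀ j, w ≠ e j) → Function.extend e b y w = x w) ↔ x = y := by
    intro b
    constructor
    · intro h
      funext w
      by_cases hw : ∃ j, e j = w
      · obtain ⟨j, rfl⟩ := hw
        rw [hx, hy]
      · rw [← h w fun j hj => hw ⟨j, hj.symm⟩, Function.extend_apply' _ _ _ hw]
    · rintro rfl w hw
      rw [Function.extend_apply' _ _ _ fun ⟨j, hj⟩ => hw j hj.symm]
  simp only [h2, Function.extend_comp he]
  split_ifs <;> simp

/-- The projection on the basis states which vanish on the wires `r`. -/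
def zeroProj (r : Finset W) : Matrix (W → Fin 2) (W → Fin 2) ℂ :=
  Matrix.diagonal fun y => if ∀ w ∈ r, y w = 0 then 1 else 0

lemma zeroProj_mul_self (r : Finset W) : zeroProj r * zeroProj r = zeroProj r := by
  rw [zeroProj, Matrix.diagonal_mul_diagonal]
  congr 1; funext y; split_ifs <;> simp

lemma commute_onWire_zeroProj {c : W} {r : Finset W} (hc : c ∉ r)
    (m : Matrix (Fin 2) (Fin 2) ℂ) : Commute (onWire c m) (zeroProj r) := by
  refine commute_onWire_diagonal (fun x b => ?_) m
  have : ∀ w ∈ r, Function.update x c b w = x w := fun w hw =>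
    Function.update_of_ne (fun h : w = c => hc (h ▸ hw)) _ _
  congr 1
  rw [eq_iff_iff]
  exact forall₂_congr fun w hw => by rw [this w hw]

section Ring

variable {A : Type*} [Ring A] {p b t : A}

lemma reflection_mul_self (hp : p * p = p) : (2 * p - 1) * (2 * p - 1) = 1 := by
  have : (2 * p - 1) * (2 * p - 1) = 4 * (p * p) - 4 * p + 1 := by noncomm_ring
  rw [this, hp]; noncomm_ring

/-- The product of two reflections acts on the first of the projections as a rotation: its
hermitian part is `2 t - 1` there, if `t` is the overlap of the projections. -/
lemma hermitianPart_walk_mul [Algebra ℂ A] (hp : p * p = p) (hpbp : p * b * p = p * t) :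
    ((1 / 2 : ℂ) • ((2 * p - 1) * (2 * b - 1) + (2 * b - 1) * (2 * p - 1))) * p =
      p * (2 * t - 1) := by
  have h : ((2 * p - 1) * (2 * b - 1) + (2 * b - 1) * (2 * p - 1)) * p =
      (2 : ℂ) • (p * (2 * t - 1)) := by
    have e1 : ((2 * p - 1) * (2 * b - 1) + (2 * b - 1) * (2 * p - 1)) * p =
        4 * (p * b * p) - 2 * (p * p) + (4 * b * (p * p) - 4 * b * p) - (2 * (p * p) - 2 * p) := by
      noncomm_ring
    rw [e1, hp, hpbp, ofNat_smul_eq_nsmul]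
    noncomm_ring
  rw [smul_mul_assoc, h, smul_smul]
  norm_num

lemma aeval_mul_of_mul_eq [Algebra ℂ A] {h c : A} (hpc : h * p = p * c) (q : ℂ[X]) :
    aeval h q * p = p * aeval c q := by
  have hpow : ∀ j : ℕ, h ^ j * p = p * c ^ j := by
    intro j
    induction j with
    | zero => simp
    | succ j ih => rw [pow_succ, mul_assoc, hpc, ← mul_assoc, ih, mul_assoc, ← pow_succ]
  rw [aeval_eq_sum_range, aeval_eq_sum_range, Finset.sum_mul, Finset.mul_sum]
  exact Finset.sum_congr rfl fun j _ => by rw [smul_mul_assoc, hpow, mul_smul_comm]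

end Ring

lemma aeval_diagonal (c : (W → Fin 2) → ℂ) (q : ℂ[X]) :
    aeval (Matrix.diagonal c) q = Matrix.diagonal fun y => q.eval (c y) := by
  have h := aeval_algHom_apply (Matrix.diagonalAlgHom ℂ (n := W → Fin 2) (α := ℂ)) c q
  simp only [Matrix.diagonalAlgHom_apply] at h
  rw [h]
  congr 1
  funext y
  simp

/-- A reflection about the zero states of the wires `r`, controlled on wire `c` being `0`. -/
lemma hasGateCount_zeroControlled_reflection {c : W} {r : Finset W} (hc : c ∉ r) :
    HasGateCount (zeroControlled (onWire c) (2 * zeroProj r - 1)) (6 * 2 ^ r.card) := by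
  have : Nonempty W := ⟨c⟩
  have h := HasGateCount.diagonal_sign (insert c r)
    (fun y => if y c = 0 ∧ ¬ ∀ w ∈ r, y w = 0 then 1 else 0) fun x y hxy => by
      have h1 : x c = y c := hxy c (by simp)
      have h2 : (∀ w ∈ r, x w = 0) ↔ ∀ w ∈ r, y w = 0 :=
        forall₂_congr fun w hw => by rw [hxy w (by simp [hw])]
      simp only [h1, h2]
  rw [Finset.card_insert_of_notMem hc] at h
  refine HasGateCount.mono ?_ (by rw [pow_succ]; omega :
    3 * 2 ^ (r.card + 1) ≤ 6 * 2 ^ r.card)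
  convert h using 1
  rw [zeroControlled, onWire_apply, onWire_apply, zeroProj,
    mux_eq_diagonal (fun y i j hij => by fin_cases i <;> fin_cases j <;> simp at hij ⊢),
    mux_eq_diagonal (fun y i j hij => by fin_cases i <;> fin_cases j <;> simp at hij ⊢)]
  ext x y
  by_cases hxy : x = y
  · subst hxy
    rw [Matrix.add_apply, Matrix.diagonal_mul, Matrix.sub_apply, two_mul, Matrix.add_apply]
    simp only [Matrix.diagonal_apply_eq, Matrix.one_apply_eq]
    by_cases h1 : ∀ w ∈ r, x w = 0
    · rw [if_pos h1, if_neg fun h => h.2 h1]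
      rcases fin_two_cases (x c) with h0 | h0 <;> simp [h0]
    · rw [if_neg h1]
      rcases fin_two_cases (x c) with h0 | h0
      · rw [if_pos ⟨h0, h1⟩]; simp [h0]
      · rw [if_neg fun h => by simp [h0] at h]; simp [h0]
  · rw [Matrix.add_apply, Matrix.diagonal_mul, Matrix.sub_apply, two_mul, Matrix.add_apply]
    simp [Matrix.diagonal_apply_ne _ hxy, Matrix.one_apply_ne hxy]

/-- Quantum signal processing for the product of the reflections about the zero states of the
flag wires `r₁` and, conjugated by `U`, about those of `r₂`. If the second projection is the
operator `τ` on the first one, `Q (2 τ - 1)` is block encoded with the wire `c` as the only further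
flag, for any real polynomial `Q` of modulus less than one on `[-1, 1]`. -/
theorem exists_polynomial_blockEncoding {c : W} {r₁ r₂ : Finset W} (hc₁ : c ∉ r₁) (hc₂ : c ∉ r₂)
    {U : Matrix (W → Fin 2) (W → Fin 2) ℂ} {k : ℕ} (hU : HasGateCount U k)
    (hUc : ∀ a, Commute (onWire c a) U) (τ : (W → Fin 2) → ℝ)
    (hτ : zeroProj r₁ * (U.conjTranspose * zeroProj r₂ * U) * zeroProj r₁ =
      zeroProj r₁ * Matrix.diagonal fun y => (τ y : ℂ))
    (Q : ℝ[X]) (hQ : ∀ s : ℝ, -1 ≤ s → s ≤ 1 → |Q.eval s| < 1) :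
    ∃ V : Matrix (W → Fin 2) (W → Fin 2) ℂ,
      HasGateCount V (3 * Q.natDegree * (2 * k + 6 * 2 ^ r₁.card + 6 * 2 ^ r₂.card + 1) + 1) ∧
      ∀ x y : W → Fin 2, x c = 0 → y c = 0 → (∀ w ∈ r₁, x w = 0) → (∀ w ∈ r₁, y w = 0) →
        V x y = if x = y then ((Q.eval (2 * τ y - 1) : ℝ) : ℂ) else 0 := by
  set p := zeroProj r₁ with hp
  set p₂ := zeroProj r₂ with hp₂
  set b := U.conjTranspose * p₂ * U with hb
  set ι := onWire c with hι
  have hUU : U * U.conjTranspose = 1 := by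
    simpa [Matrix.star_eq_conjTranspose] using Matrix.mem_unitaryGroup_iff.1 hU.mem_unitary
  have hUU' : U.conjTranspose * U = 1 := by
    simpa [Matrix.star_eq_conjTranspose] using Matrix.mem_unitaryGroup_iff'.1 hU.mem_unitary
  have hpp : p * p = p := zeroProj_mul_self _
  have hbb : b * b = b := by
    rw [hb, mul_assoc, ← mul_assoc U, ← mul_assoc U, hUU, one_mul, mul_assoc, ← mul_assoc p₂,
      show p₂ * p₂ = p₂ from zeroProj_mul_self _, ← mul_assoc]
  have hUc' : ∀ a, Commute (ι a) U.conjTranspose := by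
    intro a
    -- conjugate the commutation relation with `U` by the unitary `U`
    have := congrArg (fun X => U.conjTranspose * X * U.conjTranspose) (hUc a).eq
    simp only [mul_assoc, hUU, mul_one] at this
    rw [← mul_assoc U.conjTranspose U, hUU', one_mul] at this
    exact this.symm
  set w := (2 * p - 1) * (2 * b - 1) with hw
  set v := (2 * b - 1) * (2 * p - 1) with hv
  have hwv : w * v = 1 := by
    rw [hw, hv, mul_assoc, ← mul_assoc (2 * b - 1), reflection_mul_self hbb, one_mul,
      reflection_mul_self hpp]
  have hvw : v * w = 1 := by
    rw [hw, hv, mul_assoc, ← mul_assoc (2 * p - 1), reflection_mul_self hpp, one_mul,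
      reflection_mul_self hbb]
  have hpc : ∀ a, Commute (ι a) (2 * p - 1) := fun a =>
    (((Commute.ofNat_right _ 2).mul_right (commute_onWire_zeroProj hc₁ a))).sub_right
      (Commute.one_right _)
  have hp₂c : ∀ a, Commute (ι a) (2 * p₂ - 1) := fun a =>
    (((Commute.ofNat_right _ 2).mul_right (commute_onWire_zeroProj hc₂ a))).sub_right
      (Commute.one_right _)
  have hbU : 2 * b - 1 = U.conjTranspose * (2 * p₂ - 1) * U := by
    rw [hb, mul_sub, sub_mul, mul_one, hUU', two_mul, two_mul, mul_add, add_mul]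
  have hbc : ∀ a, Commute (ι a) (2 * b - 1) := fun a => by
    rw [hbU]; exact ((hUc' a).mul_right (hp₂c a)).mul_right (hUc a)
  have hwc : ∀ a, Commute (ι a) w := fun a => (hpc a).mul_right (hbc a)
  have hvc : ∀ a, Commute (ι a) v := fun a => (hbc a).mul_right (hpc a)
  -- the controlled walk
  have e00 : ι (Matrix.single 0 0 1) * ι (Matrix.single 0 0 1) = ι (Matrix.single 0 0 1) := by
    rw [← map_mul]; simp
  have e11 : ι (Matrix.single 1 1 1) * ι (Matrix.single 1 1 1) = ι (Matrix.single 1 1 1) := by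
    rw [← map_mul]; simp
  have e01 : ι (Matrix.single 0 0 1) * ι (Matrix.single 1 1 1) = 0 := by rw [← map_mul]; simp
  have e10 : ι (Matrix.single 1 1 1) * ι (Matrix.single 0 0 1) = 0 := by rw [← map_mul]; simp
  have esum : ι (Matrix.single 0 0 1) + ι (Matrix.single 1 1 1) = 1 := by
    rw [← map_add, ← map_one ι]; congr 1; ext i j; fin_cases i <;> fin_cases j <;> simp
  have hcw : zeroControlled ι w = zeroControlled ι (2 * p - 1) *
      (U.conjTranspose * zeroControlled ι (2 * p₂ - 1) * U) := by
    have h1 : U.conjTranspose * zeroControlled ι (2 * p₂ - 1) * U =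
        ι (Matrix.single 0 0 1) * (2 * b - 1) + ι (Matrix.single 1 1 1) := by
      rw [zeroControlled, mul_add, add_mul, ← mul_assoc, ← (hUc' _).eq, ← (hUc' _).eq, mul_assoc,
        mul_assoc, mul_assoc, hUU', mul_one, hbU, mul_assoc]
    rw [h1, zeroControlled, zeroControlled, add_mul, mul_add, mul_add, mul_assoc,
      ← mul_assoc (2 * p - 1), ← (hpc _).eq, mul_assoc, ← mul_assoc (ι _) (ι _), e00, ← mul_assoc
      (ι (Matrix.single 1 1 1)) (ι _), e10, zero_mul, e11, mul_assoc (ι _) (2 * p - 1) (ι _),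
      ← (hpc _).eq, ← mul_assoc (ι _) (ι _), e01, zero_mul]
    simp [hw]
  have hcount : HasGateCount (zeroControlled ι w) (2 * k + 6 * 2 ^ r₁.card + 6 * 2 ^ r₂.card) := by
    rw [hcw]
    refine ((hasGateCount_zeroControlled_reflection hc₁).mul ((hU.conjTranspose.mul
      (hasGateCount_zeroControlled_reflection hc₂)).mul hU)).mono (by omega)
  set K := 2 * k + 6 * 2 ^ r₁.card + 6 * 2 ^ r₂.card with hK
  obtain ⟨S, B', hS, hSe⟩ := exists_signal_sequence_of_real ι w hwc hwv hvw
    (fun n S => HasGateCount S (n * (K + 1) + 1)) (fun R hR => by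
      rw [zero_mul, zero_add]; exact HasGateCount.onWire c hR)
    (fun n S R hR hS => (((HasGateCount.onWire c hR).mul hcount).mul hS).mono (by ring_nf; omega))
    Q hQ
  have hcwH : (zeroControlled ι w).conjTranspose = zeroControlled ι v := by
    -- the inverse of a unitary is its adjoint
    have h1 : zeroControlled ι w * zeroControlled ι v = 1 := by
      rw [zeroControlled, zeroControlled, add_mul, mul_add, mul_add, mul_assoc,
        ← mul_assoc w, ← (hwc _).eq, mul_assoc, hwv, mul_one, e00, mul_assoc (ι _) w,
        ← (hwc _).eq, ← mul_assoc (ι _) (ι _), e01, ← mul_assoc (ι _) (ι _), e10, e11]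
      simp [esum]
    have h2 : (zeroControlled ι w).conjTranspose * zeroControlled ι w = 1 := by
      simpa [Matrix.star_eq_conjTranspose] using
        Matrix.mem_unitaryGroup_iff'.1 hcount.mem_unitary
    calc _ = (zeroControlled ι w).conjTranspose * (zeroControlled ι w * zeroControlled ι v) := by
          rw [h1, mul_one]
      _ = _ := by rw [← mul_assoc, h2, one_mul]
  refine ⟨(zeroControlled ι v) ^ Q.natDegree * S, ?_, ?_⟩
  · rw [← hcwH]
    refine ((hcount.conjTranspose.pow _).mul hS).mono ?_
    ring_nf
    nlinarith [Nat.zero_le Q.natDegree]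
  · intro x y hxc hyc hx hy
    have hpow : ∀ j : ℕ, ι (Matrix.single 0 0 1) * zeroControlled ι v ^ j =
        v ^ j * ι (Matrix.single 0 0 1) := by
      intro j
      induction j with
      | zero => simp
      | succ j ih =>
        have h1 : ι (Matrix.single 0 0 1) * zeroControlled ι v = v * ι (Matrix.single 0 0 1) := by
          rw [zeroControlled, mul_add, e01, add_zero, ← mul_assoc, e00, (hvc _).eq]
        rw [pow_succ, ← mul_assoc, ih, mul_assoc, h1, ← mul_assoc, ← pow_succ]
    have e0' : ι (Matrix.single 0 0 1) * ι (Matrix.single 1 0 1) = 0 := by rw [← map_mul]; simp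
    have hblock : ι (Matrix.single 0 0 1) * (zeroControlled ι v ^ Q.natDegree * S) *
        ι (Matrix.single 0 0 1) * p = ι (Matrix.single 0 0 1) *
          (p * Matrix.diagonal fun y => ((Q.eval (2 * τ y - 1) : ℝ) : ℂ)) := by
      have h1 : ι (Matrix.single 0 0 1) * (zeroControlled ι v ^ Q.natDegree * S) *
          ι (Matrix.single 0 0 1) = ι (Matrix.single 0 0 1) *
            aeval ((1 / 2 : ℂ) • (w + v)) (Q.map (algebraMap ℝ ℂ)) := by
        rw [← mul_assoc, hpow, mul_assoc, mul_assoc, hSe, mul_add, ← mul_assoc (ι _) (ι _),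
          ← mul_assoc (ι _) (ι _), e00, e0', zero_mul, add_zero, ← mul_assoc (ι _),
          ((hwc _).pow_right _).eq, ← mul_assoc, ← mul_assoc]
        have h2 : v ^ Q.natDegree * w ^ Q.natDegree = 1 := by
          rw [← (show Commute v w from hvw.trans hwv.symm).mul_pow, hvw, one_pow]
        rw [h2, one_mul]
      rw [h1, mul_assoc]
      congr 1
      rw [aeval_mul_of_mul_eq (hermitianPart_walk_mul hpp hτ)]
      congr 1
      have h3 : (2 * (Matrix.diagonal fun y => (τ y : ℂ)) - 1 :
          Matrix (W → Fin 2) (W → Fin 2) ℂ) =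
          Matrix.diagonal fun y => ((2 * τ y - 1 : ℝ) : ℂ) := by
        ext x y
        by_cases h : x = y
        · subst h; simp [two_mul]
        · simp [two_mul, Matrix.diagonal_apply_ne _ h, Matrix.one_apply_ne h]
      rw [h3, aeval_diagonal]
      congr 1
      funext y
      rw [eval_map, ← Complex.coe_algebraMap, eval₂_at_apply]
    have hdiag : ι (Matrix.single 0 0 1) =
        Matrix.diagonal fun y : W → Fin 2 => if y c = 0 then (1 : ℂ) else 0 := by
      rw [hι, onWire_apply, mux_eq_diagonal (fun y i j hij => by
        fin_cases i <;> fin_cases j <;> simp at hij ⊢)]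
      congr 1; funext y
      rcases fin_two_cases (y c) with h | h <;> simp [h]
    have := congrFun (congrFun hblock x) y
    rw [hdiag, hp, zeroProj, Matrix.mul_diagonal, Matrix.mul_diagonal, Matrix.diagonal_mul,
      Matrix.diagonal_mul, Matrix.diagonal_mul] at this
    simp only [if_pos hxc, if_pos hyc, if_pos hx, if_pos hy, one_mul, mul_one] at this
    rw [this, Matrix.diagonal_apply]
    split_ifs with h
    · rw [h]
    · rfl

end Walk

/-! ### The distance of the particles as an overlap -/

section Distance

variable {W : Type} [Fintype W] [DecidableEq W]

lemma sum_binary {R : Type*} [AddCommMonoid R] {m n : ℕ} (h : n ≤ 2 ^ m) (f : Fin n → R) :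
    ∑ b : Fin m → Fin 2,
      (if hb : (finFunctionFinEquiv b : ℕ) < n then f ⟨finFunctionFinEquiv b, hb⟩ else 0) =
      ∑ t, f t := by
  symm
  refine Fintype.sum_of_injective (fun t : Fin n => finFunctionFinEquiv.symm (Fin.castLE h t))
    (finFunctionFinEquiv.symm.injective.comp (Fin.castLE_injective h)) _ _ ?_ ?_
  · intro b hb
    rw [dif_neg]
    intro hlt
    exact hb ⟨⟨_, hlt⟩, by
      rw [Equiv.symm_apply_eq]; rfl⟩
  · intro t
    simp

lemma neg_one_pow_bit (s : Fin 2) : (-1 : ℝ) ^ (s : ℕ) = 1 - 2 * ((s : ℕ) : ℝ) := by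
  fin_cases s <;> norm_num

lemma position_eq_sum {n : ℕ} (s : Fin n → Fin 2) :
    position (finFunctionFinEquiv s) =
      ∑ t : Fin n, (2 : ℝ) ^ (t : ℕ) / (2 ^ n - 1) * ((s t : ℕ) : ℝ) := by
  rw [position, finFunctionFinEquiv_apply, Nat.cast_sum, Finset.sum_div]
  refine Finset.sum_congr rfl fun t _ => ?_
  push_cast
  ring

lemma sum_cons {R : Type*} [AddCommMonoid R] {m : ℕ} (f : (Fin (m + 1) → Fin 2) → R) :
    ∑ b, f b = ∑ b : Fin m → Fin 2, (f (Fin.cons 0 b) + f (Fin.cons 1 b)) := by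
  rw [← (Fin.consEquiv fun _ => Fin 2).sum_comp, Fintype.sum_prod_type, Fin.sum_univ_two,
    ← Finset.sum_add_distrib]
  rfl

/-- Amplitudes of the register holding the particle (first bit) and the binary digit: equal for
the two particles, and for digit `t` proportional to the square root of its weight `2 ^ t`. -/
def digitAmplitude (n nb : ℕ) (b : Fin (nb + 1) → Fin 2) : ℝ :=
  if (finFunctionFinEquiv (Fin.tail b) : ℕ) < n then
    √((2 : ℝ) ^ (finFunctionFinEquiv (Fin.tail b) : ℕ) / (2 * (2 ^ n - 1))) else 0

/-- Equal amplitudes on the numbers less than `d`. -/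
def uniformAmplitude (d dk : ℕ) (b : Fin dk → Fin 2) : ℝ :=
  if (finFunctionFinEquiv b : ℕ) < d then √(d : ℝ)⁻¹ else 0

lemma two_pow_sub_one_pos {n : ℕ} (hn : 1 ≤ n) : (0 : ℝ) < 2 ^ n - 1 := by
  have : (1 : ℝ) < 2 ^ n := one_lt_pow₀ (by norm_num) (by omega)
  linarith

lemma digitAmplitude_cons_mul_self {n nb : ℕ} (hn : 1 ≤ n) (p : Fin 2) (b : Fin nb → Fin 2) :
    digitAmplitude n nb (Fin.cons p b) * digitAmplitude n nb (Fin.cons p b) =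
      if (finFunctionFinEquiv b : ℕ) < n then
        (2 : ℝ) ^ (finFunctionFinEquiv b : ℕ) / (2 * (2 ^ n - 1)) else 0 := by
  have := two_pow_sub_one_pos hn
  simp only [digitAmplitude, Fin.tail_cons]
  split_ifs
  · exact Real.mul_self_sqrt (by positivity)
  · simp

lemma sum_digitAmplitude_sq {n nb : ℕ} (hn : 1 ≤ n) (hnb : n ≤ 2 ^ nb) :
    ∑ b, digitAmplitude n nb b ^ 2 = 1 := by
  have hpos := two_pow_sub_one_pos hn
  simp only [pow_two]
  rw [sum_cons]
  simp only [digitAmplitude_cons_mul_self hn]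
  have := sum_binary hnb fun t : Fin n =>
    (2 : ℝ) ^ (t : ℕ) / (2 * (2 ^ n - 1)) + (2 : ℝ) ^ (t : ℕ) / (2 * (2 ^ n - 1))
  calc _ = _ := Finset.sum_congr rfl fun b _ => by split_ifs <;> simp
    _ = _ := this
    _ = ∑ t : Fin n, (2 : ℝ) ^ (t : ℕ) / (2 ^ n - 1) :=
        Finset.sum_congr rfl fun t _ => by field_simp; ring
    _ = 1 := by
        rw [← Finset.sum_div, Fin.sum_univ_eq_sum_range (fun t => (2 : ℝ) ^ t),
          geom_sum_eq (by norm_num)]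
        norm_num
        exact hpos.ne'

lemma uniformAmplitude_mul_self (d dk : ℕ) (b : Fin dk → Fin 2) :
    uniformAmplitude d dk b * uniformAmplitude d dk b =
      if (finFunctionFinEquiv b : ℕ) < d then (d : ℝ)⁻¹ else 0 := by
  simp only [uniformAmplitude]
  split_ifs
  · exact Real.mul_self_sqrt (by positivity)
  · simp

lemma sum_uniformAmplitude_sq {d dk : ℕ} (hd : 1 ≤ d) (hdk : d ≤ 2 ^ dk) :
    ∑ b, uniformAmplitude d dk b ^ 2 = 1 := by
  simp only [pow_two, uniformAmplitude_mul_self]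
  have := sum_binary hdk fun _ => (d : ℝ)⁻¹
  calc _ = _ := Finset.sum_congr rfl fun b _ => by split_ifs <;> rfl
    _ = _ := this
    _ = 1 := by
      have : (d : ℝ) ≠ 0 := by positivity
      simp [this]

/-- The sum over particles and digits of the signs `(-1) ^ (particle + digit)` with the weights
of the digits is the coordinate difference of the two particles. -/
lemma sum_digitAmplitude_mul_sign {n nb : ℕ} (hn : 1 ≤ n) (hnb : n ≤ 2 ^ nb)
    (s : Fin 2 → Fin n → Fin 2) (D : (Fin (nb + 1) → Fin 2) → ℂ)
    (hD : ∀ (p : Fin 2) (b : Fin nb → Fin 2) (hb : (finFunctionFinEquiv b : ℕ) < n),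
      D (Fin.cons p b) = (-1) ^ (p : ℕ) * (-1) ^ (s p ⟨finFunctionFinEquiv b, hb⟩ : ℕ)) :
    ∑ b, ((digitAmplitude n nb b * digitAmplitude n nb b : ℝ) : ℂ) * D b =
      ((position (finFunctionFinEquiv (s 1)) - position (finFunctionFinEquiv (s 0)) : ℝ) : ℂ) := by
  have hpos := two_pow_sub_one_pos hn
  rw [sum_cons]
  have := sum_binary hnb fun t : Fin n => ((((2 : ℝ) ^ (t : ℕ) / (2 ^ n - 1)) *
    ((s 1 t : ℕ) : ℝ) - ((2 : ℝ) ^ (t : ℕ) / (2 ^ n - 1)) * ((s 0 t : ℕ) : ℝ) : ℝ) : ℂ)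
  calc _ = _ := Finset.sum_congr rfl fun b _ => ?_
    _ = _ := this
    _ = _ := by
      rw [← Complex.ofReal_sum, Finset.sum_sub_distrib, position_eq_sum, position_eq_sum]
  rw [digitAmplitude_cons_mul_self hn, digitAmplitude_cons_mul_self hn]
  split_ifs with hb
  · rw [hD 0 b hb, hD 1 b hb]
    have e : ∀ q : Fin 2, (-1 : ℂ) ^ (q : ℕ) = ((1 - 2 * ((q : ℕ) : ℝ) : ℝ) : ℂ) := fun q => by
      rw [← neg_one_pow_bit]; push_cast; rfl
    rw [e (s 0 _), e (s 1 _)]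
    simp only [Fin.val_zero, Fin.val_one, pow_zero, pow_one, one_mul, neg_one_mul]
    rw [← Complex.ofReal_neg, ← Complex.ofReal_mul, ← Complex.ofReal_mul, ← Complex.ofReal_add]
    congr 1
    field_simp
    ring
  · simp

lemma mul_zeroProj_apply {r : Finset W} (M : Matrix (W → Fin 2) (W → Fin 2) ℂ) (x y : W → Fin 2) :
    (zeroProj r * M * zeroProj r) x y =
      if (∀ w ∈ r, x w = 0) ∧ ∀ w ∈ r, y w = 0 then M x y else 0 := by
  rw [zeroProj, Matrix.mul_diagonal, Matrix.diagonal_mul]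
  by_cases h1 : ∀ w ∈ r, x w = 0
  · by_cases h2 : ∀ w ∈ r, y w = 0
    · rw [if_pos h1, if_pos h2, if_pos ⟨h1, h2⟩]; simp
    · rw [if_neg h2, mul_zero]; exact (if_neg fun h => h2 h.2).symm
  · rw [if_neg h1, zero_mul, zero_mul]; exact (if_neg fun h => h1 h.1).symm

lemma zeroProj_mul_diagonal_apply {r : Finset W} (D : (W → Fin 2) → ℂ) (x y : W → Fin 2) :
    (zeroProj r * Matrix.diagonal D) x y =
      if x = y then (if ∀ w ∈ r, x w = 0 then 1 else 0) * D x else 0 := by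
  rw [zeroProj, Matrix.diagonal_mul_diagonal, Matrix.diagonal_apply]

/-- The operator `U` prepares a superposition of all dimensions `k` (register `eK`), with
amplitude in the zero state of the particle-and-digit register `eB` proportional to the coordinate
difference of the particles in dimension `k`. The norm of this component is the distance. -/
theorem exists_distance_overlap {n d nb dk : ℕ} (hn : 1 ≤ n) (hd : 1 ≤ d) (hnb : n ≤ 2 ^ nb)
    (hdk : d ≤ 2 ^ dk) (eK : Fin dk → W) (eB : Fin (nb + 1) → W) (sys : SysWire d n → W)
    (hK : Function.Injective eK) (hB : Function.Injective eB) (hS : Function.Injective sys)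
    (hKB : ∀ i j, eK i ≠ eB j) (hKS : ∀ i j, eK i ≠ sys j) (hBS : ∀ i j, eB i ≠ sys j) :
    ∃ U : Matrix (W → Fin 2) (W → Fin 2) ℂ, HasGateCount U (16 * 2 ^ (dk + (nb + 1))) ∧
      (∀ c, (∀ i, c ≠ eK i) → (∀ i, c ≠ eB i) → (∀ i, c ≠ sys i) → ∀ a, Commute (onWire c a) U) ∧
      zeroProj (Finset.univ.image eK ∪ Finset.univ.image eB) *
        (U.conjTranspose * zeroProj (Finset.univ.image eB) * U) *
        zeroProj (Finset.univ.image eK ∪ Finset.univ.image eB) =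
      zeroProj (Finset.univ.image eK ∪ Finset.univ.image eB) *
        Matrix.diagonal fun y => ((sqDist (decode (y ∘ sys)) / d : ℝ) : ℂ) := by
  have : Nonempty W := ⟨eB 0⟩
  obtain ⟨GK, hGK, hGKc, hGKe⟩ := exists_statePrep eK hK (uniformAmplitude d dk)
    (sum_uniformAmplitude_sq hd hdk)
  obtain ⟨GB, hGB, hGBc, hGBe⟩ := exists_statePrep eB hB (digitAmplitude n nb)
    (sum_digitAmplitude_sq hn hnb)
  -- the address formed by both registers selects a digit of the system
  set leaf : (Fin (dk + (nb + 1)) → Fin 2) → Option W := fun b =>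
    if h : (finFunctionFinEquiv (b ∘ Fin.castAdd (nb + 1)) : ℕ) < d ∧
        (finFunctionFinEquiv (Fin.tail (b ∘ Fin.natAdd dk)) : ℕ) < n then
      some (sys (b (Fin.natAdd dk 0), ⟨_, h.1⟩, ⟨_, h.2⟩)) else none with hleaf
  have hleaf_eq : ∀ b l, leaf b = some l →
      ∃ h : (finFunctionFinEquiv (b ∘ Fin.castAdd (nb + 1)) : ℕ) < d ∧
        (finFunctionFinEquiv (Fin.tail (b ∘ Fin.natAdd dk)) : ℕ) < n,
      l = sys (b (Fin.natAdd dk 0), ⟨_, h.1⟩, ⟨_, h.2⟩) := by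
    intro b l h
    simp only [hleaf] at h
    split_ifs at h with h'
    exact ⟨h', (Option.some.inj h).symm⟩
  have hinj : ∀ b b' l, leaf b = some l → leaf b' = some l → b = b' := by
    intro b b' l h h'
    obtain ⟨h1, rfl⟩ := hleaf_eq b l h
    obtain ⟨h2, h3⟩ := hleaf_eq b' _ h'
    have h4 := hS h3
    simp only [Prod.mk.injEq, Fin.mk.injEq, Fin.val_inj, EmbeddingLike.apply_eq_iff_eq] at h4
    obtain ⟨a1, a2, a3⟩ := h4
    funext i
    refine Fin.addCases (fun i => congrFun a2 i) (fun i => ?_) i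
    refine Fin.cases a1 (fun i => congrFun a3 i) i
  have hdisj : ∀ b l j, leaf b = some l → l ≠ Fin.append eK eB j := by
    intro b l j h
    obtain ⟨h1, rfl⟩ := hleaf_eq b l h
    refine Fin.addCases (fun i => ?_) (fun i => ?_) j
    · rw [Fin.append_left]; exact (hKS _ _).symm
    · rw [Fin.append_right]; exact (hBS _ _).symm
  obtain ⟨D, hD, hDe, hDc⟩ := exists_select_sign (Fin.append eK eB) leaf hinj hdisj
  have hZ := HasGateCount.diagonal_sign {eB 0} (fun y : W → Fin 2 => y (eB 0))
    fun x y hxy => hxy _ (by simp)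
  set E : (W → Fin 2) → ℂ := fun y => (-1) ^ (y (eB 0) : ℕ) * D y with hE
  have hEc : HasGateCount (Matrix.diagonal E) (6 + 4 * 2 ^ (dk + (nb + 1))) := by
    have := hZ.mul hD
    rw [Matrix.diagonal_mul_diagonal] at this
    exact this.mono (by simp)
  set X := GB.conjTranspose * Matrix.diagonal E * GB with hX
  set α : (W → Fin 2) → ℂ := fun y => ∑ b,
    ((digitAmplitude n nb b * digitAmplitude n nb b : ℝ) : ℂ) *
    E (Function.extend eB b y) with hα
  have hXe : ∀ x y, (∀ j, x (eB j) = 0) → (∀ j, y (eB j) = 0) →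
      X x y = if x = y then α y else 0 := fun x y hx hy =>
    statePrep_sandwich hB hGBe hGBe _ E hx hy fun z z' _ _ => by
      rw [Matrix.diagonal_apply]
  have hαe : ∀ (y : W → Fin 2) (hk : (finFunctionFinEquiv (y ∘ eK) : ℕ) < d),
      α y = ((position (decode (y ∘ sys) 1 ⟨_, hk⟩) - position (decode (y ∘ sys) 0 ⟨_, hk⟩) : ℝ) :
        ℂ) := by
    intro y hk
    refine sum_digitAmplitude_mul_sign hn hnb (fun p t => y (sys (p, ⟨_, hk⟩, t))) _ ?_
    intro p b hb
    simp only [hE]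
    rw [hB.extend_apply, Fin.cons_zero]
    congr 1
    have hKext : Function.extend eB (Fin.cons p b : Fin (nb + 1) → Fin 2) y ∘ eK = y ∘ eK := by
      funext i
      exact Function.extend_apply' _ _ _ fun ⟨j, hj⟩ => hKB i j hj.symm
    have e1 : (Function.extend eB (Fin.cons p b : Fin (nb + 1) → Fin 2) y ∘ Fin.append eK eB) ∘
        Fin.castAdd (nb + 1) = y ∘ eK := by
      rw [← hKext]; funext i; simp
    have e2 : (Function.extend eB (Fin.cons p b : Fin (nb + 1) → Fin 2) y ∘ Fin.append eK eB) ∘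
        Fin.natAdd dk = (Fin.cons p b : Fin (nb + 1) → Fin 2) := by
      funext i; simp [hB.extend_apply]
    rw [hDe _ (sys (p, ⟨_, hk⟩, ⟨_, hb⟩))]
    · rw [Function.extend_apply' _ _ _ fun ⟨j, hj⟩ => hBS _ _ hj]
    · simp only [hleaf, e1, e2, Fin.tail_cons]
      rw [dif_pos ⟨hk, hb⟩]
      simp [hB.extend_apply]
  refine ⟨X * GK, ?_, ?_, ?_⟩
  · refine (((hGB.conjTranspose.mul hEc).mul hGB).mul hGK).mono ?_
    have h1 : 2 ^ (nb + 1) ≤ 2 ^ (dk + (nb + 1)) := Nat.pow_le_pow_right (by norm_num) (by omega)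
    have h2 : 2 * 2 ^ dk ≤ 2 ^ (dk + (nb + 1)) := by
      rw [← pow_succ']; exact Nat.pow_le_pow_right (by norm_num) (by omega)
    have h3 : 1 ≤ 2 ^ dk := Nat.one_le_two_pow
    omega
  · intro c hcK hcB hcS a
    have h1 := hGBc c hcB a
    have h2 : Commute (onWire c a) (Matrix.diagonal E) := by
      refine commute_onWire_diagonal (IndepOf.mul ?_ ?_) a
      · exact (indepOf_eval (hcB 0).symm).comp fun q : Fin 2 => (-1 : ℂ) ^ (q : ℕ)
      · refine hDc c (fun j => ?_) fun b hb => ?_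
        · refine Fin.addCases (fun i => ?_) (fun i => ?_) j
          · rw [Fin.append_left]; exact hcK i
          · rw [Fin.append_right]; exact hcB i
        · obtain ⟨_, h⟩ := hleaf_eq b c hb
          exact hcS _ h
    have h3 : Commute (onWire c a) GB.conjTranspose := by
      have := congrArg Matrix.conjTranspose (hGBc c hcB a.conjTranspose).eq
      rw [Matrix.conjTranspose_mul, Matrix.conjTranspose_mul] at this
      have e : (onWire c a.conjTranspose).conjTranspose = onWire c a := by
        rw [onWire_apply, mux_conjTranspose (indepOf_const c _), onWire_apply]
        simp [Matrix.star_eq_conjTranspose]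
      rw [e] at this
      exact this.symm
    exact ((h3.mul_right h2).mul_right h1).mul_right (hGKc c hcK a)
  · ext x y
    rw [mul_zeroProj_apply, zeroProj_mul_diagonal_apply]
    simp only [Finset.mem_union, Finset.mem_image, Finset.mem_univ, true_and]
    have hz : ∀ y : W → Fin 2, (∀ w, (∃ a, eK a = w) ∨ (∃ a, eB a = w) → y w = 0) ↔
        (∀ j, y (eK j) = 0) ∧ ∀ j, y (eB j) = 0 := by
      intro y
      constructor
      · exact fun h => ⟨fun j => h _ (Or.inl ⟨j, rfl⟩), fun j => h _ (Or.inr ⟨j, rfl⟩)⟩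
      · rintro ⟨h1, h2⟩ w (⟨j, rfl⟩ | ⟨j, rfl⟩)
        · exact h1 j
        · exact h2 j
    simp only [hz]
    by_cases hx : (∀ j, x (eK j) = 0) ∧ ∀ j, x (eB j) = 0
    swap
    · simp [hx]
    by_cases hy : (∀ j, y (eK j) = 0) ∧ ∀ j, y (eB j) = 0
    swap
    · rw [if_neg fun h => hy h.2, if_neg]
      rintro rfl
      exact hy hx
    rw [if_pos ⟨hx, hy⟩, if_pos hx, one_mul]
    have hassoc : (X * GK).conjTranspose * zeroProj (Finset.univ.image eB) * (X * GK) =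
        GK.conjTranspose * (X.conjTranspose * zeroProj (Finset.univ.image eB) * X) * GK := by
      rw [Matrix.conjTranspose_mul]; simp only [mul_assoc]
    rw [hassoc, statePrep_sandwich hK hGKe hGKe _ (fun z => star (α z) * α z) hx.1 hy.1]
    · by_cases hxy : x = y
      swap
      · rw [if_neg hxy, if_neg hxy]
      subst hxy
      rw [if_pos rfl, if_pos rfl]
      have hsum := sum_binary hdk fun k : Fin d => (((d : ℝ)⁻¹ *
        (position (decode (x ∘ sys) 0 k) - position (decode (x ∘ sys) 1 k)) ^ 2 : ℝ) : ℂ)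
      calc _ = _ := Finset.sum_congr rfl fun b _ => ?_
        _ = _ := hsum
        _ = _ := by
          rw [← Complex.ofReal_sum, ← Finset.mul_sum, sqDist, div_eq_inv_mul]
      rw [uniformAmplitude_mul_self]
      split_ifs with hb
      · have e1 : Function.extend eK b x ∘ eK = b := Function.extend_comp hK _ _
        have e2 : Function.extend eK b x ∘ sys = x ∘ sys := by
          funext i
          exact Function.extend_apply' _ _ _ fun ⟨j, hj⟩ => hKS _ _ hj
        have hk : (finFunctionFinEquiv (Function.extend eK b x ∘ eK) : ℕ) < d := by rwa [e1]
        rw [hαe _ hk, e2, Complex.star_def, Complex.conj_ofReal, ← Complex.ofReal_mul,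
          ← Complex.ofReal_mul]
        simp only [e1]
        congr 1
        ring
      · simp
    · intro z z' hz1 hz2
      have hzB : ∀ j, z (eB j) = 0 := fun j => by rw [hz1 _ fun i => (hKB i j).symm]; exact hx.2 j
      have hzB' : ∀ j, z' (eB j) = 0 := fun j => by
        rw [hz2 _ fun i => (hKB i j).symm]; exact hy.2 j
      rw [Matrix.mul_apply]
      have : ∀ u, (X.conjTranspose * zeroProj (Finset.univ.image eB)) z u * X u z' =
          if u = z then (if z = z' then star (α z) * α z else 0) else 0 := by
        intro u
        rw [zeroProj, Matrix.mul_diagonal, Matrix.conjTranspose_apply]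
        by_cases hu : ∀ w ∈ Finset.univ.image eB, u w = 0
        · have hu' : ∀ j, u (eB j) = 0 := fun j => hu _ (by simp)
          rw [if_pos hu, hXe u z hu' hzB, hXe u z' hu' hzB', mul_one]
          by_cases h1 : u = z
          · subst h1
            rw [if_pos rfl, if_pos rfl]
            split_ifs with h2
            · rw [h2]
            · simp
          · rw [if_neg h1, if_neg h1]; simp
        · rw [if_neg hu, mul_zero, zero_mul, if_neg]
          rintro rfl
          exact hu (by simpa using hzB)
      rw [Finset.sum_congr rfl fun u _ => this u, Finset.sum_ite_eq']
      simp

end Distance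

/-! ### Modular addition and the shift of a coordinate -/

section Shift

variable {W : Type} [Fintype W] [DecidableEq W]

/-- A map that adds to each bit of a register a function of the lower bits and of a control
register is a product of controlled bit flips, the highest bit being flipped first. -/
lemma HasGateCount.triangular_flip [Nonempty W] (cs : Finset W) :
    ∀ {n : ℕ} (e : Fin n → W), Function.Injective e → (∀ j, e j ∉ cs) →
      ∀ f : Fin n → (W → Fin 2) → Fin 2,
      (∀ b, DependsOn (f b) (↑cs ∪ {w | ∃ j < b, e j = w})) →
      HasGateCount (mapMatrix fun y => Function.extend e (fun b => y (e b) + f b y) y)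
        (9 * 2 ^ (cs.card + n))
  | 0, e, _, _, f, _ => by
    have : (fun y : W → Fin 2 => Function.extend e (fun b => y (e b) + f b y) y) = id := by
      funext y w
      exact Function.extend_apply' _ _ _ fun ⟨j, _⟩ => j.elim0
    rw [this, mapMatrix_id]
    exact HasGateCount.one.mono (Nat.zero_le _)
  | n + 1, e, he, hcs, f, hf => by
    have hlow := HasGateCount.triangular_flip cs (e ∘ Fin.castSucc)
      (he.comp (Fin.castSucc_injective n)) (fun j => hcs _) (fun b => f b.castSucc) (fun b => by
        intro x y hxy
        refine hf b.castSucc fun w hw => hxy w ?_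
        rcases hw with hw | ⟨j, hj, rfl⟩
        · exact Or.inl hw
        · refine Or.inr ⟨⟨j, lt_trans hj b.2⟩, hj, rfl⟩)
    have htop := HasGateCount.controlled_flip (e (Fin.last n))
      (cs ∪ Finset.univ.image (e ∘ Fin.castSucc)) (by
        rw [Finset.mem_union, not_or]
        refine ⟨hcs _, ?_⟩
        simp only [Finset.mem_image, Finset.mem_univ, true_and, not_exists]
        intro j hj
        exact (Fin.castSucc_lt_last j).ne (he hj)) (f (Fin.last n)) (by
        intro x y hxy
        refine hf (Fin.last n) fun w hw => hxy w ?_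
        rcases hw with hw | ⟨j, hj, rfl⟩
        · simp [Finset.mem_coe.1 hw]
        · simp only [Finset.coe_union, Finset.coe_image, Finset.coe_univ, Set.image_univ]
          exact Or.inr ⟨⟨j, hj⟩, rfl⟩)
    have hcard : (cs ∪ Finset.univ.image (e ∘ Fin.castSucc)).card ≤ cs.card + n := by
      refine (Finset.card_union_le _ _).trans (Nat.add_le_add_left ?_ _)
      exact Finset.card_image_le.trans (by simp)
    have hmul := hlow.mul htop
    rw [mapMatrix_mul] at hmul
    have hmap : (fun y : W → Fin 2 => Function.extend e (fun b => y (e b) + f b y) y) =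
        (fun y => Function.extend (e ∘ Fin.castSucc)
          (fun b => y ((e ∘ Fin.castSucc) b) + f b.castSucc y) y) ∘
        fun y => Function.update y (e (Fin.last n)) (y (e (Fin.last n)) + f (Fin.last n) y) := by
      funext y w
      simp only [Function.comp_apply]
      set y' := Function.update y (e (Fin.last n)) (y (e (Fin.last n)) + f (Fin.last n) y) with hy'
      by_cases hw : ∃ j, e j = w
      · obtain ⟨j, rfl⟩ := hw
        rw [he.extend_apply]
        refine Fin.lastCases ?_ (fun j => ?_) j
        · rw [Function.extend_apply', hy', Function.update_self]
          rintro ⟨j, hj⟩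
          exact (Fin.castSucc_lt_last j).ne (he hj)
        · have hne : ∀ j : Fin n, e j.castSucc ≠ e (Fin.last n) := fun j hj =>
            (Fin.castSucc_lt_last j).ne (he hj)
          rw [show e j.castSucc = (e ∘ Fin.castSucc) j from rfl,
            (he.comp (Fin.castSucc_injective n)).extend_apply]
          have h1 : y' (e j.castSucc) = y (e j.castSucc) := by
            rw [hy', Function.update_of_ne (hne j)]
          have h2 : f j.castSucc y' = f j.castSucc y := by
            refine hf j.castSucc fun w hw => ?_
            rw [hy', Function.update_of_ne]
            rintro rfl
            rcases hw with hw | ⟨i, hi, h⟩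
            · exact hcs _ hw
            · rw [he h] at hi
              exact absurd (Fin.castSucc_lt_last j) (not_lt.2 hi.le)
          simp only [Function.comp_apply, h1, h2]
      · rw [Function.extend_apply' _ _ _ hw, Function.extend_apply', hy', Function.update_of_ne]
        · exact fun h => hw ⟨_, h.symm⟩
        · rintro ⟨j, hj⟩
          exact hw ⟨_, hj⟩
    rw [hmap]
    refine hmul.mono ?_
    have := Nat.pow_le_pow_right (show 0 < 2 by norm_num) hcard
    rw [← add_assoc, pow_succ]
    omega

lemma finFunctionFinEquiv_mod_eq {n : ℕ} {x y : Fin n → Fin 2} (b : ℕ)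
    (h : ∀ j : Fin n, (j : ℕ) < b → x j = y j) :
    (finFunctionFinEquiv x : ℕ) % 2 ^ b = (finFunctionFinEquiv y : ℕ) % 2 ^ b := by
  rw [finFunctionFinEquiv_apply, finFunctionFinEquiv_apply, Finset.sum_nat_mod,
    Finset.sum_nat_mod (f := fun i => (y i : ℕ) * 2 ^ (i : ℕ))]
  congr 1
  refine Finset.sum_congr rfl fun j _ => ?_
  rcases lt_or_ge (j : ℕ) b with hj | hj
  · rw [h j hj]
  · have : 2 ^ b ∣ 2 ^ (j : ℕ) := pow_dvd_pow 2 hj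
    rw [Nat.mod_eq_zero_of_dvd (this.mul_left _), Nat.mod_eq_zero_of_dvd (this.mul_left _)]

/-- The bit `b` of a sum is the sum modulo two of bit `b` of the first summand and of bit `b` of
the sum in which the first summand is truncated to its lower bits. -/
lemma bit_add (X l n b : ℕ) (hb : b < n) :
    (X + l) % 2 ^ n / 2 ^ b % 2 = (X / 2 ^ b % 2 + (X % 2 ^ b + l) / 2 ^ b % 2) % 2 := by
  obtain ⟨k, rfl⟩ := Nat.exists_eq_add_of_lt hb
  rw [show b + k + 1 = b + (k + 1) by ring, pow_add, Nat.mod_mul_right_div_self, pow_succ',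
    Nat.mod_mul_right_mod, ← Nat.add_mod]
  congr 1
  conv_lhs => rw [← Nat.div_add_mod X (2 ^ b), add_assoc, Nat.mul_add_div (by positivity)]

/-- Addition of `l`, modulo `2 ^ n`, to the number held in binary by the wires `e`. -/
def addOnRegister {n : ℕ} (e : Fin n → W) (l : ℕ) (y : W → Fin 2) : W → Fin 2 :=
  Function.extend e (finFunctionFinEquiv.symm
    ⟨((finFunctionFinEquiv (y ∘ e) : ℕ) + l) % 2 ^ n, Nat.mod_lt _ (by positivity)⟩) y

lemma addOnRegister_comp {n : ℕ} {e : Fin n → W} (he : Function.Injective e) (l : ℕ)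
    (y : W → Fin 2) : (finFunctionFinEquiv (addOnRegister e l y ∘ e) : ℕ) =
      ((finFunctionFinEquiv (y ∘ e) : ℕ) + l) % 2 ^ n := by
  rw [addOnRegister, Function.extend_comp he, Equiv.apply_symm_apply]

lemma addOnRegister_of_ne {n : ℕ} {e : Fin n → W} (l : ℕ) (y : W → Fin 2) {w : W}
    (hw : ∀ j, w ≠ e j) : addOnRegister e l y w = y w :=
  Function.extend_apply' _ _ _ fun ⟨j, hj⟩ => hw j hj.symm

lemma addOnRegister_zero {n : ℕ} {e : Fin n → W} (he : Function.Injective e) (y : W → Fin 2) :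
    addOnRegister e 0 y = y := by
  funext w
  by_cases hw : ∃ j, e j = w
  · obtain ⟨j, rfl⟩ := hw
    rw [addOnRegister, he.extend_apply]
    simp only [add_zero, Nat.mod_eq_of_lt (Fin.is_lt _), Fin.eta, Equiv.symm_apply_apply,
      Function.comp_apply]
  · exact Function.extend_apply' _ _ _ hw

lemma HasGateCount.addOnRegister [Nonempty W] (cs : Finset W) {n : ℕ} (e : Fin n → W)
    (he : Function.Injective e) (hcs : ∀ j, e j ∉ cs) (l : (W → Fin 2) → ℕ)
    (hl : DependsOn l ↑cs) :
    HasGateCount (mapMatrix fun y => addOnRegister e (l y) y) (9 * 2 ^ (cs.card + n)) := by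
  have h := HasGateCount.triangular_flip cs e he hcs (fun b y =>
    ⟨((finFunctionFinEquiv (y ∘ e) : ℕ) % 2 ^ (b : ℕ) + l y) / 2 ^ (b : ℕ) % 2,
      Nat.mod_lt _ (by norm_num)⟩) (fun b x y hxy => by
    have h1 : l x = l y := hl fun w hw => hxy w (Or.inl hw)
    have h2 := finFunctionFinEquiv_mod_eq (x := x ∘ e) (y := y ∘ e) (b : ℕ)
      fun j hj => hxy _ (Or.inr ⟨j, hj, rfl⟩)
    simp only [h1, h2])
  convert h using 4 with y
  rw [LJGradient.addOnRegister]
  congr 1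
  funext b
  ext
  have hbit : (y (e b) : ℕ) = (finFunctionFinEquiv (y ∘ e) : ℕ) / 2 ^ (b : ℕ) % 2 := by
    conv_lhs => rw [show y (e b) = finFunctionFinEquiv.symm (finFunctionFinEquiv (y ∘ e)) b by simp]
    rw [finFunctionFinEquiv_symm_apply_val]
  rw [finFunctionFinEquiv_symm_apply_val, Fin.val_add, hbit]
  exact bit_add _ _ _ _ b.2

lemma finRotate_pow_apply (N m : ℕ) (i : Fin N) :
    (((finRotate N) ^ m) i : ℕ) = ((i : ℕ) + m) % N := by
  have := i.neZero
  induction m with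
  | zero => simp [Nat.mod_eq_of_lt i.is_lt]
  | succ m ih =>
    rw [pow_succ', Equiv.Perm.mul_apply, finRotate_apply, Fin.val_add, ih, Fin.val_one',
      ← Nat.add_mod, add_assoc]

lemma finRotate_zpow_apply (N : ℕ) (l : ℤ) (i : Fin N) :
    (((finRotate N) ^ l) i : ℕ) = ((i : ℕ) + (l % N).toNat) % N := by
  have hN : 0 < N := i.pos
  have h1 : (finRotate N) ^ N = 1 := by
    ext j
    rw [finRotate_pow_apply, Nat.add_mod_right, Nat.mod_eq_of_lt j.is_lt]
    rfl
  have h2 : (finRotate N) ^ l = (finRotate N) ^ (l % N).toNat := by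
    conv_lhs => rw [← Int.emod_add_mul_ediv l N]
    rw [zpow_add, zpow_mul, zpow_natCast, h1, one_zpow, mul_one, ← zpow_natCast,
      Int.toNat_of_nonneg (Int.emod_nonneg _ (by omega))]
  rw [h2, finRotate_pow_apply]

/-- Shift of the coordinate of particle `i` whose number is held by the register `out` by the
number of grid points `L` determined by the register `eL`. -/
def shiftState {d n m dl : ℕ} (out : Fin m → W) (eL : Fin dl → W) (sys : SysWire d n → W)
    (i : Fin 2) (L : (Fin dl → Fin 2) → ℤ) (s : Finset (Fin d)) (y : W → Fin 2) : W → Fin 2 :=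
  if h : ∃ h : (finFunctionFinEquiv (y ∘ out) : ℕ) < d, (⟨_, h⟩ : Fin d) ∈ s then
    addOnRegister (fun b => sys (i, ⟨_, h.1⟩, b)) (L (y ∘ eL) % ((2 ^ n : ℕ) : ℤ)).toNat y
  else y

variable {d n m dl : ℕ} {out : Fin m → W} {eL : Fin dl → W} {sys : SysWire d n → W} {i : Fin 2}
  {L : (Fin dl → Fin 2) → ℤ} {s : Finset (Fin d)}

lemma shiftState_of_ne (y : W → Fin 2) {w : W} (hw : ∀ j, w ≠ sys j) :
    shiftState out eL sys i L s y w = y w := by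
  rw [shiftState]
  split_ifs
  · exact addOnRegister_of_ne _ _ fun j => hw _
  · rfl

lemma decode_shiftState (hS : Function.Injective sys) (y : W → Fin 2)
    (hy : (finFunctionFinEquiv (y ∘ out) : ℕ) < d) :
    decode (shiftState out eL sys i L Finset.univ y ∘ sys) =
      shift i ⟨_, hy⟩ (L (y ∘ eL)) (decode (y ∘ sys)) := by
  rw [shiftState, dif_pos ⟨hy, Finset.mem_univ _⟩]
  funext i' k'
  have hinj : Function.Injective fun b : Fin n => sys (i, ⟨_, hy⟩, b) := fun b b' h => by
    simpa using hS h
  by_cases h : i' = i ∧ k' = ⟨_, hy⟩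
  · obtain ⟨rfl, rfl⟩ := h
    rw [shift, Function.update_self, Function.update_self]
    ext
    rw [finRotate_zpow_apply]
    exact addOnRegister_comp hinj _ _
  · have h1 : shift i ⟨_, hy⟩ (L (y ∘ eL)) (decode (y ∘ sys)) i' k' = decode (y ∘ sys) i' k' := by
      rw [shift]
      by_cases hi : i' = i
      · subst hi
        rw [Function.update_self, Function.update_of_ne fun hk => h ⟨rfl, hk⟩]
      · rw [Function.update_of_ne hi]
    rw [h1, decode, decode]
    congr 1
    funext b
    refine addOnRegister_of_ne _ _ fun j hj => h ?_
    have := hS hj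
    simp only [Prod.mk.injEq] at this
    exact ⟨this.1, this.2.1⟩

lemma HasGateCount.shiftState [Nonempty W] (hS : Function.Injective sys)
    (hOS : ∀ j j', out j ≠ sys j') (hLS : ∀ j j', eL j ≠ sys j') (i : Fin 2)
    (L : (Fin dl → Fin 2) → ℤ) (s : Finset (Fin d)) :
    HasGateCount (mapMatrix (shiftState out eL sys i L s)) (s.card * (9 * 2 ^ (m + dl + n))) := by
  induction s using Finset.induction_on with
  | empty =>
    have : LJGradient.shiftState out eL sys i L ∅ = id := by
      funext y
      rw [LJGradient.shiftState, dif_neg]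
      · rfl
      · simp
    rw [this, mapMatrix_id]
    exact HasGateCount.one.mono (Nat.zero_le _)
  | insert k s hk ih =>
    have hinj : Function.Injective fun b : Fin n => sys (i, k, b) := fun b b' h => by
      simpa using hS h
    have hadd := HasGateCount.addOnRegister (Finset.univ.image out ∪ Finset.univ.image eL)
      (fun b => sys (i, k, b)) hinj (fun j => by
        simp only [Finset.mem_union, Finset.mem_image, Finset.mem_univ, true_and]
        rintro (⟨a, ha⟩ | ⟨a, ha⟩)
        · exact hOS _ _ ha
        · exact hLS _ _ ha)
      (fun y => if (finFunctionFinEquiv (y ∘ out) : ℕ) = k then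
        (L (y ∘ eL) % ((2 ^ n : ℕ) : ℤ)).toNat else 0) (fun x y hxy => by
        have h1 : x ∘ out = y ∘ out := funext fun j => hxy _ (by simp)
        have h2 : x ∘ eL = y ∘ eL := funext fun j => hxy _ (by simp)
        simp only [h1, h2])
    have hcard : (Finset.univ.image out ∪ Finset.univ.image eL).card + n ≤ m + dl + n := by
      refine Nat.add_le_add_right ((Finset.card_union_le _ _).trans (Nat.add_le_add ?_ ?_)) _
      · exact Finset.card_image_le.trans (by simp)
      · exact Finset.card_image_le.trans (by simp)
    have hmul := (hadd.mono
      (Nat.mul_le_mul_left 9 (Nat.pow_le_pow_right (by norm_num) hcard))).mul ih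
    rw [mapMatrix_mul] at hmul
    have hmap : LJGradient.shiftState out eL sys i L (insert k s) =
        (fun y => LJGradient.addOnRegister (fun b => sys (i, k, b))
          (if (finFunctionFinEquiv (y ∘ out) : ℕ) = k then
            (L (y ∘ eL) % ((2 ^ n : ℕ) : ℤ)).toNat else 0) y) ∘
        LJGradient.shiftState out eL sys i L s := by
      funext y
      rw [Function.comp_apply]
      have h1 : LJGradient.shiftState out eL sys i L s y ∘ out = y ∘ out :=
        funext fun j => shiftState_of_ne _ fun j' => hOS _ _
      rw [h1]
      by_cases h : (finFunctionFinEquiv (y ∘ out) : ℕ) = k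
      · have h2 : LJGradient.shiftState out eL sys i L s y = y := by
          rw [LJGradient.shiftState, dif_neg]
          rintro ⟨h3, h4⟩
          have : (⟨_, h3⟩ : Fin d) = k := Fin.ext h
          exact hk (this ▸ h4)
        have h3 : (finFunctionFinEquiv (y ∘ out) : ℕ) < d := h ▸ k.2
        have h4 : (⟨_, h3⟩ : Fin d) = k := Fin.ext h
        rw [if_pos h, h2, LJGradient.shiftState, dif_pos ⟨h3, by rw [h4]; simp⟩]
        simp only [h4]
      · rw [if_neg h, addOnRegister_zero hinj, LJGradient.shiftState, LJGradient.shiftState]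
        have h5 : ∀ h3 : (finFunctionFinEquiv (y ∘ out) : ℕ) < d,
            ((⟨_, h3⟩ : Fin d) ∈ insert k s ↔ (⟨_, h3⟩ : Fin d) ∈ s) := fun h3 => by
          rw [Finset.mem_insert, or_iff_right]
          rintro rfl
          exact h rfl
        simp only [h5]
    rw [hmap, Finset.card_insert_of_notMem hk]
    exact hmul.mono (by ring_nf; rfl)

end Shift

/-! ### The stencil as a linear combination of shifts -/

/-- The points `1, -1, 2, -2, …` of the stencil, enumerated in binary. -/
def stencilPoint {dl : ℕ} (b : Fin dl → Fin 2) : ℤ :=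
  if (finFunctionFinEquiv b : ℕ) % 2 = 0 then ((finFunctionFinEquiv b : ℕ) / 2 : ℕ) + 1
  else -(((finFunctionFinEquiv b : ℕ) / 2 : ℕ) + 1)

lemma stencilPoint_injective {dl : ℕ} : Function.Injective (stencilPoint (dl := dl)) := by
  intro b b' h
  apply finFunctionFinEquiv.injective
  apply Fin.ext
  simp only [stencilPoint] at h
  split_ifs at h <;> omega

lemma sum_stencilPoint {dl a : ℕ} (hdl : 2 * a ≤ 2 ^ dl) (h : ℤ → ℝ) (h0 : h 0 = 0)
    (ha : ∀ l : ℤ, a < l.natAbs → h l = 0) :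
    ∑ b : Fin dl → Fin 2, h (stencilPoint b) = ∑ l ∈ Finset.Icc (-(a : ℤ)) a, h l := by
  rw [← Finset.sum_image (f := h) (g := stencilPoint) (s := Finset.univ)
    fun b _ b' _ hb => stencilPoint_injective hb]
  refine Finset.sum_congr_of_eq_on_inter ?_ ?_ fun _ _ _ => rfl
  · intro l _ hl
    refine ha l ?_
    rw [Finset.mem_Icc] at hl
    omega
  · intro l hl hl'
    rw [Finset.mem_Icc] at hl
    by_cases hl0 : l = 0
    · rw [hl0, h0]
    refine absurd ?_ hl'
    have hj : 2 * (l.natAbs - 1) + (if 0 < l then 0 else 1) < 2 ^ dl := by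
      split_ifs <;> omega
    refine Finset.mem_image.2 ⟨finFunctionFinEquiv.symm ⟨_, hj⟩, Finset.mem_univ _, ?_⟩
    rw [stencilPoint, Equiv.apply_symm_apply]
    split_ifs <;> simp only at * <;> omega

lemma fdCoeff_zero (a : ℕ) : fdCoeff a 0 = 0 := by simp [fdCoeff]

lemma fdCoeff_of_lt {a : ℕ} {l : ℤ} (h : a < l.natAbs) : fdCoeff a l = 0 := by
  simp [fdCoeff, h]

lemma fdNorm_pos {a : ℕ} (ha : 1 ≤ a) : 0 < fdNorm a := by
  refine Finset.sum_pos' (fun _ _ => abs_nonneg _) ⟨1, by simp; omega, ?_⟩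
  rw [fdCoeff, if_neg (by simp; omega)]
  rw [abs_pos]
  simp [Nat.factorial_ne_zero]

section Gradient

variable {W : Type} [Fintype W] [DecidableEq W]

lemma injective_of_mapMatrix_mem_unitary {f : (W → Fin 2) → (W → Fin 2)}
    (h : mapMatrix f ∈ Matrix.unitaryGroup (W → Fin 2) ℂ) : Function.Injective f := by
  intro z z' hz
  have h1 := congrFun (congrFun (Matrix.mem_unitaryGroup_iff'.1 h) z) z'
  rw [Matrix.star_eq_conjTranspose, conjTranspose_mapMatrix_mul_apply, mapMatrix,
    Matrix.of_apply, if_pos hz] at h1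
  by_contra hne
  rw [Matrix.one_apply_ne hne] at h1
  exact one_ne_zero h1

/-- The circuit of the block encoding: a superposition of the directions in the output register
and of the points of the stencil in the register `eL`, a shift of the system, the polynomial of the
distance, and the inverse of the shift. -/
theorem exists_gradient_circuit {n d a nb dk m dl : ℕ} (hn : 1 ≤ n) (hd : 1 ≤ d) (ha : 1 ≤ a)
    (hnb : n ≤ 2 ^ nb) (hdk : d ≤ 2 ^ dk) (hm : d ≤ 2 ^ m) (hdl : 2 * a ≤ 2 ^ dl)
    {eK : Fin dk → W} {eB : Fin (nb + 1) → W} {c : W} {eL : Fin dl → W} {out : Fin m → W}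
    {sys : SysWire d n → W}
    (hK : Function.Injective eK) (hB : Function.Injective eB) (hL : Function.Injective eL)
    (hO : Function.Injective out) (hS : Function.Injective sys)
    (hKB : ∀ i j, eK i ≠ eB j) (hKL : ∀ i j, eK i ≠ eL j) (hBL : ∀ i j, eB i ≠ eL j)
    (hcK : ∀ i, c ≠ eK i) (hcB : ∀ i, c ≠ eB i) (hcL : ∀ i, c ≠ eL i)
    (hKO : ∀ i j, eK i ≠ out j) (hBO : ∀ i j, eB i ≠ out j) (hcO : ∀ i, c ≠ out i)
    (hLO : ∀ i j, eL i ≠ out j)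
    (hKS : ∀ i j, eK i ≠ sys j) (hBS : ∀ i j, eB i ≠ sys j) (hcS : ∀ i, c ≠ sys i)
    (hLS : ∀ i j, eL i ≠ sys j) (hOS : ∀ i j, out i ≠ sys j)
    (i : Fin 2) (R : Polynomial ℝ) {Λ : ℝ} (hΛ : 0 < Λ)
    (hR : ∀ s ∈ Set.Icc (-1 : ℝ) 1, |R.eval (d * (1 + s) / 2)| < Λ) :
    ∃ M : Matrix (W → Fin 2) (W → Fin 2) ℂ,
      HasGateCount M (3 * R.natDegree * (45 * 2 ^ (dk + (nb + 1))) + 1 +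
        2 * (d * (9 * 2 ^ (m + dl + n))) + 6 * 2 ^ dl + 3 * 2 ^ m) ∧
      ∀ x y : W → Fin 2, (∀ j, x (eK j) = 0) → (∀ j, x (eB j) = 0) → x c = 0 →
        (∀ j, x (eL j) = 0) → (∀ j, y (eK j) = 0) → (∀ j, y (eB j) = 0) → y c = 0 →
        (∀ j, y (eL j) = 0) → (∀ j, y (out j) = 0) →
        M x y = if ∀ w, (∀ j, w ≠ out j) → x w = y w then
          (if h : (finFunctionFinEquiv (x ∘ out) : ℕ) < d then
            (((√(d : ℝ) * fdNorm a * Λ)⁻¹ * fdPartial a R i ⟨_, h⟩ (decode (y ∘ sys)) : ℝ) : ℂ)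
          else 0) else 0 := by
  have : Nonempty W := ⟨c⟩
  have hd0 : (d : ℝ) ≠ 0 := by positivity
  have hβ := fdNorm_pos ha
  obtain ⟨U, hU, hUc, hUτ⟩ := exists_distance_overlap hn hd hnb hdk eK eB sys hK hB hS hKB hKS hBS
  set r₁ := Finset.univ.image eK ∪ Finset.univ.image eB with hr₁
  set r₂ := Finset.univ.image eB with hr₂
  have hmem : ∀ (x : W → Fin 2), (∀ j, x (eK j) = 0) → (∀ j, x (eB j) = 0) →
      ∀ w ∈ r₁, x w = 0 := by
    intro x h1 h2 w hw
    simp only [hr₁, hr₂, Finset.mem_union, Finset.mem_image, Finset.mem_univ, true_and] at hw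
    rcases hw with ⟨j, rfl⟩ | ⟨j, rfl⟩
    · exact h1 j
    · exact h2 j
  have hc₂ : c ∉ r₂ := by
    simp only [hr₂, Finset.mem_image, Finset.mem_univ, true_and, not_exists]
    exact fun j h => hcB j h.symm
  have hc₁ : c ∉ r₁ := by
    simp only [hr₁, Finset.mem_union, not_or]
    refine ⟨?_, hc₂⟩
    simp only [Finset.mem_image, Finset.mem_univ, true_and, not_exists]
    exact fun j h => hcK j h.symm
  -- the argument of the polynomial is rescaled from the squared distance to `[-1, 1]`
  set Q : Polynomial ℝ := Polynomial.C Λ⁻¹ *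
    R.comp (Polynomial.C ((d : ℝ) / 2) * (1 + Polynomial.X)) with hQ
  have hQe : ∀ s, Q.eval s = Λ⁻¹ * R.eval (d * (1 + s) / 2) := by
    intro s
    simp only [hQ, Polynomial.eval_mul, Polynomial.eval_C, Polynomial.eval_comp,
      Polynomial.eval_add, Polynomial.eval_one, Polynomial.eval_X]
    congr 2
    ring
  have hQd : Q.natDegree ≤ R.natDegree := by
    refine (Polynomial.natDegree_C_mul_le _ _).trans ?_
    rw [Polynomial.natDegree_comp]
    have : (Polynomial.C ((d : ℝ) / 2) * (1 + Polynomial.X)).natDegree ≤ 1 := by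
      refine (Polynomial.natDegree_C_mul_le _ _).trans ?_
      exact Polynomial.natDegree_add_le_of_degree_le (by simp) (by simp)
    exact (Nat.mul_le_mul_left _ this).trans (by simp)
  have hQ1 : ∀ s ∈ Set.Icc (-1 : ℝ) 1, |Q.eval s| < 1 := by
    intro s hs
    rw [hQe, abs_mul, abs_of_pos (inv_pos.2 hΛ), inv_mul_lt_iff₀ hΛ, mul_one]
    exact hR s hs
  obtain ⟨V, hV, hVe⟩ := exists_polynomial_blockEncoding hc₁ hc₂ hU (hUc c hcK hcB hcS) _ hUτ Q
    fun s h1 h2 => hQ1 s ⟨h1, h2⟩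
  set T := shiftState out eL sys i stencilPoint Finset.univ with hT
  have hTc := HasGateCount.shiftState hS hOS hLS i stencilPoint (Finset.univ : Finset (Fin d))
  have hTinj : Function.Injective T := injective_of_mapMatrix_mem_unitary hTc.mem_unitary
  -- the amplitudes of the two preparations multiply to the normalized stencil coefficients
  set v : (Fin dl → Fin 2) → ℝ := fun b => √(|fdCoeff a (stencilPoint b)| / fdNorm a) with hv
  set v' : (Fin dl → Fin 2) → ℝ := fun b => SignType.sign (fdCoeff a (stencilPoint b)) *
    √(|fdCoeff a (stencilPoint b)| / fdNorm a) with hv'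
  have hvv : ∀ b, v b * v b = |fdCoeff a (stencilPoint b)| / fdNorm a := fun b =>
    Real.mul_self_sqrt (by positivity)
  have hvv' : ∀ b, v b * v' b = fdCoeff a (stencilPoint b) / fdNorm a := by
    intro b
    calc v b * v' b = SignType.sign (fdCoeff a (stencilPoint b)) * (v b * v b) := by
          simp only [hv, hv']; ring
      _ = _ := by rw [hvv, mul_div_assoc', sign_mul_abs]
  have hv1 : ∑ b, v b ^ 2 = 1 := by
    simp only [pow_two, hvv]
    rw [← Finset.sum_div, sum_stencilPoint hdl (fun l => |fdCoeff a l|)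
      (by simp [fdCoeff_zero]) (fun l hl => by simp [fdCoeff_of_lt hl])]
    exact div_self hβ.ne'
  have hv1' : ∑ b, v' b ^ 2 = 1 := by
    rw [← hv1]
    refine Finset.sum_congr rfl fun b _ => ?_
    by_cases h0 : fdCoeff a (stencilPoint b) = 0
    · simp [hv, hv', h0]
    · have : ((SignType.sign (fdCoeff a (stencilPoint b)) : SignType) : ℝ) ^ 2 = 1 := by
        rcases lt_or_gt_of_ne h0 with h | h
        · simp [sign_neg h]
        · simp [sign_pos h]
      simp only [hv, hv', mul_pow, this, one_mul]
  obtain ⟨P, hP, -, hPe⟩ := exists_statePrep eL hL v hv1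
  obtain ⟨P', hP', -, hPe'⟩ := exists_statePrep eL hL v' hv1'
  obtain ⟨PO, hPO, -, hPOe⟩ := exists_statePrep out hO (uniformAmplitude d m)
    (sum_uniformAmplitude_sq hd hm)
  set B := (mapMatrix T).conjTranspose * V * mapMatrix T with hBdef
  have hBcount := (hTc.conjTranspose.mul hV).mul hTc
  set A := P.conjTranspose * B * P' with hA
  have hAcount := (hP.conjTranspose.mul hBcount).mul hP'
  have hTflag : ∀ z w, (∀ j, w ≠ sys j) → T z w = z w := fun z w hw => shiftState_of_ne z hw
  set μ : (W → Fin 2) → ℂ := fun z =>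
    ((Q.eval (2 * (sqDist (decode (T z ∘ sys)) / d) - 1) : ℝ) : ℂ) with hμ
  have hBe : ∀ z z' : W → Fin 2, (∀ j, z (eK j) = 0) → (∀ j, z (eB j) = 0) → z c = 0 →
      (∀ j, z' (eK j) = 0) → (∀ j, z' (eB j) = 0) → z' c = 0 →
      B z z' = if z = z' then μ z else 0 := by
    intro z z' h1 h2 h3 h1' h2' h3'
    rw [hBdef, mul_mapMatrix_apply, conjTranspose_mapMatrix_mul_apply, hVe]
    · simp only [hTinj.eq_iff]
      by_cases h : z = z'
      · rw [if_pos h, if_pos h, h]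
      · rw [if_neg h, if_neg h]
    · rw [hTflag _ _ hcS]; exact h3
    · rw [hTflag _ _ hcS]; exact h3'
    · exact hmem _ (fun j => by rw [hTflag _ _ (hKS j)]; exact h1 j)
        fun j => by rw [hTflag _ _ (hBS j)]; exact h2 j
    · exact hmem _ (fun j => by rw [hTflag _ _ (hKS j)]; exact h1' j)
        fun j => by rw [hTflag _ _ (hBS j)]; exact h2' j
  have hAe : ∀ x y : W → Fin 2, (∀ j, x (eK j) = 0) → (∀ j, x (eB j) = 0) → x c = 0 →
      (∀ j, x (eL j) = 0) → (∀ j, y (eK j) = 0) → (∀ j, y (eB j) = 0) → y c = 0 →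
      (∀ j, y (eL j) = 0) → A x y =
        if x = y then ∑ b, ((v b * v' b : ℝ) : ℂ) * μ (Function.extend eL b y) else 0 := by
    intro x y x1 x2 x3 x4 y1 y2 y3 y4
    refine statePrep_sandwich hL hPe hPe' B μ x4 y4 fun z z' hz hz' => ?_
    refine hBe z z' (fun j => ?_) (fun j => ?_) ?_ (fun j => ?_) (fun j => ?_) ?_
    · rw [hz _ (hKL j)]; exact x1 j
    · rw [hz _ (hBL j)]; exact x2 j
    · rw [hz _ hcL]; exact x3
    · rw [hz' _ (hKL j)]; exact y1 j
    · rw [hz' _ (hBL j)]; exact y2 j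
    · rw [hz' _ hcL]; exact y3
  refine ⟨A * PO, (hAcount.mul hPO).mono ?_, ?_⟩
  · have h1 : r₂.card ≤ nb + 1 := Finset.card_image_le.trans (by simp)
    have h2 : r₁.card ≤ dk + (nb + 1) := (Finset.card_union_le _ _).trans
      (Nat.add_le_add (Finset.card_image_le.trans (by simp)) h1)
    have h3 := Nat.pow_le_pow_right (show 0 < 2 by norm_num) h2
    have h4 := Nat.pow_le_pow_right (show 0 < 2 by norm_num) (h1.trans (Nat.le_add_left _ dk))
    have h5 : 1 ≤ 2 ^ (dk + (nb + 1)) := Nat.one_le_two_pow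
    have h6 : 2 * (16 * 2 ^ (dk + (nb + 1))) + 6 * 2 ^ r₁.card + 6 * 2 ^ r₂.card + 1 ≤
        45 * 2 ^ (dk + (nb + 1)) := by omega
    have h7 := Nat.mul_le_mul (Nat.mul_le_mul_left 3 hQd) h6
    rw [Finset.card_univ, Fintype.card_fin]
    omega
  · intro x y x1 x2 x3 x4 y1 y2 y3 y4 y5
    have hsum : (A * PO) x y = A x x * PO x y := by
      rw [Matrix.mul_apply, Finset.sum_eq_single x]
      · intro u _ hu
        rw [hPOe u y y5]
        split_ifs with h
        · rw [hAe x u x1 x2 x3 x4 (fun j => by rw [h _ (hKO j)]; exact y1 j)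
            (fun j => by rw [h _ (hBO j)]; exact y2 j) (by rw [h _ hcO]; exact y3)
            (fun j => by rw [h _ (hLO j)]; exact y4 j), if_neg (Ne.symm hu), zero_mul]
        · rw [mul_zero]
      · simp
    rw [hsum, hPOe x y y5, hAe x x x1 x2 x3 x4 x1 x2 x3 x4, if_pos rfl]
    split_ifs with h hk
    · have hsys : x ∘ sys = y ∘ sys := funext fun j => h _ fun j' => (hOS _ _).symm
      have hμe : ∀ b, μ (Function.extend eL b x) =
          ((Λ⁻¹ * R.eval (sqDist (shift i ⟨_, hk⟩ (stencilPoint b) (decode (y ∘ sys)))) : ℝ) :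
            ℂ) := by
        intro b
        have e1 : Function.extend eL b x ∘ out = x ∘ out := funext fun j =>
          Function.extend_apply' _ _ _ fun ⟨j', hj⟩ => hLO j' j hj
        have e2 : Function.extend eL b x ∘ sys = y ∘ sys := by
          rw [← hsys]
          exact funext fun j => Function.extend_apply' _ _ _ fun ⟨j', hj⟩ => hLS j' j hj
        have e3 : Function.extend eL b x ∘ eL = b := Function.extend_comp hL _ _
        have hk' : (finFunctionFinEquiv (Function.extend eL b x ∘ out) : ℕ) < d := by rwa [e1]
        simp only [hμ]
        rw [hT, decode_shiftState hS _ hk', hQe, e2, e3]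
        simp only [e1]
        congr 3
        field_simp
        ring
      simp only [hμe, hvv']
      rw [uniformAmplitude, if_pos hk, fdPartial]
      have hst := sum_stencilPoint hdl (fun l => fdCoeff a l *
        R.eval (sqDist (shift i ⟨_, hk⟩ l (decode (y ∘ sys))))) (by simp [fdCoeff_zero])
        (fun l hl => by simp [fdCoeff_of_lt hl])
      rw [← hst, Finset.mul_sum, Complex.ofReal_sum, Finset.sum_mul]
      refine Finset.sum_congr rfl fun b _ => ?_
      rw [← Complex.ofReal_mul, ← Complex.ofReal_mul]
      congr 1
      rw [Real.sqrt_inv, mul_inv, mul_inv]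
      ring
    · rw [uniformAmplitude, if_neg hk]
      simp
    · simp

end Gradient

/-! ### Resources -/

lemma two_pow_clog_le {x : ℕ} (hx : 1 ≤ x) : 2 ^ Nat.clog 2 x ≤ 2 * x := by
  rcases hx.eq_or_lt with rfl | h
  · simp
  · have h1 := Nat.pow_pred_clog_lt_self (b := 2) one_lt_two h
    have h2 : 0 < Nat.clog 2 x := Nat.clog_pos one_lt_two h
    rw [← Nat.succ_pred_eq_of_pos h2, pow_succ]
    omega

lemma IsQSPApprox.mono {V : ℝ → ℝ} {d : ℕ} {δ tol B B' D D' : ℝ} {R : Polynomial ℝ}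
    (h : IsQSPApprox V d δ tol B D R) (hB : B ≤ B') (hD : D ≤ D') :
    IsQSPApprox V d δ tol B' D' R :=
  ⟨h.1.trans hD, fun y h1 h2 => (h.2.1 y h1 h2).trans hB, h.2.2⟩

/-- Since `s ↦ (1 + s) / 2` maps `[-1, 1]` to `[0, 1]`, the bound of an admissible approximation
covers all squared distances up to `d`. -/
lemma IsQSPApprox.abs_eval_le {V : ℝ → ℝ} {d : ℕ} {δ tol B D : ℝ} {R : Polynomial ℝ}
    (h : IsQSPApprox V d δ tol B D R) {s : ℝ} (hs : s ∈ Set.Icc (-1 : ℝ) 1) :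
    |R.eval (d * (1 + s) / 2)| ≤ B := by
  have h0 : 0 ≤ (1 + s) / 8 := by linarith [hs.1]
  have h1 := h.2.1 (√((1 + s) / 8)) (by linarith [Real.sqrt_nonneg ((1 + s) / 8)])
    (Real.sqrt_le_one.2 (by linarith [hs.2]))
  rw [Real.sq_sqrt h0] at h1
  convert h1 using 3
  ring

lemma gate_count_le {C : ℝ} {n d p D : ℕ} (hn : 1 ≤ n) (hd : 1 ≤ d) (hp : 1 ≤ p) (hC : 0 < C)
    (hD : ((2 * D : ℕ) : ℝ) ≤ C * √(d : ℝ) * p * 2 ^ n * n) :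
    ((3 * D * (45 * 2 ^ (Nat.clog 2 d + (Nat.clog 2 (n + 1) + 1))) + 1 +
        2 * (d * (9 * 2 ^ (Nat.clog 2 d + (Nat.clog 2 p + 1) + n))) +
        6 * 2 ^ (Nat.clog 2 p + 1) + 3 * 2 ^ Nat.clog 2 d : ℕ) : ℝ) ≤
      (175 + 1080 * C) * (d : ℝ) ^ 2 * (p : ℝ) ^ 2 * 2 ^ n * (n : ℝ) ^ 2 := by
  have h1 : (2 : ℝ) ^ Nat.clog 2 d ≤ 2 * d := by exact_mod_cast two_pow_clog_le hd
  have h2 : (2 : ℝ) ^ Nat.clog 2 p ≤ 2 * p := by exact_mod_cast two_pow_clog_le hp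
  have h3 : (2 : ℝ) ^ Nat.clog 2 (n + 1) ≤ 4 * n := by
    have := two_pow_clog_le (show 1 ≤ n + 1 by omega)
    exact_mod_cast this.trans (by omega)
  have hn' : (1 : ℝ) ≤ n := by exact_mod_cast hn
  have hd' : (1 : ℝ) ≤ d := by exact_mod_cast hd
  have hp' : (1 : ℝ) ≤ p := by exact_mod_cast hp
  have hN : (1 : ℝ) ≤ 2 ^ n := one_le_pow₀ (by norm_num)
  have hsd : √(d : ℝ) ≤ d :=
    Real.sqrt_le_iff.2 ⟨by positivity, le_self_pow₀ hd' (by norm_num)⟩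
  push_cast at hD ⊢
  simp only [pow_add, pow_one]
  set N : ℝ := 2 ^ n
  have hD0 : (0 : ℝ) ≤ D := Nat.cast_nonneg D
  have hD' : (2 : ℝ) * D ≤ C * d * p * N * n := hD.trans (by gcongr)
  have hdd : (d : ℝ) ≤ d ^ 2 := le_self_pow₀ hd' (by norm_num)
  have hpp : (p : ℝ) ≤ p ^ 2 := le_self_pow₀ hp' (by norm_num)
  have hn2 : (1 : ℝ) ≤ (n : ℝ) ^ 2 := one_le_pow₀ hn'
  have hd2 : (1 : ℝ) ≤ (d : ℝ) ^ 2 := one_le_pow₀ hd'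
  have hp2 : (1 : ℝ) ≤ (p : ℝ) ^ 2 := one_le_pow₀ hp'
  have t1 : 3 * (D : ℝ) * (45 * (2 ^ Nat.clog 2 d * (2 ^ Nat.clog 2 (n + 1) * 2))) ≤
      1080 * C * ((d : ℝ) ^ 2 * (p : ℝ) ^ 2 * N * (n : ℝ) ^ 2) :=
    calc _ ≤ 3 * (D : ℝ) * (45 * ((2 * d) * ((4 * n) * 2))) := by gcongr
      _ = 1080 * (d * n) * (2 * D) := by ring
      _ ≤ 1080 * (d * n) * (C * d * p * N * n) := by gcongr
      _ = 1080 * C * ((d : ℝ) ^ 2 * p * N * (n : ℝ) ^ 2) := by ring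
      _ ≤ _ := by gcongr
  have t2 : 2 * ((d : ℝ) * (9 * (2 ^ Nat.clog 2 d * (2 ^ Nat.clog 2 p * 2) * N))) ≤
      144 * ((d : ℝ) ^ 2 * (p : ℝ) ^ 2 * N * (n : ℝ) ^ 2) :=
    calc _ ≤ 2 * ((d : ℝ) * (9 * ((2 * d) * ((2 * p) * 2) * N))) := by gcongr
      _ = 144 * ((d : ℝ) ^ 2 * p * N * 1) := by ring
      _ ≤ _ := by gcongr
  have t3 : 6 * ((2 : ℝ) ^ Nat.clog 2 p * 2) ≤
      24 * ((d : ℝ) ^ 2 * (p : ℝ) ^ 2 * N * (n : ℝ) ^ 2) :=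
    calc _ ≤ 6 * ((2 * (p : ℝ)) * 2) := by gcongr
      _ = 24 * (1 * p * 1 * 1) := by ring
      _ ≤ _ := by gcongr
  have t4 : 3 * (2 : ℝ) ^ Nat.clog 2 d ≤ 6 * ((d : ℝ) ^ 2 * (p : ℝ) ^ 2 * N * (n : ℝ) ^ 2) :=
    calc _ ≤ 3 * (2 * (d : ℝ)) := by gcongr
      _ = 6 * (d * 1 * 1 * 1) := by ring
      _ ≤ _ := by gcongr
  have t5 : (1 : ℝ) ≤ (d : ℝ) ^ 2 * (p : ℝ) ^ 2 * N * (n : ℝ) ^ 2 :=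
    calc (1 : ℝ) = 1 * 1 * 1 * 1 := by ring
      _ ≤ _ := by gcongr
  linarith

/-- The distribution of the flag ancillas over the registers: directions, particle and digit,
the ancilla of signal processing, the points of the stencil, and one idle ancilla. -/
abbrev FlagWire (dk nb dl : ℕ) : Type :=
  ((Fin dk ⊕ Fin (nb + 1)) ⊕ (Unit ⊕ Fin dl)) ⊕ Unit

/-- The block encoding of the gradient on its registers, for a polynomial that is bounded by `Λ`
on the squared distances up to `d`. -/
theorem exists_blockEncoding_fdGradient {n d a p : ℕ} (hn : 1 ≤ n) (hd : 1 ≤ d) (ha : 1 ≤ a)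
    (hap : a ≤ p) (i : Fin 2) (R : Polynomial ℝ) {Λ : ℝ} (hΛ : 0 < Λ)
    (hR : ∀ s ∈ Set.Icc (-1 : ℝ) 1, |R.eval (d * (1 + s) / 2)| < Λ) :
    ∃ U : Circuit ((Fin (Nat.clog 2 (n + 1) + Nat.clog 2 d + Nat.clog 2 p + 4) ⊕
        Fin (Nat.clog 2 d)) ⊕ SysWire d n),
      IsBlockEncoding (√(d : ℝ) * fdNorm a * Λ) (Circuit.toMatrix U) (fdGradient a R i) ∧
      U.length ≤ 3 * R.natDegree * (45 * 2 ^ (Nat.clog 2 d + (Nat.clog 2 (n + 1) + 1))) + 1 +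
        2 * (d * (9 * 2 ^ (Nat.clog 2 d + (Nat.clog 2 p + 1) + n))) +
        6 * 2 ^ (Nat.clog 2 p + 1) + 3 * 2 ^ Nat.clog 2 d := by
  have hc : Fintype.card (FlagWire (Nat.clog 2 d) (Nat.clog 2 (n + 1)) (Nat.clog 2 p + 1)) =
      Fintype.card (Fin (Nat.clog 2 (n + 1) + Nat.clog 2 d + Nat.clog 2 p + 4)) := by
    simp only [Fintype.card_sum, Fintype.card_fin, Fintype.card_unit]
    ring
  set e := Fintype.equivOfCardEq hc
  obtain ⟨M, ⟨U, hU, hcount⟩, hM⟩ := exists_gradient_circuit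
    (W := (Fin (Nat.clog 2 (n + 1) + Nat.clog 2 d + Nat.clog 2 p + 4) ⊕
        Fin (Nat.clog 2 d)) ⊕ SysWire d n) hn hd ha
    ((Nat.le_succ n).trans (Nat.le_pow_clog one_lt_two (n + 1))) (Nat.le_pow_clog one_lt_two d)
    (Nat.le_pow_clog one_lt_two d)
    (show 2 * a ≤ 2 ^ (Nat.clog 2 p + 1) by
      have := Nat.le_pow_clog one_lt_two p
      rw [pow_succ]; omega)
    (eK := fun j => .inl (.inl (e (.inl (.inl (.inl j))))))
    (eB := fun j => .inl (.inl (e (.inl (.inl (.inr j))))))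
    (c := .inl (.inl (e (.inl (.inr (.inl ()))))))
    (eL := fun j => .inl (.inl (e (.inl (.inr (.inr j))))))
    (out := fun j => .inl (.inr j)) (sys := .inr)
    (fun _ _ => by simp) (fun _ _ => by simp) (fun _ _ => by simp) (fun _ _ => by simp)
    (fun _ _ => by simp) (by simp) (by simp) (by simp) (by simp) (by simp) (by simp) (by simp)
    (by simp) (by simp) (by simp) (by simp) (by simp) (by simp) (by simp) (by simp)
    i R hΛ hR
  refine ⟨U, ⟨Circuit.toMatrix_mem_unitary U, fun z s s' => ?_⟩, hcount⟩
  rw [hU, hM (joinState 0 z s) (joinState 0 0 s') (fun _ => rfl) (fun _ => rfl) rfl (fun _ => rfl)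
    (fun _ => rfl) (fun _ => rfl) rfl (fun _ => rfl) (fun _ => rfl)]
  have hsys : (joinState (0 : Fin (Nat.clog 2 (n + 1) + Nat.clog 2 d + Nat.clog 2 p + 4) → Fin 2)
      (0 : Fin (Nat.clog 2 d) → Fin 2) s' ∘ Sum.inr) = s' := rfl
  have hcond : (∀ w, (∀ j, w ≠ Sum.inl (Sum.inr j)) →
      joinState (0 : Fin (Nat.clog 2 (n + 1) + Nat.clog 2 d + Nat.clog 2 p + 4) → Fin 2) z s w =
        joinState 0 (0 : Fin (Nat.clog 2 d) → Fin 2) s' w) ↔ s = s' := by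
    constructor
    · exact fun h => funext fun j => h (.inr j) (by simp)
    · rintro rfl ((w | w) | w) hw
      · rfl
      · exact absurd rfl (hw w)
      · rfl
  simp only [hcond, hsys, fdGradient, Matrix.of_apply]
  have hlam : √(d : ℝ) * fdNorm a * Λ ≠ 0 := by
    have := fdNorm_pos ha
    positivity
  by_cases hs : s = s'
  · rw [if_pos hs]
    by_cases hk : (finFunctionFinEquiv z : ℕ) < d
    · rw [dif_pos (show (finFunctionFinEquiv (joinState (0 : Fin (Nat.clog 2 (n + 1) +
        Nat.clog 2 d + Nat.clog 2 p + 4) → Fin 2) z s ∘ fun j => Sum.inl (Sum.inr j)) : ℕ) < d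
          from hk), dif_pos hk, if_pos hs, ← Complex.ofReal_mul, mul_inv_cancel_left₀ hlam]
      rfl
    · rw [dif_neg (show ¬ (finFunctionFinEquiv (joinState (0 : Fin (Nat.clog 2 (n + 1) +
        Nat.clog 2 d + Nat.clog 2 p + 4) → Fin 2) z s ∘ fun j => Sum.inl (Sum.inr j)) : ℕ) < d
          from hk), dif_neg hk, mul_zero]
  · rw [if_neg hs, mul_zero]
    simp [hs]

end LJGradient

end

theorem mainTheorem8 (ε σ κ : ℝ) (hε : 0 < ε) (hσ : 0 < σ) (hκ : 0 < κ) :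
    ∃ C : ℝ, 0 < C ∧
      ∀ n d a p : ℕ, 1 ≤ n → 1 ≤ d → 1 ≤ a →
        (p = 2 * a - 1 ∨ p = 2 * a ∨ p = 2 * a + 1) →
        ∃ W : Polynomial ℝ,
          LJGradient.IsQSPApprox (LJGradient.lennardJones ε σ) d (κ / 2 ^ n)
            (((2 : ℝ) ^ n)⁻¹ ^ (2 * a + 1)) (C * ((2 : ℝ) ^ n) ^ 12)
            (C * √(d : ℝ) * p * 2 ^ n * n) W ∧
          ∀ i : Fin 2,
            ∃ (q : ℕ)
              (U : LJGradient.Circuit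
                ((Fin q ⊕ Fin (Nat.clog 2 d)) ⊕ LJGradient.SysWire d n))
              (lam : ℝ),
              q + Nat.clog 2 d
                = Nat.clog 2 (n + 1) + 2 * Nat.clog 2 d + Nat.clog 2 p + 4 ∧
              0 < lam ∧
              lam ≤ C * LJGradient.fdNorm a * d * ((2 : ℝ) ^ n) ^ 12 ∧
              LJGradient.IsBlockEncoding lam (LJGradient.Circuit.toMatrix U)
                (LJGradient.fdGradient a W i) ∧
              (U.length : ℝ) ≤ C * (d : ℝ) ^ 2 * (p : ℝ) ^ 2 * 2 ^ n * (n : ℝ) ^ 2 := by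
  obtain ⟨C, hC, h⟩ := LJGradient.exists_isQSPApprox_lennardJones ε σ κ hε hσ hκ
  refine ⟨175 + 1080 * C, by positivity, fun n d a p hn hd ha hp => ?_⟩
  obtain ⟨R, hR⟩ := h n d a p hn hd ha (by omega)
  refine ⟨R, hR.mono (by gcongr; linarith) (by gcongr; linarith), fun i => ?_⟩
  have hβ := LJGradient.fdNorm_pos ha
  have hN : (0 : ℝ) < ((2 : ℝ) ^ n) ^ 12 := by positivity
  have hΛ : 0 < 2 * C * ((2 : ℝ) ^ n) ^ 12 := by positivity
  obtain ⟨U, hU, hcount⟩ := LJGradient.exists_blockEncoding_fdGradient (p := p) hn hd ha (by omega)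
    i R hΛ fun s hs => (hR.abs_eval_le hs).trans_lt (by nlinarith)
  refine ⟨_, U, _, by ring, by positivity, ?_, hU, ?_⟩
  · have hd' : √(d : ℝ) ≤ d := Real.sqrt_le_iff.2
      ⟨by positivity, le_self_pow₀ (by exact_mod_cast hd) (by norm_num)⟩
    calc √(d : ℝ) * LJGradient.fdNorm a * (2 * C * ((2 : ℝ) ^ n) ^ 12)
        ≤ d * LJGradient.fdNorm a * ((175 + 1080 * C) * ((2 : ℝ) ^ n) ^ 12) := by
          gcongr; linarith
      _ = _ := by ring
  · exact (Nat.cast_le.2 hcount).trans (LJGradient.gate_count_le hn hd (by omega) hC hR.1)
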